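/- Let $d\in\{1,2,3\}$, $\Omega=(0,1)^d$, and let $\alpha,\tau,T>0$. Let $m_e:\bar\Omega\times[0,T]\to\mathbb S^2\subset\mathbb R^3$ solve the inertial Landau–Lifshitz–Gilbert equation $$\partial_t m=-m\times\Delta m+\alpha\, m\times(\partial_t m+\tau\,\partial_{tt}m)\quad\text{in }\Omega\times(0,T),$$ $$m(\cdot,0)=m_0,\qquad \partial_t m(\cdot,0)=0\ \text{ in }\Omega,\qquad \partial_\nu m=0\ \text{ on }\partial\Omega\times[0,T],$$ and assume $m_e\in C^3([0,T];[C^0(\bar\Omega)]^3)\cap C^2([0,T];[C^2(\bar\Omega)]^3)\cap L^\infty([0,T];[C^4(\bar\Omega)]^3)$. For an integer $N\ge1$ put $h=1/N$ and use the nodes $x_l=((l_1-\frac12)h,\dots,(l_d-\frac12)h)$, $1\le l_i\le N$. Grid functions $f$ with values in $\mathbb R^3$ are extended to the ghost points $l_i\in\{0,N+1\}$ by the value at the adjacent node. Let $\Delta_h f(x_l)=h^{-2}\sum_{i=1}^d\bigl(f(x_{l+\mathbf e_i})-2f(x_l)+f(x_{l-\mathbf e_i})\bigr)$, where $\mathbf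 e_1,\dots,\mathbf e_d$ are the coordinate unit vectors, and $$\|f\|_2^2=h^d\sum_l|f(x_l)|^2,\qquad \|\nabla_h f\|_2^2=h^d\sum_l\sum_{i=1}^d\Bigl|\frac{f(x_{l+\mathbf e_i})-f(x_l)}{h}\Bigr|^2 .$$ Let $k>0$, $t_n=nk$. A numerical solution is a sequence of grid functions $m_h^n$ such that $m_h^0,m_h^1$ take values in $\mathbb S^2$ and, for all $n\ge1$ with $n+1\le\lfloor T/k\rfloor$, with $\bar m_h^n=\frac12(m_h^{n+1}+m_h^{n-1})$, at every node, $$\frac{m_h^{n+1}-m_h^{n-1}}{2k}-\alpha\,\bar m_h^n\times\Bigl(\frac{m_h^{n+1}-m_h^{n-1}}{2k}+\tau\,\frac{m_h^{n+1}-2m_h^n+m_h^{n-1}}{k^2}\Bigr)=-\bar m_h^n\times\Delta_h\bar m_h^n .$$ Let $e_h^n=\mathcal P_h m_e(\cdot,t_n)-m_h^n$ be the error, where $\mathcal P_h m_e$ denotes the nodal values of $m_e$. Then for every $C_0$ there are constants $\mathcal C>0$ and $\delta>0$, independent of $k$, $h$ and the numerical solution, such that the following holds for all $k,h=1/N\in(0,\delta)$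 and every numerical solution: if $$\|e_h^p\|_2+\|\nabla_h e_h^p\|_2\le C_0(k^2+h^2)\ (p=0,1,2),\qquad \Bigl\|\frac{e_h^{q+1}-e_h^q}{k}\Bigr\|_2\le C_0(k^2+h^2)\ (q=0,1),$$ then $$\|\mathcal P_h m_e(\cdot,t_n)-m_h^n\|_2+\|\nabla_h(\mathcal P_h m_e(\cdot,t_n)-m_h^n)\|_2\le\mathcal C(k^2+h^2)\qquad\text{for all }2\le n\le\lfloor T/k\rfloor .$$ -/

import Mathlib

open Set MeasureTheory
open scoped Matrix

noncomputable section

namespace ILLG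

/-- Physical space `ℝ^d`. -/
abbrev Space (d : ℕ) : Type := EuclideanSpace ℝ (Fin d)

/-- The target `ℝ³` of the magnetization. Its Euclidean inner product is the dot product `⬝ᵥ`,
its vector product is `⨯₃`; the (sup) norm of the type is used only for regularity classes, where
the choice among equivalent norms does not matter. -/
abbrev Vec : Type := Fin 3 → ℝ

/-- The open unit cube `Ω = (0,1)^d`. -/
def cube (d : ℕ) : Set (Space d) := {x | ∀ i, x i ∈ Ioo (0 : ℝ) 1}

/-- The closed unit cube, the closure of `Ω`. -/
def closedCube (d : ℕ) : Set (Space d) := {x | ∀ i, x i ∈ Icc (0 : ℝ) 1}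

theorem isCompact_closedCube (d : ℕ) : IsCompact (closedCube d) := by
  have h : IsCompact (Set.pi univ fun _ : Fin d => Icc (0 : ℝ) 1) :=
    isCompact_univ_pi fun _ => isCompact_Icc
  have h2 := (EuclideanSpace.equiv (Fin d) ℝ).toHomeomorph.isCompact_preimage.2 h
  refine (congrArg IsCompact ?_).mp h2
  ext x
  simp [closedCube, Pi.le_def, forall_and]

instance (d : ℕ) : CompactSpace (closedCube d) :=
  isCompact_iff_compactSpace.1 (isCompact_closedCube d)

/-! ### Regularity classes -/

/-- `u ∈ C^j([0,T]; [C^r(Ω̄)]³)`. A function is in `C^r(Ω̄)` if it is `C^r` on the closed cube, and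
`C^r(Ω̄)` is normed by the sup norms of its derivatives of orders `0, …, r`, that is, as a closed
subspace of the product over `i ≤ r` of the Banach spaces of continuous functions on the closed
cube with values in the `i`-linear maps. So `t ↦ u t` is a `C^j` curve in `C^r(Ω̄)` if and only if
for each `i ≤ r` the curve `t ↦ D^i (u t)` is `C^j` in the `i`-th Banach space. -/
def CjIntoCr (d : ℕ) (T : ℝ) (j r : ℕ) (u : ℝ → Space d → Vec) : Prop :=
  (∀ t ∈ Icc 0 T, ContDiffOn ℝ r (u t) (closedCube d)) ∧
  ∀ i ≤ r, ∃ U : ℝ → C(closedCube d, ContinuousMultilinearMap ℝ (fun _ : Fin i => Space d) Vec),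
    (∀ t ∈ Icc 0 T, ∀ x : closedCube d,
      U t x = iteratedFDerivWithin ℝ i (u t) (closedCube d) x) ∧
    ContDiffOn ℝ j U (Icc 0 T)

/-- `u ∈ L^∞([0,T]; [C^r(Ω̄)]³)`: for almost every `t` the function `u t` is in `C^r(Ω̄)`, with a
norm bound that does not depend on `t`. (Measurability in `t` is not demanded.) -/
def LinftyIntoCr (d : ℕ) (T : ℝ) (r : ℕ) (u : ℝ → Space d → Vec) : Prop :=
  ∃ M : ℝ, ∀ᵐ t ∂(volume.restrict (Icc (0 : ℝ) T)),
    ContDiffOn ℝ r (u t) (closedCube d) ∧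
    ∀ i ≤ r, ∀ x ∈ closedCube d, ‖iteratedFDerivWithin ℝ i (u t) (closedCube d) x‖ ≤ M

/-! ### The inertial Landau–Lifshitz–Gilbert equation -/

/-- `m` (time first, then space) solves the inertial LLG equation with damping parameter `α` and
inertia parameter `τ`, without external field, on `Ω × (0,T)`. -/
structure IsSolution (d : ℕ) (α τ T : ℝ) (m₀ : Space d → Vec) (m : ℝ → Space d → Vec) : Prop where
  /-- `m` takes values in the unit sphere. -/
  unit : ∀ t ∈ Icc 0 T, ∀ x ∈ closedCube d, m t x ⬝ᵥ m t x = 1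
  /-- `∂ₜm = -m × Δm + α m × (∂ₜm + τ ∂ₜₜm)`. -/
  eqn : ∀ t ∈ Ioo 0 T, ∀ x ∈ cube d,
    deriv (fun s => m s x) t =
      -(m t x ⨯₃ Laplacian.laplacian (m t) x) +
        α • (m t x ⨯₃ (deriv (fun s => m s x) t + τ • iteratedDeriv 2 (fun s => m s x) t))
  initial : ∀ x ∈ cube d, m 0 x = m₀ x
  initial_velocity : ∀ x ∈ cube d, derivWithin (fun s => m s x) (Icc 0 T) 0 = 0
  /-- Homogeneous Neumann condition: on the faces `x i = 0` and `x i = 1` the normal direction is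
  the `i`-th coordinate direction. -/
  neumann : ∀ t ∈ Icc 0 T, ∀ x ∈ closedCube d, ∀ i, (x i = 0 ∨ x i = 1) →
    fderivWithin ℝ (m t) (closedCube d) x (EuclideanSpace.single i 1) = 0

/-! ### The grid -/

/-- The index set of the cell-centred nodes, `N` in each direction (indices start at `0`). -/
abbrev Idx (d N : ℕ) : Type := Fin d → Fin N

/-- Vector-valued grid functions. -/
abbrev Grid (d N : ℕ) : Type := Idx d N → Vec

/-- The mesh size `h = 1 / N`. -/
def mesh (N : ℕ) : ℝ := 1 / N

/-- The node with index `l`; with indices starting at `0` its coordinates are `(l i + 1/2) h`. -/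
def node {d N : ℕ} (l : Idx d N) : Space d := WithLp.toLp 2 fun i => ((l i : ℝ) + 1 / 2) * mesh N

/-- The neighbour of `l` in direction `+i`. If it is a ghost point, its value is by the
extrapolation formula the value at `l`, so it is represented by `l` itself. -/
def next {d N : ℕ} (i : Fin d) (l : Idx d N) : Idx d N :=
  Function.update l i (if hi : (l i : ℕ) + 1 < N then ⟨(l i : ℕ) + 1, hi⟩ else l i)

/-- The neighbour of `l` in direction `-i`, with the same convention for ghost points (the
subtraction is truncated, `0 - 1 = 0`). -/
def prev {d N : ℕ} (i : Fin d) (l : Idx d N) : Idx d N :=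
  Function.update l i ⟨(l i : ℕ) - 1, lt_of_le_of_lt (Nat.sub_le _ _) (l i).isLt⟩

/-- The standard `(2d+1)`-point discrete Laplacian with the Neumann extrapolation. -/
def discLaplacian {d N : ℕ} (f : Grid d N) : Grid d N := fun l =>
  ∑ i, (1 / mesh N ^ 2) • (f (next i l) - (2 : ℝ) • f l + f (prev i l))

/-- Component `i` of the discrete gradient `∇_h f`: the central difference about the midpoint
between `l` and its neighbour in direction `+i` (it vanishes on the boundary faces). -/
def discGrad {d N : ℕ} (i : Fin d) (f : Grid d N) : Grid d N := fun l =>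
  (1 / mesh N) • (f (next i l) - f l)

/-- The discrete norm `‖f‖₂`. -/
def normTwo {d N : ℕ} (f : Grid d N) : ℝ := √(mesh N ^ d * ∑ l, f l ⬝ᵥ f l)

/-- The discrete norm `‖∇_h f‖₂` of the full discrete gradient. -/
def normGrad {d N : ℕ} (f : Grid d N) : ℝ :=
  √(mesh N ^ d * ∑ l, ∑ i, discGrad i f l ⬝ᵥ discGrad i f l)

/-- Nodal values of a function, on which the nodal interpolant agrees with it. -/
def nodal {d : ℕ} (N : ℕ) (u : Space d → Vec) : Grid d N := fun l => u (node l)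

/-! ### The scheme -/

/-- `d_t f^{n+1} = (f^{n+1} - f^{n-1}) / (2k)`, centred at time level `n ≥ 1`. -/
def timeDiff {d N : ℕ} (k : ℝ) (f : ℕ → Grid d N) (n : ℕ) : Grid d N :=
  (1 / (2 * k)) • (f (n + 1) - f (n - 1))

/-- `d_tt f^n = (f^{n+1} - 2 f^n + f^{n-1}) / k²`, for `n ≥ 1`. -/
def timeDiffTwo {d N : ℕ} (k : ℝ) (f : ℕ → Grid d N) (n : ℕ) : Grid d N :=
  (1 / k ^ 2) • (f (n + 1) - (2 : ℝ) • f n + f (n - 1))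

/-- `(f^{n+1} + f^{n-1}) / 2`, for `n ≥ 1`. -/
def timeMean {d N : ℕ} (f : ℕ → Grid d N) (n : ℕ) : Grid d N :=
  (1 / 2 : ℝ) • (f (n + 1) + f (n - 1))

/-- `mh` is a numerical solution of the three-level implicit midpoint scheme with time step `k`, up
to time level `⌊T/k⌋`: two starting fields with values in the unit sphere, and then
`d_t m^{n+1} - α m̄^n × (d_t m^{n+1} + τ d_tt m^n) = - m̄^n × Δ_h m̄^n` at each node. -/
structure IsNumerical {d N : ℕ} (α τ T k : ℝ) (mh : ℕ → Grid d N) : Prop where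
  unit_zero : ∀ l, mh 0 l ⬝ᵥ mh 0 l = 1
  unit_one : ∀ l, mh 1 l ⬝ᵥ mh 1 l = 1
  scheme : ∀ n, 1 ≤ n → n + 1 ≤ ⌊T / k⌋₊ → ∀ l,
    timeDiff k mh n l - α • (timeMean mh n l ⨯₃ (timeDiff k mh n l + τ • timeDiffTwo k mh n l)) =
      -(timeMean mh n l ⨯₃ discLaplacian (timeMean mh n) l)

/-- The error `e_h^n = P_h m(·, t_n) - m_h^n` with `t_n = n k`. -/
def error {d N : ℕ} (k : ℝ) (m : ℝ → Space d → Vec) (mh : ℕ → Grid d N) (n : ℕ) : Grid d N :=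
  nodal N (m (n * k)) - mh n

end ILLG

end

noncomputable section

namespace ILLG

section

/-! ### Algebra of dot and cross products -/

/-! The exact solution stays on the sphere, so its mean `u` over `t ± k` is exactly orthogonal to
its centred difference quotient `D`. Hence `D = u × V` holds without any error for a whole family of
fields `V`, whose component along `u` is free. `effField` fixes this component through the gradient
and `D`. Then `V` contains first derivatives only, so it is bounded and Lipschitz in space and time,
and still it agrees up to `O(k² + h²)` with the discrete field `α D + α τ D₂ - Δ_h u`, where `D₂` is
the second difference quotient. With `ρ` for the discrepancy, subtraction of the scheme gives
(`error_equation`) `De = eb × V + A × (w + ρ)`, `w = α De + α τ D2 - Δ_h eb`, where `eb`, `De`, `D2`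
are the mean and the difference quotients of the error and `A` is the numerical mean.

Testing with `w + ρ` removes the term with `A`, so the nonlinearity costs no bound on the numerical
solution, no inverse inequality and no coupling of `k` and `h`. The left side yields the kinetic
energy due to inertia and the gradient energy. On the right, the second difference quotient is
summed by parts in time and the discrete Laplacian in space. Because `(x × V) · x = 0`, every
difference that falls on the error cancels, and only differences of `V` survive (`energy_identity`,
`abs_ip_gcross_discLaplacian_le`). A corrected energy is coercive, and Gronwall's inequality gives
stability (`exists_errSq_le`).

Consistency of second order needs two facts beyond the assumed regularity. The first is four bounded
time derivatives, which come from solving the equation for the second one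
(`exists_second_deriv_chain`). The second is that third normal derivatives vanish on the faces, for
otherwise the ghost values spoil the discrete Laplacian; this follows from the equation together
with the constraint (`cubeDeriv_three_normal`). `exists_solutionBounds` collects the resulting
bounds, and `norm_field_sub_le` is the consistency estimate. -/

theorem dot_self_nonneg (a : Vec) : 0 ≤ a ⬝ᵥ a := by
  simp only [dotProduct]; exact Finset.sum_nonneg fun i _ => mul_self_nonneg _

theorem dot_cross_self_right (a b : Vec) : (a ⨯₃ b) ⬝ᵥ b = 0 := by
  simp [cross_apply, dotProduct, Fin.sum_univ_three]; ring

theorem dot_cross_self_left (a b : Vec) : (a ⨯₃ b) ⬝ᵥ a = 0 := by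
  simp [cross_apply, dotProduct, Fin.sum_univ_three]; ring

theorem dot_sq_le (a b : Vec) : (a ⬝ᵥ b) ^ 2 ≤ (a ⬝ᵥ a) * (b ⬝ᵥ b) := by
  simp only [dotProduct, Fin.sum_univ_three]
  nlinarith [sq_nonneg (a 0 * b 1 - a 1 * b 0), sq_nonneg (a 0 * b 2 - a 2 * b 0),
    sq_nonneg (a 1 * b 2 - a 2 * b 1)]

theorem cross_dot_cross_le (a b : Vec) : (a ⨯₃ b) ⬝ᵥ (a ⨯₃ b) ≤ (a ⬝ᵥ a) * (b ⬝ᵥ b) := by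
  have h : (a ⨯₃ b) ⬝ᵥ (a ⨯₃ b) = (a ⬝ᵥ a) * (b ⬝ᵥ b) - (a ⬝ᵥ b) ^ 2 := by
    simp [cross_apply, dotProduct, Fin.sum_univ_three]; ring
  rw [h]; linarith [sq_nonneg (a ⬝ᵥ b)]

theorem cross_dot_sq_le (a x g : Vec) {b : ℝ} (hx : x ⬝ᵥ x ≤ b ^ 2) :
    ((a ⨯₃ x) ⬝ᵥ g) ^ 2 ≤ b ^ 2 * (a ⬝ᵥ a) * (g ⬝ᵥ g) := by
  calc ((a ⨯₃ x) ⬝ᵥ g) ^ 2 ≤ ((a ⨯₃ x) ⬝ᵥ (a ⨯₃ x)) * (g ⬝ᵥ g) := dot_sq_le _ _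
    _ ≤ ((a ⬝ᵥ a) * (x ⬝ᵥ x)) * (g ⬝ᵥ g) :=
      mul_le_mul_of_nonneg_right (cross_dot_cross_le _ _) (dot_self_nonneg g)
    _ ≤ ((a ⬝ᵥ a) * b ^ 2) * (g ⬝ᵥ g) :=
      mul_le_mul_of_nonneg_right (mul_le_mul_of_nonneg_left hx (dot_self_nonneg a))
        (dot_self_nonneg g)
    _ = _ := by ring

/-! ### The discrete inner product -/

variable {d N : ℕ}

/-- The discrete inner product of grid functions. -/
def ip (f g : Grid d N) : ℝ := mesh N ^ d * ∑ l, f l ⬝ᵥ g l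

/-- The square of the discrete norm of the discrete gradient. -/
def gradSq (f : Grid d N) : ℝ := ∑ i, ip (discGrad i f) (discGrad i f)

/-- The pointwise vector product of grid functions. -/
def gcross (f g : Grid d N) : Grid d N := fun l => f l ⨯₃ g l

theorem mesh_nonneg : 0 ≤ mesh N := by unfold mesh; positivity

theorem mesh_pos (hN : 0 < N) : 0 < mesh N := by unfold mesh; positivity

theorem ip_comm (f g : Grid d N) : ip f g = ip g f := by
  simp only [ip, dotProduct_comm]

theorem ip_add_left (f f' g : Grid d N) : ip (f + f') g = ip f g + ip f' g := by
  simp only [ip, Pi.add_apply, add_dotProduct, Finset.sum_add_distrib, mul_add]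

theorem ip_sub_left (f f' g : Grid d N) : ip (f - f') g = ip f g - ip f' g := by
  simp only [ip, Pi.sub_apply, sub_dotProduct, Finset.sum_sub_distrib, mul_sub]

theorem ip_smul_left (c : ℝ) (f g : Grid d N) : ip (c • f) g = c * ip f g := by
  simp only [ip, Pi.smul_apply, smul_dotProduct, smul_eq_mul, ← Finset.mul_sum]; ring

theorem ip_add_right (f g g' : Grid d N) : ip f (g + g') = ip f g + ip f g' := by
  simp only [ip_comm f, ip_add_left]

theorem ip_sub_right (f g g' : Grid d N) : ip f (g - g') = ip f g - ip f g' := by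
  simp only [ip_comm f, ip_sub_left]

theorem ip_smul_right (c : ℝ) (f g : Grid d N) : ip f (c • g) = c * ip f g := by
  simp only [ip_comm f, ip_smul_left]

theorem ip_self_nonneg (f : Grid d N) : 0 ≤ ip f f :=
  mul_nonneg (pow_nonneg mesh_nonneg _) (Finset.sum_nonneg fun _ _ => dot_self_nonneg _)

theorem gradSq_nonneg (f : Grid d N) : 0 ≤ gradSq f :=
  Finset.sum_nonneg fun _ _ => ip_self_nonneg _

/-- The `N ^ d` nodes carry weights `mesh N ^ d`, of total mass one. -/
theorem ip_self_le (hN : 0 < N) {f : Grid d N} {b : ℝ} (h : ∀ l, f l ⬝ᵥ f l ≤ b) : ip f f ≤ b := by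
  have h1 : ip f f ≤ mesh N ^ d * ∑ _l : Idx d N, b :=
    mul_le_mul_of_nonneg_left (Finset.sum_le_sum fun l _ => h l) (pow_nonneg mesh_nonneg _)
  have h2 : mesh N ^ d * ∑ _l : Idx d N, b = b := by
    have : (N : ℝ) ≠ 0 := by positivity
    simp [mesh]; field_simp
  linarith

theorem normTwo_sq (f : Grid d N) : normTwo f ^ 2 = ip f f :=
  Real.sq_sqrt (ip_self_nonneg f)

theorem gradSq_eq (f : Grid d N) :
    gradSq f = mesh N ^ d * ∑ l, ∑ i, discGrad i f l ⬝ᵥ discGrad i f l := by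
  simp only [gradSq, ip, ← Finset.mul_sum]
  rw [Finset.sum_comm]

theorem normGrad_sq (f : Grid d N) : normGrad f ^ 2 = gradSq f := by
  rw [normGrad, ← gradSq_eq, Real.sq_sqrt (gradSq_nonneg f)]

theorem two_mul_ip_le (f g : Grid d N) : 2 * |ip f g| ≤ ip f f + ip g g := by
  have h1 := ip_self_nonneg (f + g)
  have h2 := ip_self_nonneg (f - g)
  simp only [ip_add_left, ip_add_right, ip_sub_left, ip_sub_right, ip_comm g f] at h1 h2
  rcases abs_cases (ip f g) with h | h <;> linarith

theorem ip_add_self_le (f g : Grid d N) : ip (f + g) (f + g) ≤ 2 * (ip f f + ip g g) := by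
  have h2 := ip_self_nonneg (f - g)
  simp only [ip_add_left, ip_add_right, ip_sub_left, ip_sub_right, ip_comm g f] at *
  linarith

theorem abs_ip_le_of {f g f' g' : Grid d N} {a b : ℝ}
    (h : ∀ l, |f l ⬝ᵥ g l| ≤ a * (f' l ⬝ᵥ f' l) + b * (g' l ⬝ᵥ g' l)) :
    |ip f g| ≤ a * ip f' f' + b * ip g' g' := by
  have h0 : 0 ≤ mesh N ^ d := pow_nonneg mesh_nonneg _
  rw [ip, abs_mul, abs_of_nonneg h0]
  calc mesh N ^ d * |∑ l, f l ⬝ᵥ g l|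
      ≤ mesh N ^ d * ∑ l, (a * (f' l ⬝ᵥ f' l) + b * (g' l ⬝ᵥ g' l)) := by
        gcongr
        exact (Finset.abs_sum_le_sum_abs _ _).trans (Finset.sum_le_sum fun l _ => h l)
    _ = _ := by
        simp only [ip, Finset.sum_add_distrib, ← Finset.mul_sum]; ring

theorem abs_ip_gcross_le {b : ℝ} (hb : 0 ≤ b) {f X g : Grid d N} (hX : ∀ l, X l ⬝ᵥ X l ≤ b ^ 2) :
    |ip (gcross f X) g| ≤ b / 2 * ip f f + b / 2 * ip g g := by
  refine abs_ip_le_of fun l => abs_le_of_sq_le_sq ?_ ?_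
  · have h := cross_dot_sq_le (f l) (X l) (g l) (hX l)
    refine h.trans ?_
    nlinarith [mul_nonneg (sq_nonneg b) (sq_nonneg (f l ⬝ᵥ f l - g l ⬝ᵥ g l))]
  · have := dot_self_nonneg (f l); have := dot_self_nonneg (g l); positivity

/-- Young's inequality with unequal weights: the factor `1 / 4` on `g` lets the kinetic energy,
which has factor `1 / 2`, absorb the correction term of `energy`. -/
theorem abs_ip_gcross_le' {b : ℝ} {f X g : Grid d N} (hX : ∀ l, X l ⬝ᵥ X l ≤ b ^ 2) :
    |ip (gcross f X) g| ≤ b ^ 2 * ip f f + 1 / 4 * ip g g := by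
  refine abs_ip_le_of fun l => abs_le_of_sq_le_sq ?_ ?_
  · have h := cross_dot_sq_le (f l) (X l) (g l) (hX l)
    refine h.trans ?_
    nlinarith [sq_nonneg (b ^ 2 * (f l ⬝ᵥ f l) - 1 / 4 * (g l ⬝ᵥ g l))]
  · have := dot_self_nonneg (f l); have := dot_self_nonneg (g l); positivity

theorem ip_gcross_left_self (f g : Grid d N) : ip (gcross f g) f = 0 := by
  simp [ip, gcross, dot_cross_self_left]

theorem gcross_add_left (f f' g : Grid d N) : gcross (f + f') g = gcross f g + gcross f' g := by
  ext l : 1; simp [gcross]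

theorem gcross_smul_left (c : ℝ) (f g : Grid d N) : gcross (c • f) g = c • gcross f g := by
  ext l : 1; simp [gcross]

theorem gcross_sub_right (f g g' : Grid d N) : gcross f (g - g') = gcross f g - gcross f g' := by
  ext l : 1; simp [gcross]

/-! ### Summation by parts -/

theorem next_apply_same {i : Fin d} {l : Idx d N} (h : (l i : ℕ) + 1 < N) :
    ((next i l) i : ℕ) = l i + 1 := by simp [next, h]

theorem prev_apply_same (i : Fin d) (l : Idx d N) : ((prev i l) i : ℕ) = l i - 1 := by simp [prev]

theorem next_eq_self {i : Fin d} {l : Idx d N} (h : ¬ (l i : ℕ) + 1 < N) : next i l = l := by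
  simp [next, h]

theorem prev_eq_self {i : Fin d} {l : Idx d N} (h : (l i : ℕ) = 0) : prev i l = l := by
  unfold prev
  convert Function.update_eq_self i l
  simp [h]

theorem prev_next {i : Fin d} {l : Idx d N} (h : (l i : ℕ) + 1 < N) : prev i (next i l) = l := by
  unfold prev
  rw [next, Function.update_idem]
  convert Function.update_eq_self i l
  simp [h]

theorem next_prev {i : Fin d} {l : Idx d N} (h : 0 < (l i : ℕ)) : next i (prev i l) = l := by
  have h1 : ((prev i l) i : ℕ) + 1 = l i := by rw [prev_apply_same]; omega
  have h2 : ((prev i l) i : ℕ) + 1 < N := by rw [h1]; exact (l i).isLt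
  unfold next
  rw [dif_pos h2]
  simp only [prev, Function.update_idem]
  convert Function.update_eq_self i l
  simp; omega

/-- Both sums run over the interior faces in direction `i`, seen from either side. At the boundary
the neighbour is `l` itself, and `hφ` removes that term; this is where the Neumann extrapolation
makes boundary contributions disappear. -/
theorem sum_prev_eq_sum_next (i : Fin d) (φ : Idx d N → Idx d N → ℝ) (hφ : ∀ l, φ l l = 0) :
    ∑ l, φ l (prev i l) = ∑ l, φ (next i l) l := by
  rw [← Finset.sum_filter_of_ne (p := fun l : Idx d N => 0 < (l i : ℕ))
      (f := fun l => φ l (prev i l)),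
    ← Finset.sum_filter_of_ne (p := fun l : Idx d N => (l i : ℕ) + 1 < N)
      (f := fun l => φ (next i l) l)]
  · refine Finset.sum_nbij' (prev i) (next i) ?_ ?_ ?_ ?_ ?_
    · intro l hl
      simp only [Finset.mem_filter, Finset.mem_univ, true_and] at hl ⊢
      rw [prev_apply_same]; have := (l i).isLt; omega
    · intro l hl
      simp only [Finset.mem_filter, Finset.mem_univ, true_and] at hl ⊢
      rw [next_apply_same hl]; omega
    · intro l hl
      exact next_prev (by simpa using hl)
    · intro l hl
      exact prev_next (by simpa using hl)
    · intro l hl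
      rw [next_prev (by simpa using hl)]
  · intro l _ h
    by_contra hl
    exact h (by rw [next_eq_self hl, hφ])
  · intro l _ h
    by_contra hl
    exact h (by rw [prev_eq_self (by omega), hφ])

/-- Discrete integration by parts with the Neumann extrapolation. -/
theorem ip_discLaplacian (f g : Grid d N) :
    ip f (discLaplacian g) = - ∑ i, ip (discGrad i f) (discGrad i g) := by
  have key : ∀ i, ∑ l, f l ⬝ᵥ (g (next i l) - (2 : ℝ) • g l + g (prev i l)) =
      - ∑ l, (f (next i l) - f l) ⬝ᵥ (g (next i l) - g l) := by
    intro i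
    have h1 := sum_prev_eq_sum_next i (fun l l' => f l ⬝ᵥ (g l - g l')) (by simp)
    have h2 : ∑ l, f l ⬝ᵥ (g (next i l) - (2 : ℝ) • g l + g (prev i l)) =
        ∑ l, f l ⬝ᵥ (g (next i l) - g l) - ∑ l, f l ⬝ᵥ (g l - g (prev i l)) := by
      rw [← Finset.sum_sub_distrib]
      refine Finset.sum_congr rfl fun l _ => ?_
      simp only [dotProduct_add, dotProduct_sub, dotProduct_smul, smul_eq_mul]; ring
    rw [h2, h1, ← Finset.sum_sub_distrib, ← Finset.sum_neg_distrib]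
    refine Finset.sum_congr rfl fun l _ => ?_
    simp only [sub_dotProduct]; ring
  simp only [ip, discLaplacian, discGrad, dotProduct_sum, dotProduct_smul, smul_dotProduct,
    smul_eq_mul, ← Finset.mul_sum]
  rw [Finset.sum_comm]
  simp only [key, Finset.sum_neg_distrib]
  ring

theorem discGrad_add (i : Fin d) (f g : Grid d N) :
    discGrad i (f + g) = discGrad i f + discGrad i g := by
  ext l : 1; simp only [discGrad, Pi.add_apply, ← smul_add]; congr 1; abel

theorem discGrad_sub (i : Fin d) (f g : Grid d N) :
    discGrad i (f - g) = discGrad i f - discGrad i g := by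
  ext l : 1; simp only [discGrad, Pi.sub_apply, ← smul_sub]; congr 1; abel

theorem discGrad_smul (i : Fin d) (c : ℝ) (f : Grid d N) :
    discGrad i (c • f) = c • discGrad i f := by
  ext l : 1; simp only [discGrad, Pi.smul_apply, ← smul_sub]; rw [smul_comm]

theorem discLaplacian_sub (f g : Grid d N) :
    discLaplacian (f - g) = discLaplacian f - discLaplacian g := by
  ext l : 1
  simp only [discLaplacian, Pi.sub_apply, ← Finset.sum_sub_distrib]
  refine Finset.sum_congr rfl fun i _ => ?_
  rw [← smul_sub]; congr 1; module

theorem discLaplacian_add (f g : Grid d N) :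
    discLaplacian (f + g) = discLaplacian f + discLaplacian g := by
  ext l : 1
  simp only [discLaplacian, Pi.add_apply, ← Finset.sum_add_distrib]
  refine Finset.sum_congr rfl fun i _ => ?_
  rw [← smul_add]; congr 1; module

theorem discLaplacian_smul (c : ℝ) (f : Grid d N) :
    discLaplacian (c • f) = c • discLaplacian f := by
  ext l : 1
  simp only [discLaplacian, Pi.smul_apply, Finset.smul_sum]
  refine Finset.sum_congr rfl fun i _ => ?_
  module

theorem gradSq_add_le (f g : Grid d N) : gradSq (f + g) ≤ 2 * (gradSq f + gradSq g) := by
  simp only [gradSq, ← Finset.sum_add_distrib, Finset.mul_sum, discGrad_add]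
  exact Finset.sum_le_sum fun i _ => ip_add_self_le _ _

theorem gradSq_smul (c : ℝ) (f : Grid d N) : gradSq (c • f) = c ^ 2 * gradSq f := by
  simp only [gradSq, discGrad_smul, ip_smul_left, ip_smul_right, Finset.mul_sum]
  refine Finset.sum_congr rfl fun i _ => by ring

/-- Testing `f × V` with the discrete Laplacian of `f` only costs the gradient of `V`. -/
theorem abs_ip_gcross_discLaplacian_le {b : ℝ} (hb : 0 ≤ b) {f V : Grid d N}
    (hV : ∀ i l, discGrad i V l ⬝ᵥ discGrad i V l ≤ b ^ 2) :
    |ip (gcross f V) (discLaplacian f)| ≤ b / 2 * (d * ip f f) + b / 2 * gradSq f := by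
  rw [ip_discLaplacian, abs_neg]
  have h : ∀ i, ip (discGrad i (gcross f V)) (discGrad i f) =
      ip (gcross f (discGrad i V)) (discGrad i f) := by
    intro i
    simp only [ip]
    congr 1
    refine Finset.sum_congr rfl fun l _ => ?_
    simp only [discGrad, gcross]
    -- Discrete product rule. The term in which the difference falls on `f` is orthogonal to the
    -- gradient of `f` that it is tested with.
    have : f (next i l) ⨯₃ V (next i l) - f l ⨯₃ V l =
        (f (next i l) - f l) ⨯₃ V (next i l) + f l ⨯₃ (V (next i l) - V l) := by
      simp only [map_sub, LinearMap.sub_apply]; abel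
    rw [this]
    simp only [smul_add, add_dotProduct, smul_dotProduct, dotProduct_smul, dot_cross_self_left,
      map_smul, smul_zero, zero_add]
  simp only [h]
  calc |∑ i, ip (gcross f (discGrad i V)) (discGrad i f)|
      ≤ ∑ i, |ip (gcross f (discGrad i V)) (discGrad i f)| := Finset.abs_sum_le_sum_abs _ _
    _ ≤ ∑ i : Fin d, (b / 2 * ip f f + b / 2 * ip (discGrad i f) (discGrad i f)) :=
        Finset.sum_le_sum fun i _ => abs_ip_gcross_le hb (hV i)
    _ = _ := by
        simp [Finset.sum_add_distrib, gradSq, Finset.mul_sum]; ring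

end

section

variable {d N : ℕ}

/-! ### The energy estimate -/

/-- Energy identity over one time step of the error equation. -/
theorem energy_identity {α τ k : ℝ} (hk : 0 < k)
    {e0 e1 e2 V V' ρ A De D2 eb δ0 δ1 : Grid d N}
    (hDe : De = (1 / 2 : ℝ) • (δ1 + δ0)) (hD2 : D2 = (1 / k) • (δ1 - δ0))
    (heb : eb = (1 / 2 : ℝ) • (e2 + e0))
    (h1 : e2 = e1 + k • δ1) (h0 : e1 = e0 + k • δ0)
    (heq : ∀ l, De l = eb l ⨯₃ V l +
      A l ⨯₃ ((α • De + (α * τ) • D2 - discLaplacian eb) l + ρ l)) :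
    (α * τ / 2 * ip δ1 δ1 + (gradSq e2 + gradSq e1) / 4 - α * τ * ip (gcross e1 V) δ1) -
      (α * τ / 2 * ip δ0 δ0 + (gradSq e1 + gradSq e0) / 4 - α * τ * ip (gcross e0 V') δ0) =
      k * (- α * ip De De - ip De ρ + α * ip (gcross eb V) De -
        ip (gcross eb V) (discLaplacian eb) + ip (gcross eb V) ρ) -
        α * τ * ip (gcross e0 (V - V')) δ0 := by
  set w : Grid d N := α • De + (α * τ) • D2 - discLaplacian eb with hw
  -- testing the error equation with `w + ρ`
  have htest : ip De (w + ρ) = ip (gcross eb V) (w + ρ) := by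
    simp only [ip]
    congr 1
    refine Finset.sum_congr rfl fun l _ => ?_
    have := heq l
    simp only [Pi.add_apply, gcross]
    rw [this, add_dotProduct, dot_cross_self_right, add_zero]
  -- The outer mean is the middle value plus `k² / 2` times the second difference quotient, and that
  -- correction is invisible when tested with `D2`.
  have hgc : gcross eb V = gcross e1 V + (k ^ 2 / 2) • gcross D2 V := by
    rw [← gcross_smul_left, ← gcross_add_left]
    congr 1
    rw [heb, hD2, h1, h0]
    have : (k ^ 2 / 2) * (1 / k) = k / 2 := by field_simp
    rw [smul_smul, this]; module
  have hD2t : ip (gcross eb V) D2 = ip (gcross e1 V) D2 := by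
    rw [hgc, ip_add_left, ip_smul_left, ip_gcross_left_self]; ring
  -- Summation by parts in time. Replacing `e1` by `e0` in front of `δ0` is free because `e1 - e0`
  -- is a multiple of `δ0`, so the expression telescopes up to the increment `V - V'`.
  have hkD2 : k * ip (gcross e1 V) D2 =
      ip (gcross e1 V) δ1 - ip (gcross e0 V') δ0 - ip (gcross e0 (V - V')) δ0 := by
    rw [hD2, ip_smul_right, ip_sub_right]
    have e : ip (gcross e1 V) δ0 = ip (gcross e0 V) δ0 := by
      rw [h0, gcross_add_left, gcross_smul_left, ip_add_left, ip_smul_left,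
        ip_gcross_left_self]; ring
    rw [e, gcross_sub_right, ip_sub_left]
    field_simp; ring
  have hDD2 : k * ip De D2 = (ip δ1 δ1 - ip δ0 δ0) / 2 := by
    rw [hDe, hD2]
    simp only [ip_smul_left, ip_smul_right, ip_sub_right, ip_add_left, ip_comm δ0 δ1]
    field_simp; ring
  have hlap : k * ip De (discLaplacian eb) = - ((gradSq e2 - gradSq e0) / 4) := by
    have hDe' : De = (1 / (2 * k)) • (e2 - e0) := by
      rw [hDe, h1, h0]
      have : 1 / 2 = (1 / (2 * k)) * k := by field_simp
      rw [this]; module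
    rw [ip_discLaplacian, hDe', heb]
    have : ∀ i, ip (discGrad i ((1 / (2 * k)) • (e2 - e0))) (discGrad i ((1 / 2 : ℝ) • (e2 + e0)))
        = 1 / (4 * k) * (ip (discGrad i e2) (discGrad i e2) -
          ip (discGrad i e0) (discGrad i e0)) := by
      intro i
      simp only [discGrad_smul, discGrad_sub, discGrad_add, ip_smul_left, ip_smul_right,
        ip_sub_left, ip_add_right, ip_comm (discGrad i e0) (discGrad i e2)]
      field_simp; ring
    simp only [this, ← Finset.mul_sum, Finset.sum_sub_distrib]
    simp only [gradSq]
    field_simp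
  have hexp : α * ip De De + α * τ * ip De D2 - ip De (discLaplacian eb) + ip De ρ =
      α * ip (gcross eb V) De + α * τ * ip (gcross e1 V) D2 -
        ip (gcross eb V) (discLaplacian eb) + ip (gcross eb V) ρ := by
    have := htest
    rw [hw] at this
    simp only [ip_add_right, ip_sub_right, ip_smul_right, hD2t] at this
    linarith
  linear_combination α * τ * hkD2 - α * τ * hDD2 + hlap + k * hexp

/-- The bookkeeping of `energy_step`: the `x`'s stand for the terms on the right of
`energy_identity`, and `S` for the squared quantities that dominate them. -/
theorem energy_bound_aux {a t k B d S x1 x2 x3 x4 x5 x6 : ℝ} (ha : 0 ≤ a) (ht : 0 ≤ t) (hk : 0 ≤ k)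
    (hB : 0 ≤ B) (hd : 0 ≤ d) (hS : 0 ≤ S) (t1 : x1 ≤ 0) (t2 : x2 ≤ S / 4 + B ^ 2 * S / 2)
    (t3 : x3 ≤ a * (B / 2 * S)) (t4 : x4 ≤ B / 2 * (d * (S / 2)) + B / 2 * (S / 2))
    (t5 : x5 ≤ B / 2 * (S / 2) + B / 2 * (B ^ 2 * S)) (t6 : x6 ≤ k * (t * (B / 2 * S))) :
    k * (x1 + x2 + x3 + x4 + x5) + x6 ≤
      k * ((1 + (1 + a + d + t) * B + (1 + B) * B ^ 2) * S) := by
  have h1 : k * (x1 + x2 + x3 + x4 + x5) ≤ k * (0 + (S / 4 + B ^ 2 * S / 2) + a * (B / 2 * S) +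
      (B / 2 * (d * (S / 2)) + B / 2 * (S / 2)) + (B / 2 * (S / 2) + B / 2 * (B ^ 2 * S))) :=
    mul_le_mul_of_nonneg_left (by linarith) hk
  have h2 : 0 ≤ k * (3 / 4 * S + B ^ 2 * S / 2 + a * (B / 2 * S) + 3 / 4 * (B * (d * S)) +
      B / 2 * S + B / 2 * (B ^ 2 * S) + t * (B / 2 * S)) := by positivity
  linarith

/-- Energy balance over one time step of the error equation. -/
theorem energy_step {α τ k B ε : ℝ} (hα : 0 < α) (hτ : 0 < τ) (hk : 0 < k) (hB : 0 ≤ B)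
    (hN : 0 < N) {e0 e1 e2 V V' ρ A De D2 eb δ0 δ1 : Grid d N}
    (hDe : De = (1 / 2 : ℝ) • (δ1 + δ0)) (hD2 : D2 = (1 / k) • (δ1 - δ0))
    (heb : eb = (1 / 2 : ℝ) • (e2 + e0))
    (h1 : e2 = e1 + k • δ1) (h0 : e1 = e0 + k • δ0)
    (heq : ∀ l, De l = eb l ⨯₃ V l +
      A l ⨯₃ ((α • De + (α * τ) • D2 - discLaplacian eb) l + ρ l))
    (hV : ∀ l, V l ⬝ᵥ V l ≤ B ^ 2) (hρ : ∀ l, ρ l ⬝ᵥ ρ l ≤ (B * ε) ^ 2)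
    (hVx : ∀ i l, discGrad i V l ⬝ᵥ discGrad i V l ≤ B ^ 2)
    (hVt : ∀ l, (V l - V' l) ⬝ᵥ (V l - V' l) ≤ (B * k) ^ 2) :
    (α * τ / 2 * ip δ1 δ1 + (gradSq e2 + gradSq e1) / 4 - α * τ * ip (gcross e1 V) δ1) -
      (α * τ / 2 * ip δ0 δ0 + (gradSq e1 + gradSq e0) / 4 - α * τ * ip (gcross e0 V') δ0) ≤
    k * ((1 + (1 + α + d + α * τ) * B + (1 + B) * B ^ 2) *
      (ip δ1 δ1 + ip δ0 δ0 + ip e2 e2 + ip e0 e0 + gradSq e2 + gradSq e0 + ε ^ 2)) := by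
  have hDe0 := ip_self_nonneg De
  have b1 := abs_le.1 (abs_ip_gcross_le (f := eb) (g := De) hB hV)
  have b2 := abs_le.1 (abs_ip_gcross_le (f := eb) (g := ρ) hB hV)
  have b3 := abs_le.1 (abs_ip_gcross_discLaplacian_le (f := eb) hB hVx)
  have b4 := abs_le.1 (abs_ip_gcross_le (f := e0) (g := δ0) (X := V - V')
    (mul_nonneg hB hk.le) hVt)
  have b5 := two_mul_ip_le De ρ
  have b5' := neg_abs_le (ip De ρ)
  have b6 : ip ρ ρ ≤ (B * ε) ^ 2 := ip_self_le hN hρ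
  have b7 : ip De De ≤ (ip δ1 δ1 + ip δ0 δ0) / 2 := by
    rw [hDe, ip_smul_left, ip_smul_right]; linarith [ip_add_self_le δ1 δ0]
  have b8 : ip eb eb ≤ (ip e2 e2 + ip e0 e0) / 2 := by
    rw [heb, ip_smul_left, ip_smul_right]; linarith [ip_add_self_le e2 e0]
  have b9 : gradSq eb ≤ (gradSq e2 + gradSq e0) / 2 := by
    rw [heb, gradSq_smul]; linarith [gradSq_add_le e2 e0]
  have n1 := ip_self_nonneg δ1
  have n2 := ip_self_nonneg δ0
  have n3 := ip_self_nonneg e2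
  have n4 := ip_self_nonneg e0
  have n5 := gradSq_nonneg e2
  have n6 := gradSq_nonneg e0
  have n7 := ip_self_nonneg eb
  have n8 := gradSq_nonneg eb
  have n9 := ip_self_nonneg ρ
  have hd : (0 : ℝ) ≤ d := Nat.cast_nonneg d
  set S := ip δ1 δ1 + ip δ0 δ0 + ip e2 e2 + ip e0 e0 + gradSq e2 + gradSq e0 + ε ^ 2 with hS
  have hε := sq_nonneg ε
  have s1 : ip De De ≤ S / 2 := by linarith
  have s2 : ip eb eb ≤ S / 2 := by linarith
  have s3 : gradSq eb ≤ S / 2 := by linarith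
  have s4 : ip ρ ρ ≤ B ^ 2 * S := by
    refine b6.trans ?_
    rw [mul_pow]; exact mul_le_mul_of_nonneg_left (by linarith) (sq_nonneg B)
  have s5 : ip e0 e0 + ip δ0 δ0 ≤ S := by linarith
  have hat : 0 < α * τ := mul_pos hα hτ
  -- The damping is discarded; the other terms with `De` are controlled by the kinetic energy,
  -- through `b7`.
  have t1 : -α * ip De De ≤ 0 := by
    rw [neg_mul]; exact neg_nonpos.2 (mul_nonneg hα.le hDe0)
  have t2 : - ip De ρ ≤ S / 4 + B ^ 2 * S / 2 := by linarith
  have t3 : α * ip (gcross eb V) De ≤ α * (B / 2 * S) := by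
    refine mul_le_mul_of_nonneg_left (b1.2.trans ?_) hα.le
    rw [← mul_add]
    exact mul_le_mul_of_nonneg_left (by linarith) (by positivity)
  have t4 : - ip (gcross eb V) (discLaplacian eb) ≤ B / 2 * (d * (S / 2)) + B / 2 * (S / 2) := by
    refine (neg_le.1 b3.1).trans (add_le_add ?_ ?_)
    · exact mul_le_mul_of_nonneg_left (mul_le_mul_of_nonneg_left s2 hd) (by positivity)
    · exact mul_le_mul_of_nonneg_left s3 (by positivity)
  have t5 : ip (gcross eb V) ρ ≤ B / 2 * (S / 2) + B / 2 * (B ^ 2 * S) :=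
    b2.2.trans (add_le_add (mul_le_mul_of_nonneg_left s2 (by positivity))
      (mul_le_mul_of_nonneg_left s4 (by positivity)))
  have t6 : - (α * τ * ip (gcross e0 (V - V')) δ0) ≤ k * (α * τ * (B / 2 * S)) := by
    have : - ip (gcross e0 (V - V')) δ0 ≤ B * k / 2 * S := by
      refine (neg_le.1 b4.1).trans ?_
      rw [← mul_add]
      exact mul_le_mul_of_nonneg_left s5 (by positivity)
    calc - (α * τ * ip (gcross e0 (V - V')) δ0) = α * τ * (- ip (gcross e0 (V - V')) δ0) := by ring
      _ ≤ α * τ * (B * k / 2 * S) := mul_le_mul_of_nonneg_left this hat.le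
      _ = _ := by ring
  have key := energy_bound_aux hα.le hat.le hk.le hB hd (by positivity : 0 ≤ S) t1 t2 t3 t4 t5 t6
  rw [energy_identity hk hDe hD2 heb h1 h0 heq]
  refine le_trans (le_of_eq ?_) key
  ring

/-! ### Discrete Gronwall inequality and stability -/

/-- A discrete Gronwall inequality. -/
theorem gronwall_le {y : ℕ → ℝ} {k c η : ℝ} {n₀ M : ℕ} (hk : 0 ≤ k) (hc : 0 ≤ c)
    (hkc : k * c ≤ 1 / 2) (hη : 0 ≤ η) (hy : ∀ n, 0 ≤ y n)
    (h : ∀ n, n₀ ≤ n → n + 1 ≤ M → y (n + 1) - y n ≤ k * (c * (y (n + 1) + y n + η))) :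
    ∀ n, n₀ ≤ n → n ≤ M → y n + η ≤ Real.exp (4 * c * (n * k)) * (y n₀ + η) := by
  intro n hn
  induction n, hn using Nat.le_induction with
  | base =>
    intro _
    have h1 : 1 ≤ Real.exp (4 * c * (n₀ * k)) := Real.one_le_exp (by positivity)
    nlinarith [hy n₀]
  | succ n hn ih =>
    intro hM
    have h1 := ih (by omega)
    have h2 := h n hn hM
    have hkc0 : 0 ≤ k * c := mul_nonneg hk hc
    have h3 : y (n + 1) + η ≤ (1 + 4 * (k * c)) * (y n + η) := by
      have hz : y (n + 1) * (1 - k * c) ≤ y n * (1 + k * c) + k * c * η := by nlinarith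
      have hz2 : (y (n + 1) + η) * (1 - k * c) ≤ (1 + k * c) * (y n + η) := by nlinarith
      -- The implicit term is moved to the left; for `0 ≤ x ≤ 1/2` the growth factor `(1 + x) / (1 -
      -- x)` is at most `1 + 4x`.
      have hz3 : (1 + k * c) ≤ (1 + 4 * (k * c)) * (1 - k * c) := by nlinarith
      have hpos : 0 < 1 - k * c := by linarith
      have hz4 : (y (n + 1) + η) * (1 - k * c) ≤ ((1 + 4 * (k * c)) * (y n + η)) * (1 - k * c) := by
        have := mul_le_mul_of_nonneg_right hz3 (add_nonneg (hy n) hη)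
        nlinarith
      exact le_of_mul_le_mul_right hz4 hpos
    have h4 : 1 + 4 * (k * c) ≤ Real.exp (4 * (k * c)) := by
      linarith [Real.add_one_le_exp (4 * (k * c))]
    calc y (n + 1) + η ≤ (1 + 4 * (k * c)) * (y n + η) := h3
      _ ≤ Real.exp (4 * (k * c)) * (Real.exp (4 * c * (n * k)) * (y n₀ + η)) :=
        mul_le_mul h4 h1 (add_nonneg (hy n) hη) (Real.exp_pos _).le
      _ = _ := by
        rw [← mul_assoc, ← Real.exp_add]; push_cast; ring_nf

/-- The part of the error controlled by the energy. -/
def errSq (k : ℝ) (e : ℕ → Grid d N) (n : ℕ) : ℝ :=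
  ip ((1 / k) • (e (n + 1) - e n)) ((1 / k) • (e (n + 1) - e n)) +
    (gradSq (e (n + 1)) + gradSq (e n)) + (ip (e (n + 1)) (e (n + 1)) + ip (e n) (e n))

theorem errSq_nonneg (k : ℝ) (e : ℕ → Grid d N) (n : ℕ) : 0 ≤ errSq k e n := by
  unfold errSq
  have := ip_self_nonneg ((1 / k) • (e (n + 1) - e n))
  have := ip_self_nonneg (e (n + 1))
  have := ip_self_nonneg (e n)
  have := gradSq_nonneg (e (n + 1))
  have := gradSq_nonneg (e n)
  positivity

/-- The energy, equivalent to `errSq`. -/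
def energy (α τ B k : ℝ) (e V : ℕ → Grid d N) (n : ℕ) : ℝ :=
  (α * τ / 2 * ip ((1 / k) • (e (n + 1) - e n)) ((1 / k) • (e (n + 1) - e n)) +
    (gradSq (e (n + 1)) + gradSq (e n)) / 4 -
    α * τ * ip (gcross (e n) (V n)) ((1 / k) • (e (n + 1) - e n))) +
  (α * τ * B ^ 2 + 1) * (ip (e (n + 1)) (e (n + 1)) + ip (e n) (e n))

/-- The indefinite cross term left by summation by parts in time is absorbed half by the kinetic
energy and half by the `L²` part. That is why `energy` carries the weight `α τ B² + 1` there. -/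
theorem le_energy {α τ B k : ℝ} (hα : 0 < α) (hτ : 0 < τ) {e V : ℕ → Grid d N} {n : ℕ}
    (hV : ∀ l, V n l ⬝ᵥ V n l ≤ B ^ 2) :
    min (α * τ / 4) (1 / 4) * errSq k e n ≤ energy α τ B k e V n := by
  have hat : 0 < α * τ := mul_pos hα hτ
  have h := (abs_le.1 (abs_ip_gcross_le' (f := e n) (g := (1 / k) • (e (n + 1) - e n)) hV)).2
  unfold errSq energy
  set δ := (1 / k) • (e (n + 1) - e n)
  have n1 := ip_self_nonneg δ
  have n2 := ip_self_nonneg (e (n + 1))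
  have n3 := ip_self_nonneg (e n)
  have n4 := gradSq_nonneg (e (n + 1))
  have n5 := gradSq_nonneg (e n)
  have m1 := min_le_left (α * τ / 4) (1 / 4)
  have m2 := min_le_right (α * τ / 4) (1 / 4)
  have h' := mul_le_mul_of_nonneg_left h hat.le
  have p1 := mul_le_mul_of_nonneg_right m1 n1
  have p2 := mul_le_mul_of_nonneg_right m2 (add_nonneg n4 n5)
  have p3 := mul_le_mul_of_nonneg_right m2 (add_nonneg n2 n3)
  have q : 0 ≤ α * τ * B ^ 2 * ip (e (n + 1)) (e (n + 1)) := by positivity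
  nlinarith

theorem energy_le {α τ B k : ℝ} (hα : 0 < α) (hτ : 0 < τ) {e V : ℕ → Grid d N} {n : ℕ}
    (hV : ∀ l, V n l ⬝ᵥ V n l ≤ B ^ 2) :
    energy α τ B k e V n ≤ (1 + α * τ + 2 * (α * τ * B ^ 2)) * errSq k e n := by
  have hat : 0 < α * τ := mul_pos hα hτ
  have h := (abs_le.1 (abs_ip_gcross_le' (f := e n) (g := (1 / k) • (e (n + 1) - e n)) hV)).1
  unfold errSq energy
  set δ := (1 / k) • (e (n + 1) - e n)
  have n1 := ip_self_nonneg δ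
  have n2 := ip_self_nonneg (e (n + 1))
  have n3 := ip_self_nonneg (e n)
  have n4 := gradSq_nonneg (e (n + 1))
  have n5 := gradSq_nonneg (e n)
  have h' := mul_le_mul_of_nonneg_left h hat.le
  have hb : 0 ≤ α * τ * B ^ 2 := by positivity
  have q1 := mul_nonneg hb n1
  have q2 := mul_nonneg hb n2
  have q3 := mul_nonneg hb n3
  have q4 := mul_nonneg hb n4
  have q5 := mul_nonneg hb n5
  have r1 := mul_nonneg hat.le n1
  have r2 := mul_nonneg hat.le n2
  have r3 := mul_nonneg hat.le n3
  have r4 := mul_nonneg hat.le n4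
  have r5 := mul_nonneg hat.le n5
  nlinarith

/-- Growth of the energy over one time step. -/
theorem energy_succ_sub_le {α τ k B ε : ℝ} (hα : 0 < α) (hτ : 0 < τ) (hk : 0 < k) (hB : 0 ≤ B)
    (hN : 0 < N) {e V : ℕ → Grid d N} {n : ℕ} {ρ A : Grid d N}
    (heq : ∀ l, timeDiff k e (n + 1) l = timeMean e (n + 1) l ⨯₃ V (n + 1) l +
      A l ⨯₃ ((α • timeDiff k e (n + 1) + (α * τ) • timeDiffTwo k e (n + 1) -
        discLaplacian (timeMean e (n + 1))) l + ρ l))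
    (hV : ∀ l, V (n + 1) l ⬝ᵥ V (n + 1) l ≤ B ^ 2) (hρ : ∀ l, ρ l ⬝ᵥ ρ l ≤ (B * ε) ^ 2)
    (hVx : ∀ i l, discGrad i (V (n + 1)) l ⬝ᵥ discGrad i (V (n + 1)) l ≤ B ^ 2)
    (hVt : ∀ l, (V (n + 1) l - V n l) ⬝ᵥ (V (n + 1) l - V n l) ≤ (B * k) ^ 2) :
    energy α τ B k e V (n + 1) - energy α τ B k e V n ≤
      k * ((2 + (1 + α + d + α * τ) * B + (1 + B) * B ^ 2 + α * τ * B ^ 2) *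
        (errSq k e (n + 1) + errSq k e n + ε ^ 2)) := by
  have hat : 0 < α * τ := mul_pos hα hτ
  have step := energy_step (e0 := e n) (e1 := e (n + 1)) (e2 := e (n + 1 + 1)) (V := V (n + 1))
    (V' := V n) (ρ := ρ) (A := A) (De := timeDiff k e (n + 1)) (D2 := timeDiffTwo k e (n + 1))
    (eb := timeMean e (n + 1)) (δ0 := (1 / k) • (e (n + 1) - e n))
    (δ1 := (1 / k) • (e (n + 1 + 1) - e (n + 1))) (ε := ε)
    hα hτ hk hB hN ?_ ?_ ?_ ?_ ?_ heq hV hρ hVx hVt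
  rotate_left
  · simp only [timeDiff, Nat.add_sub_cancel, ← smul_add, smul_smul]
    congr 1
    · field_simp
    · abel
  · simp only [timeDiffTwo, Nat.add_sub_cancel, ← smul_sub, smul_smul]
    congr 1
    · field_simp
    · module
  · simp only [timeMean, Nat.add_sub_cancel]
  · rw [smul_smul, mul_one_div_cancel hk.ne', one_smul]; abel
  · rw [smul_smul, mul_one_div_cancel hk.ne', one_smul]; abel
  -- The `L²` part added to the energy grows slowly: `e (n+2) - e n` is `k` times a sum of two
  -- velocities, which are already controlled.
  have hx : ip (e (n + 1 + 1)) (e (n + 1 + 1)) - ip (e n) (e n) ≤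
      k * (errSq k e (n + 1) + errSq k e n) := by
    have h1 : ip (e (n + 1 + 1)) (e (n + 1 + 1)) - ip (e n) (e n) =
        k * ip ((1 / k) • (e (n + 1 + 1) - e (n + 1)) + (1 / k) • (e (n + 1) - e n))
          (e (n + 1 + 1) + e n) := by
      rw [← smul_add, ip_smul_left, ← mul_assoc, mul_one_div_cancel hk.ne', one_mul]
      have : e (n + 1 + 1) - e (n + 1) + (e (n + 1) - e n) = e (n + 1 + 1) - e n := by abel
      rw [this]
      simp only [ip_sub_left, ip_add_right, ip_comm (e n) (e (n + 1 + 1))]; ring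
    rw [h1]
    refine mul_le_mul_of_nonneg_left ?_ hk.le
    have h2 := two_mul_ip_le ((1 / k) • (e (n + 1 + 1) - e (n + 1)) + (1 / k) • (e (n + 1) - e n))
      (e (n + 1 + 1) + e n)
    have h3 := ip_add_self_le ((1 / k) • (e (n + 1 + 1) - e (n + 1))) ((1 / k) • (e (n + 1) - e n))
    have h4 := ip_add_self_le (e (n + 1 + 1)) (e n)
    have h5 := le_abs_self (ip ((1 / k) • (e (n + 1 + 1) - e (n + 1)) +
      (1 / k) • (e (n + 1) - e n)) (e (n + 1 + 1) + e n))
    unfold errSq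
    have n1 := ip_self_nonneg (e (n + 1))
    have n2 := gradSq_nonneg (e (n + 1))
    have n3 := gradSq_nonneg (e (n + 1 + 1))
    have n4 := gradSq_nonneg (e n)
    linarith
  have hmono : ip ((1 / k) • (e (n + 1 + 1) - e (n + 1))) ((1 / k) • (e (n + 1 + 1) - e (n + 1))) +
      ip ((1 / k) • (e (n + 1) - e n)) ((1 / k) • (e (n + 1) - e n)) +
      ip (e (n + 1 + 1)) (e (n + 1 + 1)) + ip (e n) (e n) + gradSq (e (n + 1 + 1)) + gradSq (e n) +
      ε ^ 2 ≤ errSq k e (n + 1) + errSq k e n + ε ^ 2 := by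
    unfold errSq
    have n1 := ip_self_nonneg (e (n + 1))
    have n2 := gradSq_nonneg (e (n + 1))
    linarith
  have hc : 0 ≤ 1 + (1 + α + d + α * τ) * B + (1 + B) * B ^ 2 := by positivity
  have step' := step.trans (mul_le_mul_of_nonneg_left (mul_le_mul_of_nonneg_left hmono hc) hk.le)
  have hx' := mul_le_mul_of_nonneg_left hx (show 0 ≤ α * τ * B ^ 2 + 1 by positivity)
  have hε : 0 ≤ k * (α * τ * B ^ 2 + 1) * ε ^ 2 := by positivity
  unfold energy
  linarith

/-- Stability: an error that satisfies the linearised scheme up to a consistency error `ε` and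
starts with size `ε` stays of size `ε`. -/
theorem exists_errSq_le (d : ℕ) {α τ T B : ℝ} (hα : 0 < α) (hτ : 0 < τ) (hT : 0 < T) (hB : 0 ≤ B)
    (C₁ : ℝ) (hC₁ : 0 ≤ C₁) :
    ∃ C > 0, ∃ δ > 0, ∀ (N : ℕ) (k : ℝ), 0 < N → 0 < k → k < δ → ∀ (ε : ℝ) (e V ρ A : ℕ → Grid d N),
      (∀ n, 1 ≤ n → n + 1 ≤ ⌊T / k⌋₊ →
        (∀ l, timeDiff k e n l = timeMean e n l ⨯₃ V n l +
          A n l ⨯₃ ((α • timeDiff k e n + (α * τ) • timeDiffTwo k e n -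
            discLaplacian (timeMean e n)) l + ρ n l)) ∧
        (∀ l, V n l ⬝ᵥ V n l ≤ B ^ 2) ∧ (∀ l, ρ n l ⬝ᵥ ρ n l ≤ (B * ε) ^ 2) ∧
        (∀ i l, discGrad i (V n) l ⬝ᵥ discGrad i (V n) l ≤ B ^ 2)) →
      (∀ n, 1 ≤ n → n + 1 + 1 ≤ ⌊T / k⌋₊ → ∀ l,
        (V (n + 1) l - V n l) ⬝ᵥ (V (n + 1) l - V n l) ≤ (B * k) ^ 2) →
      errSq k e 1 ≤ C₁ * ε ^ 2 →
      ∀ n, 1 ≤ n → n + 1 ≤ ⌊T / k⌋₊ → errSq k e n ≤ C * ε ^ 2 := by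
  have hat : 0 < α * τ := mul_pos hα hτ
  set c₀ : ℝ := min (α * τ / 4) (1 / 4) with hc₀
  have hc₀p : 0 < c₀ := lt_min (by positivity) (by norm_num)
  set c₁ : ℝ := 1 + α * τ + 2 * (α * τ * B ^ 2) with hc₁
  set c₂ : ℝ := 2 + (1 + α + d + α * τ) * B + (1 + B) * B ^ 2 + α * τ * B ^ 2 with hc₂
  have hc₁p : 0 < c₁ := by positivity
  have hc₂p : 0 < c₂ := by positivity
  -- The first summand pays for passing from `errSq` to the energy, the second for the consistency
  -- error. The step restriction `1 / (2 * c₃)` below is the one that `gronwall_le` asks for.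
  set c₃ : ℝ := c₂ / c₀ + c₂ with hc₃
  have hc₃p : 0 < c₃ := by positivity
  refine ⟨Real.exp (4 * c₃ * T) * (c₁ * C₁ + 1) / c₀, by positivity, 1 / (2 * c₃), by positivity, ?_⟩
  intro N k hN hk hkδ ε e V ρ A h hVt h1 n hn hnT
  have hkc : k * c₃ ≤ 1 / 2 := by
    rw [lt_div_iff₀ (by positivity)] at hkδ; linarith
  have hlow : ∀ n, 1 ≤ n → n + 1 ≤ ⌊T / k⌋₊ → c₀ * errSq k e n ≤ energy α τ B k e V n :=
    fun n hn hnT => le_energy hα hτ (h n hn hnT).2.1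
  -- Coercivity is known only at the levels where `V` is bounded; truncation at zero provides the
  -- nonnegativity for all `n` that `gronwall_le` requires.
  set y : ℕ → ℝ := fun n => max (energy α τ B k e V n) 0 with hy
  have hyeq : ∀ n, 1 ≤ n → n + 1 ≤ ⌊T / k⌋₊ → y n = energy α τ B k e V n := fun n hn hnT =>
    max_eq_left ((mul_nonneg hc₀p.le (errSq_nonneg k e n)).trans (hlow n hn hnT))
  -- The energy with index `n` involves level `n + 1`, so the last index is one below the last time
  -- level.
  have hgr := gronwall_le (y := y) (k := k) (c := c₃) (η := ε ^ 2) (n₀ := 1) (M := ⌊T / k⌋₊ - 1)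
    hk.le hc₃p.le hkc (sq_nonneg ε) (fun n => le_max_right _ _) ?_ n hn (by omega)
  · have hnk : n * k ≤ T := by
      have h2 : (n : ℝ) ≤ T / k :=
        (Nat.cast_le.2 (by omega : n ≤ ⌊T / k⌋₊)).trans (Nat.floor_le (by positivity))
      rwa [le_div_iff₀ hk] at h2
    have hexp : Real.exp (4 * c₃ * (n * k)) ≤ Real.exp (4 * c₃ * T) :=
      Real.exp_le_exp.2 (mul_le_mul_of_nonneg_left hnk (by positivity))
    have hy1 : y 1 ≤ c₁ * (C₁ * ε ^ 2) := by
      rw [hyeq 1 le_rfl (by omega)]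
      exact (energy_le hα hτ (h 1 le_rfl (by omega)).2.1).trans
        (mul_le_mul_of_nonneg_left h1 hc₁p.le)
    have hfin : c₀ * errSq k e n ≤ Real.exp (4 * c₃ * T) * ((c₁ * C₁ + 1) * ε ^ 2) := by
      calc c₀ * errSq k e n ≤ y n := by rw [hyeq n hn hnT]; exact hlow n hn hnT
        _ ≤ y n + ε ^ 2 := by linarith [sq_nonneg ε]
        _ ≤ _ := hgr
        _ ≤ Real.exp (4 * c₃ * T) * ((c₁ * C₁ + 1) * ε ^ 2) := by
          refine mul_le_mul hexp (by linarith) ?_ (Real.exp_pos _).le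
          exact add_nonneg (le_max_right _ _) (sq_nonneg ε)
    rw [div_mul_eq_mul_div, le_div_iff₀ hc₀p]
    linarith
  · intro n hn hnM
    have ha : n + 1 + 1 ≤ ⌊T / k⌋₊ := by omega
    rw [hyeq n hn (by omega), hyeq (n + 1) (by omega) ha]
    obtain ⟨q1, q2, q3, q4⟩ := h (n + 1) (by omega) ha
    refine (energy_succ_sub_le hα hτ hk hB hN q1 q2 q3 q4 (hVt n hn ha)).trans ?_
    refine mul_le_mul_of_nonneg_left ?_ hk.le
    have l1 := hlow n hn (by omega)
    have l2 := hlow (n + 1) (by omega) ha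
    have e1 : errSq k e n ≤ energy α τ B k e V n / c₀ := by rw [le_div_iff₀ hc₀p]; linarith
    have e2 : errSq k e (n + 1) ≤ energy α τ B k e V (n + 1) / c₀ := by
      rw [le_div_iff₀ hc₀p]; linarith
    have p1 : 0 ≤ energy α τ B k e V n := (mul_nonneg hc₀p.le (errSq_nonneg k e n)).trans l1
    have p2 : 0 ≤ energy α τ B k e V (n + 1) :=
      (mul_nonneg hc₀p.le (errSq_nonneg k e _)).trans l2
    calc c₂ * (errSq k e (n + 1) + errSq k e n + ε ^ 2)
        ≤ c₂ * (energy α τ B k e V (n + 1) / c₀ + energy α τ B k e V n / c₀ + ε ^ 2) := by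
          gcongr
      _ ≤ c₃ * (energy α τ B k e V (n + 1) + energy α τ B k e V n + ε ^ 2) := by
          have : c₂ * (energy α τ B k e V (n + 1) / c₀ + energy α τ B k e V n / c₀ + ε ^ 2) =
            c₂ / c₀ * (energy α τ B k e V (n + 1) + energy α τ B k e V n) + c₂ * ε ^ 2 := by ring
          rw [this, hc₃]
          have z1 : 0 ≤ c₂ * (energy α τ B k e V (n + 1) + energy α τ B k e V n) := by positivity
          have z2 : 0 ≤ c₂ / c₀ * ε ^ 2 := by positivity
          linarith

end

section

/-! ### Taylor expansions -/

section Taylor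

variable {E : Type*} [NormedAddCommGroup E] [NormedSpace ℝ E]

/-- Induction on the order: the derivative of the remainder is the remainder of the shifted chain,
and the mean value inequality integrates it. The factorial in the remainder is given away. Working
with a chain `F 0, F 1, …` inside a convex set covers endpoints and chains that are pieced together.
-/
theorem norm_sub_taylor_le {S : Set ℝ} (hS : Convex ℝ S) {M x : ℝ} (hx : x ∈ S) (n : ℕ) :
    ∀ {F : ℕ → ℝ → E}, (∀ j ≤ n, ∀ s ∈ S, HasDerivWithinAt (F j) (F (j + 1) s) S s) →
      (∀ s ∈ S, ‖F (n + 1) s‖ ≤ M) → ∀ y ∈ S,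
      ‖F 0 y - ∑ j ∈ Finset.range (n + 1), ((y - x) ^ j / j.factorial) • F j x‖ ≤
        M * |y - x| ^ (n + 1) := by
  induction n with
  | zero =>
    intro F hF hM y hy
    simpa using hS.norm_image_sub_le_of_norm_hasDerivWithin_le (hF 0 le_rfl) hM hx hy
  | succ n ih =>
    intro F hF hM y hy
    have hM0 : 0 ≤ M := (norm_nonneg _).trans (hM x hx)
    have hseg : uIcc x y ⊆ S := by
      rw [← segment_eq_uIcc]; exact hS.segment_subset hx hy
    set G : ℝ → E := fun z =>
      F 0 z - ∑ j ∈ Finset.range (n + 2), ((z - x) ^ j / j.factorial) • F j x with hG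
    set G' : ℝ → E := fun z =>
      F 1 z - ∑ j ∈ Finset.range (n + 1), ((z - x) ^ j / j.factorial) • F (j + 1) x with hG'
    have hGd : ∀ z ∈ uIcc x y, HasDerivWithinAt G (G' z) (uIcc x y) z := by
      intro z hz
      have h0 := (hF 0 (Nat.zero_le _) z (hseg hz)).mono hseg
      refine h0.sub ?_
      have h1 : HasDerivAt (fun z => ∑ j ∈ Finset.range (n + 2),
          ((z - x) ^ j / j.factorial) • F j x)
          (∑ j ∈ Finset.range (n + 2), ((j * (z - x) ^ (j - 1)) / j.factorial) • F j x) z := by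
        refine HasDerivAt.fun_sum fun j _ => ?_
        refine HasDerivAt.smul_const ?_ _
        refine HasDerivAt.div_const ?_ _
        have := ((hasDerivAt_id z).sub_const x).fun_pow j
        simpa using this
      rw [Finset.sum_range_succ'] at h1
      convert h1.hasDerivWithinAt using 1
      simp only [Nat.cast_zero, zero_mul, zero_div, zero_smul, add_zero, Nat.add_sub_cancel]
      refine Finset.sum_congr rfl fun j _ => ?_
      congr 1
      rw [Nat.factorial_succ]
      push_cast
      have : (j : ℝ) + 1 ≠ 0 := by positivity
      have : (j.factorial : ℝ) ≠ 0 := by positivity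
      field_simp
    have hb : ∀ z ∈ uIcc x y, ‖G' z‖ ≤ M * |y - x| ^ (n + 1) := by
      intro z hz
      refine (ih (F := fun j => F (j + 1)) (fun j hj => hF (j + 1) (by omega)) hM z
        (hseg hz)).trans ?_
      gcongr 2
      exact abs_sub_left_of_mem_uIcc hz
    have hmv := (convex_uIcc x y).norm_image_sub_le_of_norm_hasDerivWithin_le hGd hb
      left_mem_uIcc right_mem_uIcc
    have hGx : G x = 0 := by
      simp [hG, Finset.sum_range_succ']
    rw [hGx, sub_zero, Real.norm_eq_abs] at hmv
    calc _ ≤ M * |y - x| ^ (n + 1) * |y - x| := hmv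
      _ = _ := by ring

theorem norm_smul_le_of_le {c b : ℝ} {v : E} (hc : 0 < c) (h : ‖v‖ ≤ c * b) :
    ‖(1 / c) • v‖ ≤ b := by
  rw [norm_smul, Real.norm_eq_abs, abs_of_pos (by positivity), one_div, inv_mul_le_iff₀ hc]
  exact h

variable {S : Set ℝ} {M : ℝ} {F : ℕ → ℝ → E} {t k : ℝ}

/-- Second order accuracy of the mean value over `t ± k`. -/
theorem norm_mean_sub_le (hS : Convex ℝ S) (hk : 0 < k) (ht : t ∈ S) (hp : t + k ∈ S)
    (hm : t - k ∈ S) (hF : ∀ j ≤ 1, ∀ s ∈ S, HasDerivWithinAt (F j) (F (j + 1) s) S s)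
    (hM : ∀ s ∈ S, ‖F 2 s‖ ≤ M) :
    ‖(1 / 2 : ℝ) • (F 0 (t + k) + F 0 (t - k)) - F 0 t‖ ≤ M * k ^ 2 := by
  have h1 := norm_sub_taylor_le hS ht 1 hF hM _ hp
  have h2 := norm_sub_taylor_le hS ht 1 hF hM _ hm
  simp only [Finset.sum_range_succ, Finset.sum_range_zero, add_sub_cancel_left, abs_of_pos hk,
    show t - k - t = -k by ring, abs_neg] at h1 h2
  norm_num [Nat.factorial] at h1 h2
  have e : (1 / 2 : ℝ) • (F 0 (t + k) + F 0 (t - k)) - F 0 t =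
      (1 / 2 : ℝ) • ((F 0 (t + k) - (F 0 t + k • F 1 t)) +
        (F 0 (t - k) - (F 0 t + -(k • F 1 t)))) := by module
  rw [e]
  refine norm_smul_le_of_le two_pos ((norm_add_le _ _).trans ?_)
  linarith

/-- Second order accuracy of the centred first difference. -/
theorem norm_centralDiff_sub_le (hS : Convex ℝ S) (hk : 0 < k) (ht : t ∈ S) (hp : t + k ∈ S)
    (hm : t - k ∈ S) (hF : ∀ j ≤ 2, ∀ s ∈ S, HasDerivWithinAt (F j) (F (j + 1) s) S s)
    (hM : ∀ s ∈ S, ‖F 3 s‖ ≤ M) :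
    ‖(1 / (2 * k)) • (F 0 (t + k) - F 0 (t - k)) - F 1 t‖ ≤ M * k ^ 2 := by
  have h1 := norm_sub_taylor_le hS ht 2 hF hM _ hp
  have h2 := norm_sub_taylor_le hS ht 2 hF hM _ hm
  simp only [Finset.sum_range_succ, Finset.sum_range_zero, add_sub_cancel_left, abs_of_pos hk,
    show t - k - t = -k by ring, abs_neg] at h1 h2
  norm_num [Nat.factorial] at h1 h2
  have e : (1 / (2 * k)) • (F 0 (t + k) - F 0 (t - k)) - F 1 t =
      (1 / (2 * k)) • ((F 0 (t + k) - (F 0 t + k • F 1 t + (k ^ 2 / 2) • F 2 t)) -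
        (F 0 (t - k) - (F 0 t + -(k • F 1 t) + (k ^ 2 / 2) • F 2 t))) := by
    have : F 1 t = (1 / (2 * k)) • ((2 * k) • F 1 t) := by
      rw [smul_smul, one_div_mul_cancel (by positivity), one_smul]
    nth_rw 1 [this]
    rw [← smul_sub]; congr 1; module
  rw [e]
  refine norm_smul_le_of_le (by positivity) ((norm_sub_le _ _).trans ?_)
  linarith

/-- Second order accuracy of the centred second difference. -/
theorem norm_secondDiff_sub_le (hS : Convex ℝ S) (hk : 0 < k) (ht : t ∈ S) (hp : t + k ∈ S)
    (hm : t - k ∈ S) (hF : ∀ j ≤ 3, ∀ s ∈ S, HasDerivWithinAt (F j) (F (j + 1) s) S s)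
    (hM : ∀ s ∈ S, ‖F 4 s‖ ≤ M) :
    ‖(1 / k ^ 2) • (F 0 (t + k) - (2 : ℝ) • F 0 t + F 0 (t - k)) - F 2 t‖ ≤ 2 * M * k ^ 2 := by
  have h1 := norm_sub_taylor_le hS ht 3 hF hM _ hp
  have h2 := norm_sub_taylor_le hS ht 3 hF hM _ hm
  simp only [Finset.sum_range_succ, Finset.sum_range_zero, add_sub_cancel_left, abs_of_pos hk,
    show t - k - t = -k by ring, abs_neg] at h1 h2
  norm_num [Nat.factorial] at h1 h2
  have e : (1 / k ^ 2) • (F 0 (t + k) - (2 : ℝ) • F 0 t + F 0 (t - k)) - F 2 t =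
      (1 / k ^ 2) •
        ((F 0 (t + k) - (F 0 t + k • F 1 t + (k ^ 2 / 2) • F 2 t + (k ^ 3 / 6) • F 3 t)) +
        (F 0 (t - k) - (F 0 t + -(k • F 1 t) + (k ^ 2 / 2) • F 2 t +
          ((-k) ^ 3 / 6) • F 3 t))) := by
    have : F 2 t = (1 / k ^ 2) • (k ^ 2 • F 2 t) := by
      rw [smul_smul, one_div_mul_cancel (by positivity), one_smul]
    nth_rw 1 [this]
    rw [← smul_sub]; congr 1; module
  rw [e]
  refine norm_smul_le_of_le (by positivity) ((norm_add_le _ _).trans ?_)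
  linarith

/-- At half a mesh width from a boundary point at which the odd derivatives vanish, the reflected
value agrees with the Taylor polynomial to fourth order. -/
theorem norm_taylor_ghost_le (hS : Convex ℝ S) {η : ℝ} (ht : t ∈ S) (hp : t + η / 2 ∈ S)
    (hF : ∀ j ≤ 3, ∀ s ∈ S, HasDerivWithinAt (F j) (F (j + 1) s) S s)
    (hM : ∀ s ∈ S, ‖F 4 s‖ ≤ M) (h1 : F 1 (t + η / 2) = 0) (h3 : F 3 (t + η / 2) = 0) :
    ‖η • F 1 t + (η ^ 2 / 2) • F 2 t + (η ^ 3 / 6) • F 3 t‖ ≤ M * η ^ 4 := by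
  have a1 := norm_sub_taylor_le hS ht 2 (F := fun j => F (j + 1))
    (fun j hj => hF (j + 1) (by omega)) hM _ hp
  have a3 := norm_sub_taylor_le hS ht 0 (F := fun j => F (j + 3))
    (fun j hj => hF (j + 3) (by omega)) hM _ hp
  have hM0 : 0 ≤ M := (norm_nonneg _).trans (hM t ht)
  simp only [Finset.sum_range_succ, Finset.sum_range_zero, add_sub_cancel_left, zero_add, h1, h3,
    zero_sub, norm_neg, pow_zero, pow_one, Nat.factorial, one_smul, Nat.cast_one, div_one, mul_one]
    at a1 a3
  -- The bracket is the Taylor polynomial of `F 1` evaluated at the face, where `F 1` vanishes, so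
  -- it is of third order in `η`. The leftover `1/6 - 1/8 = 1/24` multiplies `F 3 t`, which is of
  -- first order because `F 3` vanishes at the face.
  have e : η • F 1 t + (η ^ 2 / 2) • F 2 t + (η ^ 3 / 6) • F 3 t =
      η • (F 1 t + (η / 2) • F 2 t + ((η / 2) ^ 2 / ((1 + 1 : ℕ) : ℝ)) • F 3 t) +
        (η ^ 3 / 24) • F 3 t := by
    push_cast; module
  have n1 : ‖η • (F 1 t + (η / 2) • F 2 t + ((η / 2) ^ 2 / ((1 + 1 : ℕ) : ℝ)) • F 3 t)‖ ≤
      |η| * (M * |η / 2| ^ 3) := by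
    rw [norm_smul, Real.norm_eq_abs]
    exact mul_le_mul_of_nonneg_left a1 (abs_nonneg _)
  have n2 : ‖(η ^ 3 / 24) • F 3 t‖ ≤ |η| ^ 3 / 24 * (M * |η / 2|) := by
    rw [norm_smul, Real.norm_eq_abs, abs_div, abs_pow, abs_of_pos (by norm_num : (0 : ℝ) < 24)]
    exact mul_le_mul_of_nonneg_left a3 (by positivity)
  rw [e]
  refine (norm_add_le _ _).trans ((add_le_add n1 n2).trans ?_)
  rw [abs_div, abs_of_pos (by norm_num : (0 : ℝ) < 2)]
  have : η ^ 4 = |η| ^ 4 := by rw [← abs_pow, abs_of_nonneg (by positivity)]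
  rw [this]
  have : 0 ≤ M * |η| ^ 4 := by positivity
  nlinarith

theorem norm_taylor_three_le (hS : Convex ℝ S) {η : ℝ} (ht : t ∈ S) (hp : t + η ∈ S)
    (hF : ∀ j ≤ 3, ∀ s ∈ S, HasDerivWithinAt (F j) (F (j + 1) s) S s)
    (hM : ∀ s ∈ S, ‖F 4 s‖ ≤ M) :
    ‖F 0 (t + η) - F 0 t - (η • F 1 t + (η ^ 2 / 2) • F 2 t + (η ^ 3 / 6) • F 3 t)‖ ≤
      M * η ^ 4 := by
  have h1 := norm_sub_taylor_le hS ht 3 hF hM _ hp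
  simp only [Finset.sum_range_succ, Finset.sum_range_zero, add_sub_cancel_left] at h1
  norm_num [Nat.factorial] at h1
  rw [← abs_pow, abs_of_nonneg (by positivity : 0 ≤ η ^ 4)] at h1
  convert h1 using 2
  module

/-- `P 0, …, P n` are the derivatives of the curve `P 0` on `[0, T]`. -/
def IsDerivChain (T : ℝ) (n : ℕ) (P : ℕ → ℝ → E) : Prop :=
  ∀ j < n, ∀ t ∈ Icc 0 T, HasDerivWithinAt (P j) (P (j + 1) t) (Icc 0 T) t

theorem IsDerivChain.clm {E' : Type*} [NormedAddCommGroup E'] [NormedSpace ℝ E'] {T : ℝ} {n : ℕ}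
    {P : ℕ → ℝ → E} (h : IsDerivChain T n P) (L : E →L[ℝ] E') :
    IsDerivChain T n fun j t => L (P j t) :=
  fun j hj t ht => L.hasFDerivAt.comp_hasDerivWithinAt t (h j hj t ht)

/-- A curve of class `C^n` with its derivatives, which are bounded on a compact interval. -/
theorem exists_derivChain {T : ℝ} (hT : 0 < T) {n : ℕ} {U : ℝ → E}
    (hU : ContDiffOn ℝ n U (Icc 0 T)) :
    ∃ P : ℕ → ℝ → E, P 0 = U ∧
      IsDerivChain T n P ∧ (∀ l : ℕ, l + 1 ≤ n → ContDiffOn ℝ l (P 1) (Icc 0 T)) ∧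
      ∃ M, 0 ≤ M ∧ ∀ j ≤ n, ∀ t ∈ Icc 0 T, ‖P j t‖ ≤ M := by
  have hu := uniqueDiffOn_Icc hT
  refine ⟨fun j => iteratedDerivWithin j U (Icc 0 T), iteratedDerivWithin_zero, ?_, ?_, ?_⟩
  · intro j hj t ht
    have h := (hU.differentiableOn_iteratedDerivWithin (by exact_mod_cast hj) hu) t ht
    simp only [iteratedDerivWithin_succ]
    exact h.hasDerivWithinAt
  · intro l hl
    refine (hU.derivWithin hu (by exact_mod_cast hl)).congr fun t _ => ?_
    simp only [iteratedDerivWithin_one]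
  · have hb : ∀ j, ∃ M, 0 ≤ M ∧ (j ≤ n → ∀ t ∈ Icc 0 T,
        ‖iteratedDerivWithin j U (Icc 0 T) t‖ ≤ M) := by
      intro j
      by_cases hj : j ≤ n
      · obtain ⟨C, hC⟩ := isCompact_Icc.exists_bound_of_continuousOn
          (hU.continuousOn_iteratedDerivWithin (by exact_mod_cast hj) hu)
        exact ⟨|C|, abs_nonneg _, fun _ t ht => (hC t ht).trans (le_abs_self C)⟩
      · exact ⟨0, le_rfl, fun h => absurd h hj⟩
    choose M hM0 hM using hb
    refine ⟨∑ j ∈ Finset.range (n + 1), M j, Finset.sum_nonneg fun j _ => hM0 j, ?_⟩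
    intro j hj t ht
    exact (hM j hj t ht).trans (Finset.single_le_sum (f := M) (fun j _ => hM0 j)
      (Finset.mem_range.2 (by omega)))

end Taylor

/-! ### The closed cube and coordinate lines -/

variable {d : ℕ}

/-- The `i`-th coordinate unit vector. -/
def unitVec (i : Fin d) : Space d := EuclideanSpace.single i 1

theorem norm_unitVec (i : Fin d) : ‖unitVec i‖ = 1 := by simp [unitVec]

theorem unitVec_apply (i j : Fin d) : unitVec i j = if j = i then 1 else 0 := by
  simp [unitVec]

theorem isOpen_cube (d : ℕ) : IsOpen (cube d) := by
  have h : IsOpen (Set.pi univ fun _ : Fin d => Ioo (0 : ℝ) 1) :=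
    isOpen_set_pi finite_univ fun _ _ => isOpen_Ioo
  have h2 := (EuclideanSpace.equiv (Fin d) ℝ).toHomeomorph.isOpen_preimage.2 h
  refine (congrArg IsOpen ?_).mp h2
  ext x
  simp [cube]

theorem cube_subset_closedCube : cube d ⊆ closedCube d :=
  fun _ hx i => Ioo_subset_Icc_self (hx i)

theorem convex_closedCube (d : ℕ) : Convex ℝ (closedCube d) := by
  intro x hx y hy a b ha hb hab i
  exact convex_Icc (0 : ℝ) 1 (hx i) (hy i) ha hb hab

theorem cube_subset_interior : cube d ⊆ interior (closedCube d) :=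
  interior_maximal cube_subset_closedCube (isOpen_cube d)

theorem center_mem_cube : (WithLp.toLp 2 fun _ => 1 / 2 : Space d) ∈ cube d :=
  fun _ => by norm_num

theorem nonempty_interior_closedCube (d : ℕ) : (interior (closedCube d)).Nonempty :=
  ⟨_, cube_subset_interior center_mem_cube⟩

theorem uniqueDiffOn_closedCube (d : ℕ) : UniqueDiffOn ℝ (closedCube d) :=
  uniqueDiffOn_convex (convex_closedCube d) (nonempty_interior_closedCube d)

theorem closedCube_subset_closure_interior : closedCube d ⊆ closure (interior (closedCube d)) := by
  rw [(convex_closedCube d).closure_interior_eq_closure_of_nonempty_interior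
    (nonempty_interior_closedCube d)]
  exact subset_closure

theorem closedCube_subset_closure_cube : closedCube d ⊆ closure (cube d) := by
  intro x hx
  set c : Space d := WithLp.toLp 2 fun _ => 1 / 2
  have hlim : Filter.Tendsto (fun ε : ℝ => x + ε • (c - x)) (nhdsWithin 0 (Ioo 0 1)) (nhds x) := by
    have hc : Continuous (fun ε : ℝ => x + ε • (c - x)) := by fun_prop
    have := (hc.tendsto 0).mono_left (nhdsWithin_le_nhds (s := Ioo 0 1))
    simpa using this
  have : (nhdsWithin (0 : ℝ) (Ioo 0 1)).NeBot := by
    rw [← mem_closure_iff_nhdsWithin_neBot, closure_Ioo (by norm_num)]; simp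
  refine mem_closure_of_tendsto hlim ?_
  filter_upwards [self_mem_nhdsWithin] with ε hε i
  have h1 := hx i
  have h2 : (x + ε • (c - x)) i = x i + ε * (1 / 2 - x i) := by simp [c]
  rw [h2]
  constructor <;> nlinarith [h1.1, h1.2, hε.1, hε.2]

/-- The line through `x` in direction `i`, parametrised by the `i`-th coordinate. -/
def line (x : Space d) (i : Fin d) (s : ℝ) : Space d := x + (s - x i) • unitVec i

theorem line_apply (x : Space d) (i j : Fin d) (s : ℝ) :
    line x i s j = if j = i then s else x j := by
  simp only [line, PiLp.add_apply, PiLp.smul_apply, unitVec_apply, smul_eq_mul]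
  split_ifs with h
  · subst h; ring
  · ring

theorem line_self (x : Space d) (i : Fin d) : line x i (x i) = x := by simp [line]

theorem line_mem {x : Space d} (hx : x ∈ closedCube d) (i : Fin d) {s : ℝ} (hs : s ∈ Icc (0 : ℝ) 1) :
    line x i s ∈ closedCube d := by
  intro j
  rw [line_apply]
  split_ifs
  · exact hs
  · exact hx j

theorem hasDerivAt_line (x : Space d) (i : Fin d) (s : ℝ) :
    HasDerivAt (line x i) (unitVec i) s := by
  have h := (((hasDerivAt_id s).sub_const (x i)).smul_const (unitVec i)).const_add x
  simp only [id, one_smul] at h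
  exact h

theorem continuous_line (x : Space d) (i : Fin d) : Continuous (line x i) := by
  unfold line; fun_prop

/-! ### Derivatives along coordinate lines and their symmetry -/

/-- The derivatives of `f` within the closed cube. -/
abbrev cubeDeriv (n : ℕ) (f : Space d → Vec) (x : Space d) (v : Fin n → Space d) : Vec :=
  iteratedFDerivWithin ℝ n f (closedCube d) x v

theorem hasDerivWithinAt_cubeDeriv_line {n : WithTop ℕ∞} {j : ℕ} {f : Space d → Vec}
    (hf : ContDiffOn ℝ n f (closedCube d)) (hj : j < n) {x : Space d} (hx : x ∈ closedCube d)
    (i : Fin d) (v : Fin j → Space d) {s : ℝ} (hs : s ∈ Icc (0 : ℝ) 1) :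
    HasDerivWithinAt (fun s => cubeDeriv j f (line x i s) v)
      (cubeDeriv (j + 1) f (line x i s) (Fin.cons (unitVec i) v)) (Icc 0 1) s := by
  have hd := (hf.differentiableOn_iteratedFDerivWithin hj (uniqueDiffOn_closedCube d)) _
    (line_mem hx i hs)
  have h1 := hd.hasFDerivWithinAt.comp_hasDerivWithinAt s (hasDerivAt_line x i s).hasDerivWithinAt
    (fun r hr => line_mem hx i hr)
  have h2 := ((ContinuousMultilinearMap.apply ℝ (fun _ : Fin j => Space d) Vec v).hasFDerivAt
    (x := iteratedFDerivWithin ℝ j f (closedCube d) (line x i s))).comp_hasDerivWithinAt s h1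
  simp only [cubeDeriv, iteratedFDerivWithin_succ_apply_left, Fin.cons_zero, Fin.tail_cons]
  exact h2

theorem cubeDeriv_two_symm {f : Space d → Vec} (hf : ContDiffOn ℝ 2 f (closedCube d))
    {x : Space d} (hx : x ∈ closedCube d) (a b : Space d) :
    cubeDeriv 2 f x ![a, b] = cubeDeriv 2 f x ![b, a] :=
  IsSymmSndFDerivWithinAt.iteratedFDerivWithin_cons
    (hf := (hf x hx).isSymmSndFDerivWithinAt (by simp) (uniqueDiffOn_closedCube d)
      (closedCube_subset_closure_interior hx) hx) (uniqueDiffOn_closedCube d) hx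

/-- Symmetry of the second derivative of `fderivWithin ℝ f`, whose value is then applied to the last
vector `c`. It holds up to the boundary because the closed cube lies in the closure of its interior.
-/
theorem cubeDeriv_three_symm {f : Space d → Vec} (hf : ContDiffOn ℝ 3 f (closedCube d))
    {x : Space d} (hx : x ∈ closedCube d) (a b c : Space d) :
    cubeDeriv 3 f x ![a, b, c] = cubeDeriv 3 f x ![b, a, c] := by
  have hu := uniqueDiffOn_closedCube d
  have hg : ContDiffOn ℝ 2 (fderivWithin ℝ f (closedCube d)) (closedCube d) :=
    hf.fderivWithin hu (by norm_num)
  have h := IsSymmSndFDerivWithinAt.iteratedFDerivWithin_cons (v := a) (w := b)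
    (hf := (hg x hx).isSymmSndFDerivWithinAt (by simp) hu
      (closedCube_subset_closure_interior hx) hx) hu hx
  have e : ∀ a b : Space d, (Fin.init ![a, b, c] : Fin 2 → Space d) = ![a, b] := by
    intro a b; ext i : 1; fin_cases i <;> rfl
  have key : ∀ v : Fin 3 → Space d, cubeDeriv 3 f x v = iteratedFDerivWithin ℝ 2
      (fun y => fderivWithin ℝ f (closedCube d) y) (closedCube d) x (Fin.init v) (v (Fin.last 2)) :=
    fun v => iteratedFDerivWithin_succ_apply_right hu hx v
  rw [key, key ![b, a, c]]
  have e2 : ∀ a b : Space d, (![a, b, c] : Fin 3 → Space d) (Fin.last 2) = c := by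
    intro a b; rfl
  rw [e, e, e2, e2, h]

end

section

variable {d N : ℕ}

/-! ### Consistency of the discrete Laplacian -/

theorem node_apply (l : Idx d N) (i : Fin d) : node l i = ((l i : ℝ) + 1 / 2) * mesh N := rfl

theorem node_mem_cube (hN : 0 < N) (l : Idx d N) : node l ∈ cube d := by
  intro i
  have hN' : (0 : ℝ) < N := by exact_mod_cast hN
  have h : ((l i : ℕ) : ℝ) + 1 ≤ N := by exact_mod_cast (l i).isLt
  rw [node_apply, mesh]
  constructor
  · positivity
  · rw [mul_one_div, div_lt_one hN']; linarith

theorem node_mem (hN : 0 < N) (l : Idx d N) : node l ∈ closedCube d :=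
  cube_subset_closedCube (node_mem_cube hN l)

theorem node_next {i : Fin d} {l : Idx d N} (h : (l i : ℕ) + 1 < N) :
    node (next i l) = line (node l) i (node l i + mesh N) := by
  ext j
  rw [line_apply]
  split_ifs with hj
  · subst hj
    rw [node_apply, node_apply, next_apply_same h]; push_cast; ring
  · rw [node_apply, node_apply, next, Function.update_of_ne hj]

theorem node_prev {i : Fin d} {l : Idx d N} (h : 0 < (l i : ℕ)) :
    node (prev i l) = line (node l) i (node l i - mesh N) := by
  ext j
  rw [line_apply]
  split_ifs with hj
  · subst hj
    rw [node_apply, node_apply, prev_apply_same, Nat.cast_sub (by omega)]; push_cast; ring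
  · rw [node_apply, node_apply, prev, Function.update_of_ne hj]

theorem node_add_half {i : Fin d} {l : Idx d N} (hN : 0 < N) (h : ¬ (l i : ℕ) + 1 < N) :
    node l i + mesh N / 2 = 1 := by
  have hl : ((l i : ℕ) : ℝ) + 1 = N := by
    have := (l i).isLt
    exact_mod_cast (by omega : (l i : ℕ) + 1 = N)
  have hN' : (N : ℝ) ≠ 0 := by positivity
  rw [node_apply, mesh, ← hl]
  rw [← hl] at hN'
  field_simp; ring

theorem node_sub_half {i : Fin d} {l : Idx d N} (h : (l i : ℕ) = 0) :
    node l i - mesh N / 2 = 0 := by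
  rw [node_apply, h]; push_cast; ring

theorem const_cons (j : ℕ) (e : Space d) :
    (Fin.cons e (fun _ : Fin j => e) : Fin (j + 1) → Space d) = fun _ => e := by
  ext i : 1
  refine Fin.cases ?_ (fun i => ?_) i <;> simp

/-- Second order consistency of the discrete Laplacian, up to the boundary, for functions with
vanishing first and third normal derivatives. -/
theorem norm_discLaplacian_sub_le {f : Space d → Vec} (hf : ContDiffOn ℝ 4 f (closedCube d)) {M : ℝ}
    (hM : ∀ x ∈ closedCube d, ‖iteratedFDerivWithin ℝ 4 f (closedCube d) x‖ ≤ M)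
    (h1 : ∀ x ∈ closedCube d, ∀ i, (x i = 0 ∨ x i = 1) → cubeDeriv 1 f x (fun _ => unitVec i) = 0)
    (h3 : ∀ x ∈ closedCube d, ∀ i, (x i = 0 ∨ x i = 1) → cubeDeriv 3 f x (fun _ => unitVec i) = 0)
    (hN : 0 < N) (l : Idx d N) :
    ‖discLaplacian (nodal N f) l - ∑ i, cubeDeriv 2 f (node l) (fun _ => unitVec i)‖ ≤
      2 * d * M * mesh N ^ 2 := by
  set h := mesh N with hh
  have hp : 0 < h := mesh_pos hN
  set x := node l with hx
  have hxK : x ∈ closedCube d := node_mem hN l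
  have hdir : ∀ i, ‖(1 / h ^ 2) • (nodal N f (next i l) - (2 : ℝ) • nodal N f l +
      nodal N f (prev i l)) - cubeDeriv 2 f x (fun _ => unitVec i)‖ ≤ 2 * M * h ^ 2 := by
    intro i
    set F : ℕ → ℝ → Vec := fun j s => cubeDeriv j f (line x i s) (fun _ => unitVec i) with hF
    have hFd : ∀ j ≤ 3, ∀ s ∈ Icc (0 : ℝ) 1,
        HasDerivWithinAt (F j) (F (j + 1) s) (Icc 0 1) s := by
      intro j hj s hs
      have := hasDerivWithinAt_cubeDeriv_line (n := 4) hf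
        (by exact_mod_cast (by omega : j < 4)) hxK i (fun _ => unitVec i) hs
      rwa [const_cons] at this
    have hFM : ∀ s ∈ Icc (0 : ℝ) 1, ‖F 4 s‖ ≤ M := by
      intro s hs
      refine (ContinuousMultilinearMap.le_opNorm _ _).trans ?_
      simpa [norm_unitVec] using hM _ (line_mem hxK i hs)
    have hF0 : ∀ s, F 0 s = f (line x i s) := fun s => by
      simp [hF, cubeDeriv]
    have hb : ∀ b : ℝ, (b = 0 ∨ b = 1) → F 1 b = 0 ∧ F 3 b = 0 := by
      intro b hb
      have hbm : b ∈ Icc (0 : ℝ) 1 := by rcases hb with rfl | rfl <;> simp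
      have hbl : line x i b i = 0 ∨ line x i b i = 1 := by simpa [line_apply] using hb
      exact ⟨h1 _ (line_mem hxK i hbm) i hbl, h3 _ (line_mem hxK i hbm) i hbl⟩
    have hs : x i ∈ Icc (0 : ℝ) 1 := hxK i
    have hxs : f x = F 0 (x i) := by rw [hF0, line_self]
    -- Each neighbour, ghost or not, matches the cubic Taylor polynomial to fourth order. In the sum
    -- with `hL` the odd terms cancel, and division by `h²` leaves second order.
    have hR : ‖f (node (next i l)) - F 0 (x i) - (h • F 1 (x i) + (h ^ 2 / 2) • F 2 (x i) +
        (h ^ 3 / 6) • F 3 (x i))‖ ≤ M * h ^ 4 := by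
      by_cases hl : (l i : ℕ) + 1 < N
      · have hm : x i + h ∈ Icc (0 : ℝ) 1 := by
          have := node_mem hN (next i l) i
          rwa [node_next hl, line_apply, if_pos rfl] at this
        rw [node_next hl, ← hF0]
        exact norm_taylor_three_le (convex_Icc 0 1) hs hm hFd hFM
      · have hz := node_add_half hN hl
        rw [next_eq_self hl, ← hx, hxs, sub_self, zero_sub, norm_neg]
        have hbz := hb (x i + h / 2) (Or.inr hz)
        refine norm_taylor_ghost_le (convex_Icc 0 1) hs ?_ hFd hFM hbz.1 hbz.2
        rw [hz]; simp
    have hL : ‖f (node (prev i l)) - F 0 (x i) - ((-h) • F 1 (x i) + ((-h) ^ 2 / 2) • F 2 (x i) +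
        ((-h) ^ 3 / 6) • F 3 (x i))‖ ≤ M * (-h) ^ 4 := by
      by_cases hl : 0 < (l i : ℕ)
      · have hm : x i + -h ∈ Icc (0 : ℝ) 1 := by
          have := node_mem hN (prev i l) i
          rwa [node_prev hl, line_apply, if_pos rfl, sub_eq_add_neg] at this
        rw [node_prev hl, ← hF0, sub_eq_add_neg]
        exact norm_taylor_three_le (convex_Icc 0 1) hs hm hFd hFM
      · have hz : x i + -h / 2 = 0 := by
          rw [neg_div, ← sub_eq_add_neg]; exact node_sub_half (by omega)
        rw [prev_eq_self (by omega), ← hx, hxs, sub_self, zero_sub, norm_neg]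
        have hbz := hb (x i + -h / 2) (Or.inl hz)
        refine norm_taylor_ghost_le (convex_Icc 0 1) hs ?_ hFd hFM hbz.1 hbz.2
        rw [hz]; simp
    have hF2 : cubeDeriv 2 f x (fun _ => unitVec i) = F 2 (x i) := by
      simp only [hF, line_self]
    have e : (1 / h ^ 2) • (nodal N f (next i l) - (2 : ℝ) • nodal N f l + nodal N f (prev i l)) -
        F 2 (x i) = (1 / h ^ 2) • ((f (node (next i l)) - F 0 (x i) - (h • F 1 (x i) +
          (h ^ 2 / 2) • F 2 (x i) + (h ^ 3 / 6) • F 3 (x i))) + (f (node (prev i l)) - F 0 (x i) -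
          ((-h) • F 1 (x i) + ((-h) ^ 2 / 2) • F 2 (x i) + ((-h) ^ 3 / 6) • F 3 (x i)))) := by
      have : F 2 (x i) = (1 / h ^ 2) • (h ^ 2 • F 2 (x i)) := by
        rw [smul_smul, one_div_mul_cancel (by positivity), one_smul]
      nth_rw 1 [this]
      rw [← smul_sub]; congr 1
      simp only [nodal, ← hx, hxs]; module
    rw [hF2, e]
    refine norm_smul_le_of_le (by positivity) ((norm_add_le _ _).trans ((add_le_add hR hL).trans ?_))
    exact le_of_eq (by ring)
  unfold discLaplacian
  rw [← Finset.sum_sub_distrib]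
  refine (norm_sum_le _ _).trans ((Finset.sum_le_sum fun i _ => hdir i).trans (le_of_eq ?_))
  simp; ring

/-! ### Calculus for dot and cross products -/

section Products

variable {f g : ℝ → Vec} {f' g' : Vec} {S : Set ℝ} {s : ℝ}

theorem hasDerivWithinAt_dot (hf : HasDerivWithinAt f f' S s) (hg : HasDerivWithinAt g g' S s) :
    HasDerivWithinAt (fun s => f s ⬝ᵥ g s) (f' ⬝ᵥ g s + f s ⬝ᵥ g') S s := by
  simp only [dotProduct, ← Finset.sum_add_distrib]
  exact HasDerivWithinAt.fun_sum fun i _ =>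
    ((hasDerivWithinAt_pi.1 hf) i).mul ((hasDerivWithinAt_pi.1 hg) i)

theorem hasDerivWithinAt_cross (hf : HasDerivWithinAt f f' S s)
    (hg : HasDerivWithinAt g g' S s) :
    HasDerivWithinAt (fun s => f s ⨯₃ g s) (f' ⨯₃ g s + f s ⨯₃ g') S s := by
  have hf := hasDerivWithinAt_pi.1 hf
  have hg := hasDerivWithinAt_pi.1 hg
  refine hasDerivWithinAt_pi.2 fun i => ?_
  fin_cases i
  · refine (((hf 1).fun_mul (hg 2)).fun_sub ((hf 2).fun_mul (hg 1))).congr_deriv ?_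
    simp [cross_apply]; ring
  · refine (((hf 2).fun_mul (hg 0)).fun_sub ((hf 0).fun_mul (hg 2))).congr_deriv ?_
    simp [cross_apply]; ring
  · refine (((hf 0).fun_mul (hg 1)).fun_sub ((hf 1).fun_mul (hg 0))).congr_deriv ?_
    simp [cross_apply]; ring

theorem abs_apply_le (a : Vec) (i : Fin 3) : |a i| ≤ ‖a‖ := norm_le_pi_norm a i

theorem abs_dot_le (a b : Vec) : |a ⬝ᵥ b| ≤ 3 * (‖a‖ * ‖b‖) := by
  have h : ∀ i, |a i * b i| ≤ ‖a‖ * ‖b‖ := fun i => by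
    rw [abs_mul]
    exact mul_le_mul (abs_apply_le a i) (abs_apply_le b i) (abs_nonneg _) (norm_nonneg _)
  calc |a ⬝ᵥ b| ≤ ∑ i, |a i * b i| := Finset.abs_sum_le_sum_abs _ _
    _ ≤ ∑ _i : Fin 3, ‖a‖ * ‖b‖ := Finset.sum_le_sum fun i _ => h i
    _ = _ := by simp

theorem norm_cross_le (a b : Vec) : ‖a ⨯₃ b‖ ≤ 2 * (‖a‖ * ‖b‖) := by
  have h : ∀ i j, |a i * b j| ≤ ‖a‖ * ‖b‖ := fun i j => by
    rw [abs_mul]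
    exact mul_le_mul (abs_apply_le a i) (abs_apply_le b j) (abs_nonneg _) (norm_nonneg _)
  have h2 : ∀ i j k l, |a i * b j - a k * b l| ≤ 2 * (‖a‖ * ‖b‖) := fun i j k l =>
    (abs_sub _ _).trans (by linarith [h i j, h k l])
  refine (pi_norm_le_iff_of_nonneg (by positivity)).2 fun i => ?_
  rw [cross_apply, Real.norm_eq_abs]
  fin_cases i <;> exact h2 _ _ _ _

theorem continuousOn_cross {X : Type*} [TopologicalSpace X] {f g : X → Vec} {S : Set X}
    (hf : ContinuousOn f S) (hg : ContinuousOn g S) : ContinuousOn (fun x => f x ⨯₃ g x) S := by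
  have hf := continuousOn_pi.1 hf
  have hg := continuousOn_pi.1 hg
  refine continuousOn_pi.2 fun i => ?_
  fin_cases i
  · exact ((hf 1).mul (hg 2)).sub ((hf 2).mul (hg 1))
  · exact ((hf 2).mul (hg 0)).sub ((hf 0).mul (hg 2))
  · exact ((hf 0).mul (hg 1)).sub ((hf 1).mul (hg 0))

/-- The generality in `R` is there for the Banach algebra of continuous functions on the cube:
smoothness in time then holds uniformly in space. -/
theorem contDiffOn_cross {R : Type*} [NormedCommRing R] [NormedAlgebra ℝ R] {n : WithTop ℕ∞}
    {f g : ℝ → Fin 3 → R} {S : Set ℝ} (hf : ContDiffOn ℝ n f S) (hg : ContDiffOn ℝ n g S) :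
    ContDiffOn ℝ n (fun t => f t ⨯₃ g t) S := by
  have hf := contDiffOn_pi.1 hf
  have hg := contDiffOn_pi.1 hg
  refine contDiffOn_pi.2 fun i => ?_
  fin_cases i
  · exact ((hf 1).mul (hg 2)).sub ((hf 2).mul (hg 1))
  · exact ((hf 2).mul (hg 0)).sub ((hf 0).mul (hg 2))
  · exact ((hf 0).mul (hg 1)).sub ((hf 1).mul (hg 0))

theorem cross_cross_self (a b : Vec) : a ⨯₃ (a ⨯₃ b) = (a ⬝ᵥ b) • a - (a ⬝ᵥ a) • b := by
  ext i
  fin_cases i <;> simp [cross_apply, dotProduct, Fin.sum_univ_three] <;> ring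

end Products

end

section

variable {d N : ℕ}

/-! ### Pointwise consequences of the constraint and of the equation at a fixed time -/

theorem vec_two (e : Space d) : (![e, e] : Fin 2 → Space d) = fun _ => e := by
  ext i : 1; fin_cases i <;> rfl

theorem cons_const_one (a b : Space d) :
    (Fin.cons a (fun _ : Fin 1 => b) : Fin 2 → Space d) = ![a, b] := by
  ext i : 1; fin_cases i <;> rfl

theorem cons_const_two (a b : Space d) :
    (Fin.cons a (fun _ : Fin 2 => b) : Fin 3 → Space d) = ![a, b, b] := by
  ext i : 1; fin_cases i <;> rfl

theorem cubeDeriv_zero (f : Space d → Vec) (x : Space d) (v : Fin 0 → Space d) :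
    cubeDeriv 0 f x v = f x := by simp [cubeDeriv]

theorem uniqueDiffWithinAt_unit {s : ℝ} (hs : s ∈ Icc (0 : ℝ) 1) :
    UniqueDiffWithinAt ℝ (Icc (0 : ℝ) 1) s := uniqueDiffOn_Icc zero_lt_one s hs

section FixedTime

variable {f : Space d → Vec}

theorem hasDerivWithinAt_line (hf : ContDiffOn ℝ 1 f (closedCube d)) {x : Space d}
    (hx : x ∈ closedCube d) (i : Fin d) {s : ℝ} (hs : s ∈ Icc (0 : ℝ) 1) :
    HasDerivWithinAt (fun s => f (line x i s))
      (cubeDeriv 1 f (line x i s) (fun _ => unitVec i)) (Icc 0 1) s := by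
  have h := hasDerivWithinAt_cubeDeriv_line (n := 1) (j := 0) hf (by norm_num) hx i
    (fun _ => unitVec i) hs
  simpa only [cubeDeriv_zero, const_cons] using h

/-- The constraint `|f| = 1`, differentiated once. -/
theorem dot_cubeDeriv_one (hf : ContDiffOn ℝ 1 f (closedCube d))
    (hu : ∀ x ∈ closedCube d, f x ⬝ᵥ f x = 1) {x : Space d} (hx : x ∈ closedCube d) (i : Fin d) :
    f x ⬝ᵥ cubeDeriv 1 f x (fun _ => unitVec i) = 0 := by
  have h := hasDerivWithinAt_line hf hx i (hx i)
  have h2 := (hasDerivWithinAt_dot h h).congr_of_mem (f₁ := fun _ => (1 : ℝ))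
    (fun s hs => (hu _ (line_mem hx i hs)).symm) (hx i)
  have h3 := (uniqueDiffWithinAt_unit (hx i)).eq_deriv _ h2 (hasDerivWithinAt_const _ _ _)
  rw [line_self, dotProduct_comm _ (f x)] at h3
  linarith

/-- The constraint `|f| = 1`, differentiated twice. -/
theorem dot_cubeDeriv_two (hf : ContDiffOn ℝ 2 f (closedCube d))
    (hu : ∀ x ∈ closedCube d, f x ⬝ᵥ f x = 1) {x : Space d} (hx : x ∈ closedCube d) (i : Fin d) :
    f x ⬝ᵥ cubeDeriv 2 f x (fun _ => unitVec i) =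
      - (cubeDeriv 1 f x (fun _ => unitVec i) ⬝ᵥ cubeDeriv 1 f x (fun _ => unitVec i)) := by
  have hf1 : ContDiffOn ℝ 1 f (closedCube d) := hf.of_le (by norm_num)
  have h := hasDerivWithinAt_line hf1 hx i (hx i)
  have h' := hasDerivWithinAt_cubeDeriv_line (n := 2) (j := 1) hf (by norm_num) hx i
    (fun _ => unitVec i) (hx i)
  have h2 := (hasDerivWithinAt_dot h h').congr_of_mem (f₁ := fun _ => (0 : ℝ))
    (fun s hs => (dot_cubeDeriv_one hf1 hu (line_mem hx i hs) i).symm) (hx i)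
  have h3 := (uniqueDiffWithinAt_unit (hx i)).eq_deriv _ h2 (hasDerivWithinAt_const _ _ _)
  rw [line_self, const_cons] at h3
  linarith

/-- A coordinate line in a direction `j ≠ i` stays inside the face, along which the normal
derivative is constantly zero; differentiation along the line and symmetry give the claim. -/
theorem cubeDeriv_two_face (hf : ContDiffOn ℝ 2 f (closedCube d))
    (hn : ∀ x ∈ closedCube d, ∀ i, (x i = 0 ∨ x i = 1) → cubeDeriv 1 f x (fun _ => unitVec i) = 0)
    {x : Space d} (hx : x ∈ closedCube d) {i j : Fin d} (hij : i ≠ j) (hi : x i = 0 ∨ x i = 1) :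
    cubeDeriv 2 f x ![unitVec i, unitVec j] = 0 := by
  rw [cubeDeriv_two_symm hf hx]
  have h := hasDerivWithinAt_cubeDeriv_line (n := 2) (j := 1) hf (by norm_num) hx j
    (fun _ => unitVec i) (hx j)
  have h2 := h.congr_of_mem (f₁ := fun _ => (0 : Vec)) (fun s hs => by
    refine (hn _ (line_mem hx j hs) i ?_).symm
    rwa [line_apply, if_neg hij]) (hx j)
  have h3 := (uniqueDiffWithinAt_unit (hx j)).eq_deriv _ h2 (hasDerivWithinAt_const _ _ _)
  rwa [line_self, cons_const_one] at h3

/-- The argument of `cubeDeriv_two_face`, applied once more to the mixed derivative that it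
annihilates. -/
theorem cubeDeriv_three_face (hf : ContDiffOn ℝ 3 f (closedCube d))
    (hn : ∀ x ∈ closedCube d, ∀ i, (x i = 0 ∨ x i = 1) → cubeDeriv 1 f x (fun _ => unitVec i) = 0)
    {x : Space d} (hx : x ∈ closedCube d) {i j : Fin d} (hij : i ≠ j) (hi : x i = 0 ∨ x i = 1) :
    cubeDeriv 3 f x ![unitVec i, unitVec j, unitVec j] = 0 := by
  rw [cubeDeriv_three_symm hf hx]
  have h := hasDerivWithinAt_cubeDeriv_line (n := 3) (j := 2) hf (by norm_num) hx j
    ![unitVec i, unitVec j] (hx j)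
  have h2 := h.congr_of_mem (f₁ := fun _ => (0 : Vec)) (fun s hs => by
    refine (cubeDeriv_two_face (hf.of_le (by norm_num)) hn (line_mem hx j hs) hij ?_).symm
    rwa [line_apply, if_neg hij]) (hx j)
  have h3 := (uniqueDiffWithinAt_unit (hx j)).eq_deriv _ h2 (hasDerivWithinAt_const _ _ _)
  rwa [line_self] at h3

/-- A sphere-valued map with vanishing normal derivative for which `a = f × (b - Δf)`, where `a` and
`b` have vanishing normal derivatives, has vanishing third normal derivatives. -/
theorem cubeDeriv_three_normal (hf : ContDiffOn ℝ 3 f (closedCube d))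
    (hu : ∀ x ∈ closedCube d, f x ⬝ᵥ f x = 1)
    (hn : ∀ x ∈ closedCube d, ∀ i, (x i = 0 ∨ x i = 1) → cubeDeriv 1 f x (fun _ => unitVec i) = 0)
    {a b : Space d → Vec}
    (heq : ∀ x ∈ closedCube d, a x = f x ⨯₃ (b x - ∑ j, cubeDeriv 2 f x (fun _ => unitVec j)))
    {x : Space d} (hx : x ∈ closedCube d) {i : Fin d} (hi : x i = 0 ∨ x i = 1)
    (ha : HasDerivWithinAt (fun s => a (line x i s)) 0 (Icc 0 1) (x i))
    (hb : HasDerivWithinAt (fun s => b (line x i s)) 0 (Icc 0 1) (x i)) :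
    cubeDeriv 3 f x (fun _ => unitVec i) = 0 := by
  have hf2 : ContDiffOn ℝ 2 f (closedCube d) := hf.of_le (by norm_num)
  have hf1 : ContDiffOn ℝ 1 f (closedCube d) := hf.of_le (by norm_num)
  set z := cubeDeriv 3 f x (fun _ => unitVec i) with hz
  have hud := uniqueDiffWithinAt_unit (hx i)
  have hfd : HasDerivWithinAt (fun s => f (line x i s)) 0 (Icc 0 1) (x i) := by
    have h := hasDerivWithinAt_line hf1 hx i (hx i)
    rwa [line_self, hn x hx i hi] at h
  -- In the normal derivative of the Laplacian the tangential second derivatives drop out on the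
  -- face, which leaves the pure third derivative `z`.
  have hW : HasDerivWithinAt (fun s => ∑ j, cubeDeriv 2 f (line x i s) (fun _ => unitVec j)) z
      (Icc 0 1) (x i) := by
    have h : HasDerivWithinAt (fun s => ∑ j, cubeDeriv 2 f (line x i s) (fun _ => unitVec j))
        (∑ j, cubeDeriv 3 f (line x i (x i)) (Fin.cons (unitVec i) fun _ => unitVec j))
        (Icc 0 1) (x i) :=
      HasDerivWithinAt.fun_sum fun j _ => hasDerivWithinAt_cubeDeriv_line (n := 3) (j := 2) hf
        (by norm_num) hx i (fun _ => unitVec j) (hx i)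
    refine h.congr_deriv ?_
    rw [Finset.sum_eq_single i, line_self, const_cons]
    · intro j _ hj
      rw [line_self, cons_const_two]
      exact cubeDeriv_three_face hf hn hx (Ne.symm hj) hi
    · simp
  -- Normal derivative of the constraint in the form `f · Δf = -|∇f|²`. On the right each summand
  -- pairs a first with a second derivative: for `j = i` the first vanishes on the face, for `j ≠ i`
  -- the mixed second one does.
  have hdot : f x ⬝ᵥ z = 0 := by
    have h1 := hasDerivWithinAt_dot hfd hW
    have h2 : HasDerivWithinAt (fun s => - ∑ j, (cubeDeriv 1 f (line x i s) (fun _ => unitVec j) ⬝ᵥ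
        cubeDeriv 1 f (line x i s) (fun _ => unitVec j))) 0 (Icc 0 1) (x i) := by
      have h : HasDerivWithinAt (fun s => - ∑ j,
          (cubeDeriv 1 f (line x i s) (fun _ => unitVec j) ⬝ᵥ
          cubeDeriv 1 f (line x i s) (fun _ => unitVec j))) (-∑ j,
          (cubeDeriv 2 f (line x i (x i)) (Fin.cons (unitVec i) fun _ => unitVec j) ⬝ᵥ
            cubeDeriv 1 f (line x i (x i)) (fun _ => unitVec j) +
          cubeDeriv 1 f (line x i (x i)) (fun _ => unitVec j) ⬝ᵥ
            cubeDeriv 2 f (line x i (x i)) (Fin.cons (unitVec i) fun _ => unitVec j)))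
          (Icc 0 1) (x i) := by
        refine (HasDerivWithinAt.fun_sum fun j _ => ?_).fun_neg
        have h := hasDerivWithinAt_cubeDeriv_line (n := 3) (j := 1) hf
          (by norm_num) hx i (fun _ => unitVec j) (hx i)
        exact hasDerivWithinAt_dot h h
      refine h.congr_deriv ?_
      rw [line_self, neg_eq_zero]
      refine Finset.sum_eq_zero fun j _ => ?_
      by_cases hj : j = i
      · subst hj; rw [hn x hx j hi]; simp
      · rw [cons_const_one, cubeDeriv_two_face hf2 hn hx (Ne.symm hj) hi]; simp
    have h3 := h2.congr_of_mem (f₁ := fun s => f (line x i s) ⬝ᵥ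
      ∑ j, cubeDeriv 2 f (line x i s) (fun _ => unitVec j)) (fun s hs => by
        simp only [dotProduct_sum]
        rw [← Finset.sum_neg_distrib]
        exact Finset.sum_congr rfl fun j _ => dot_cubeDeriv_two hf2 hu (line_mem hx i hs) j) (hx i)
    have h4 := hud.eq_deriv _ h1 h3
    simpa [line_self] using h4
  -- Normal derivative of the equation: `a`, `b` and the factor `f` contribute nothing.
  have hcross : f x ⨯₃ z = 0 := by
    have h1 := (hasDerivWithinAt_cross hfd (hb.fun_sub hW)).congr_of_mem (f₁ := fun s => a (line x i s))
      (fun s hs => heq _ (line_mem hx i hs)) (hx i)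
    have h4 := hud.eq_deriv _ ha h1
    simp only [line_self, map_zero, LinearMap.zero_apply, zero_add, zero_sub, map_neg] at h4
    exact neg_eq_zero.1 h4.symm
  have h := cross_cross_self (f x) z
  rw [hcross, hdot, hu x hx] at h
  simpa using h.symm

end FixedTime

/-! ### Curves of functions on the closed cube -/

/-- The space of continuous fields of `j`-linear maps on the closed cube. -/
abbrev CubeForms (d j : ℕ) : Type :=
  C(closedCube d, ContinuousMultilinearMap ℝ (fun _ : Fin j => Space d) Vec)

/-- The value of a field of `j`-linear maps at a point and at given vectors, extended by zero. -/
def valAt {j : ℕ} (φ : CubeForms d j) (v : Fin j → Space d) (y : Space d) : Vec :=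
  open Classical in if h : y ∈ closedCube d then φ ⟨y, h⟩ v else 0

theorem valAt_of_mem {j : ℕ} (φ : CubeForms d j) (v : Fin j → Space d) {y : Space d}
    (h : y ∈ closedCube d) : valAt φ v y = φ ⟨y, h⟩ v := dif_pos h

/-- Evaluation at a point and at given vectors. -/
def evalForm {j : ℕ} (y : closedCube d) (v : Fin j → Space d) : CubeForms d j →L[ℝ] Vec :=
  (ContinuousMultilinearMap.apply ℝ (fun _ : Fin j => Space d) Vec v).comp
    (ContinuousMap.evalCLM ℝ y)

theorem norm_apply_form_le {j : ℕ} (φ : CubeForms d j) (y : closedCube d) (v : Fin j → Space d) :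
    ‖φ y v‖ ≤ ‖φ‖ * ∏ i, ‖v i‖ :=
  ((φ y).le_opNorm v).trans (mul_le_mul_of_nonneg_right (φ.norm_coe_le_norm y) (by positivity))

theorem norm_valAt_le {j : ℕ} (φ : CubeForms d j) (v : Fin j → Space d) (y : Space d) :
    ‖valAt φ v y‖ ≤ ‖φ‖ * ∏ i, ‖v i‖ := by
  unfold valAt
  split_ifs
  · exact norm_apply_form_le _ _ _
  · rw [norm_zero]; positivity

theorem continuousOn_valAt {j : ℕ} (φ : CubeForms d j) (v : Fin j → Space d) :
    ContinuousOn (valAt φ v) (closedCube d) := by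
  rw [continuousOn_iff_continuous_domRestrict]
  have h : Continuous fun y : closedCube d => φ y v :=
    (ContinuousMultilinearMap.apply ℝ (fun _ : Fin j => Space d) Vec v).continuous.comp φ.continuous
  convert h using 1
  ext1 y
  exact valAt_of_mem φ v y.2

theorem IsDerivChain.valAt {j n : ℕ} {T : ℝ} {P : ℕ → ℝ → CubeForms d j} (h : IsDerivChain T n P)
    (v : Fin j → Space d) (y : Space d) : IsDerivChain T n fun j t => valAt (P j t) v y := by
  by_cases hy : y ∈ closedCube d
  · simp only [valAt_of_mem _ _ hy]
    exact h.clm (evalForm ⟨y, hy⟩ v)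
  · simp only [ILLG.valAt, dif_neg hy]
    exact fun _ _ _ _ => hasDerivWithinAt_const _ _ _

/-- The part of a coordinate line in the closed cube, continued by constants. -/
def cubeLine {x : Space d} (hx : x ∈ closedCube d) (i : Fin d) : C(ℝ, closedCube d) where
  toFun s := ⟨line x i (projIcc 0 1 zero_le_one s), line_mem hx i (projIcc 0 1 zero_le_one s).2⟩
  continuous_toFun := Continuous.subtype_mk
    ((continuous_line x i).comp (continuous_subtype_val.comp continuous_projIcc)) _

theorem cubeLine_of_mem {x : Space d} (hx : x ∈ closedCube d) (i : Fin d) {s : ℝ}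
    (hs : s ∈ Icc (0 : ℝ) 1) : cubeLine hx i s = ⟨line x i s, line_mem hx i hs⟩ := by
  simp [cubeLine, projIcc_of_mem _ hs]

theorem continuous_form_curve {j : ℕ} (φ : CubeForms d j) (c : C(ℝ, closedCube d))
    (v : Fin j → Space d) : Continuous fun r => φ (c r) v :=
  (ContinuousMultilinearMap.apply ℝ (fun _ : Fin j => Space d) Vec v).continuous.comp
    (φ.continuous.comp c.continuous)

/-- Integration of a field of linear maps along a curve. -/
def lineIntegral {j : ℕ} (c : C(ℝ, closedCube d)) (v : Fin j → Space d) (s : ℝ) :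
    CubeForms d j →L[ℝ] Vec :=
  LinearMap.mkContinuous
    { toFun := fun φ : CubeForms d j => ∫ r in (0 : ℝ)..s, φ (c r) v
      map_add' := fun φ ψ => by
        simp only [ContinuousMap.add_apply, add_apply]
        exact intervalIntegral.integral_add
          ((continuous_form_curve φ c v).intervalIntegrable _ _)
          ((continuous_form_curve ψ c v).intervalIntegrable _ _)
      map_smul' := fun a φ => by
        simp only [ContinuousMap.smul_apply, smul_apply, RingHom.id_apply]
        exact intervalIntegral.integral_smul _ _ }
    ((∏ i, ‖v i‖) * |s|) (fun φ => by
      refine (intervalIntegral.norm_integral_le_of_norm_le_const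
        (fun r _ => norm_apply_form_le φ (c r) v)).trans (le_of_eq ?_)
      rw [sub_zero]; ring)

theorem lineIntegral_apply {j : ℕ} (c : C(ℝ, closedCube d)) (v : Fin j → Space d) (s : ℝ)
    (φ : CubeForms d j) : lineIntegral c v s φ = ∫ r in (0 : ℝ)..s, φ (c r) v := rfl

/-- If `Q t` is the derivative of `P t`, then the time derivatives of `Q` are the derivatives of
the time derivatives of `P`. -/
theorem hasDerivWithinAt_valAt_line {T : ℝ} (hT : 0 < T) {n : ℕ} {u : ℝ → Space d → Vec}
    (hu : ∀ t ∈ Icc 0 T, ContDiffOn ℝ 1 (u t) (closedCube d)) {P : ℕ → ℝ → CubeForms d 0}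
    {Q : ℕ → ℝ → CubeForms d 1}
    (hP : ∀ t ∈ Icc 0 T, ∀ x : closedCube d,
      P 0 t x = iteratedFDerivWithin ℝ 0 (u t) (closedCube d) x)
    (hQ : ∀ t ∈ Icc 0 T, ∀ x : closedCube d,
      Q 0 t x = iteratedFDerivWithin ℝ 1 (u t) (closedCube d) x)
    (hPd : IsDerivChain T n P) (hQd : IsDerivChain T n Q)
    {x : Space d} (hx : x ∈ closedCube d) (i : Fin d) {j : ℕ} (hj : j ≤ n) {t : ℝ}
    (ht : t ∈ Icc 0 T) {s : ℝ} (hs : s ∈ Icc (0 : ℝ) 1) :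
    HasDerivWithinAt (fun s => valAt (P j t) ![] (line x i s))
      (valAt (Q j t) (fun _ => unitVec i) (line x i s)) (Icc 0 1) s := by
  set c := cubeLine hx i with hc
  set v : Fin 1 → Space d := fun _ => unitVec i with hv
  -- The fundamental theorem of calculus along the line, written as a continuous linear relation
  -- between `P j t` and `Q j t`. In this integrated form it can be differentiated in time step by
  -- step, with no interchange of limits.
  have key : ∀ j ≤ n, ∀ t ∈ Icc 0 T, ∀ s ∈ Icc (0 : ℝ) 1,
      evalForm (c s) ![] (P j t) - evalForm (c 0) ![] (P j t) - lineIntegral c v s (Q j t) = 0 := by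
    intro j
    induction j with
    | zero =>
      intro _ t ht s hs
      have hsub : Icc 0 s ⊆ Icc (0 : ℝ) 1 := Icc_subset_Icc_right hs.2
      have hval : ∀ r ∈ Icc (0 : ℝ) 1, P 0 t (c r) ![] = u t (line x i r) := by
        intro r hr
        rw [hc, cubeLine_of_mem hx i hr, hP t ht]; simp
      have hder : ∀ r ∈ Icc (0 : ℝ) 1,
          HasDerivWithinAt (fun r => u t (line x i r)) (Q 0 t (c r) v) (Icc 0 1) r := by
        intro r hr
        rw [hc, cubeLine_of_mem hx i hr, hQ t ht]
        exact hasDerivWithinAt_line (hu t ht) hx i hr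
      have hftc := intervalIntegral.integral_eq_sub_of_hasDerivAt_of_le (a := 0) (b := s)
        (f := fun r => u t (line x i r)) (f' := fun r => Q 0 t (c r) v) hs.1
        (fun r hr => ((hder r (hsub hr)).continuousWithinAt.mono hsub))
        (fun r hr => (hder r (hsub (Ioo_subset_Icc_self hr))).hasDerivAt
          (Icc_mem_nhds hr.1 (hr.2.trans_le hs.2)))
        ((continuous_form_curve _ c v).intervalIntegrable _ _)
      have e1 : evalForm (c s) ![] (P 0 t) = u t (line x i s) := hval s hs
      have e2 : evalForm (c 0) ![] (P 0 t) = u t (line x i 0) := hval 0 (by simp)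
      rw [lineIntegral_apply, hftc, e1, e2, sub_self]
    | succ j ih =>
      intro hj t ht s hs
      have h1 := ((hPd.clm (evalForm (c s) ![]) j (by omega) t ht).fun_sub
        (hPd.clm (evalForm (c 0) ![]) j (by omega) t ht)).fun_sub
        (hQd.clm (lineIntegral c v s) j (by omega) t ht)
      have h2 := h1.congr_of_mem (f₁ := fun _ => (0 : Vec))
        (fun r hr => (ih (by omega) r hr s hs).symm) ht
      exact (uniqueDiffOn_Icc hT t ht).eq_deriv _ h2 (hasDerivWithinAt_const _ _ _)
  have hcont := continuous_form_curve (Q j t) c v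
  have hint : HasDerivAt (fun s => evalForm (c 0) ![] (P j t) + ∫ r in (0 : ℝ)..s, Q j t (c r) v)
      (Q j t (c s) v) s :=
    (intervalIntegral.integral_hasDerivAt_right (hcont.intervalIntegrable _ _)
      (hcont.stronglyMeasurableAtFilter _ _) hcont.continuousAt).const_add _
  have h := hint.hasDerivWithinAt (s := Icc (0 : ℝ) 1)
  rw [valAt_of_mem _ _ (line_mem hx i hs), ← cubeLine_of_mem hx i hs]
  refine h.congr_of_mem (fun r hr => ?_) hs
  have := key j hj t ht r hr
  rw [valAt_of_mem _ _ (line_mem hx i hr), ← cubeLine_of_mem hx i hr]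
  rw [sub_sub, sub_eq_zero, lineIntegral_apply] at this
  exact this

end

section

variable {d N : ℕ}

/-! ### Quantitative regularity of the exact solution -/

/-- The regularity of the exact solution that the consistency analysis uses: `p j`, `w j` are the
`j`-th time derivatives of `m` and of its Laplacian, `g i` is the `i`-th partial derivative. -/
structure SolutionBounds (α τ T : ℝ) (m : ℝ → Space d → Vec) (p w : ℕ → ℝ → Space d → Vec)
    (g : Fin d → ℝ → Space d → Vec) (B : ℝ) : Prop where
  nonneg : 0 ≤ B
  unit : ∀ t ∈ Icc 0 T, ∀ x ∈ closedCube d, m t x ⬝ᵥ m t x = 1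
  p_zero : ∀ t ∈ Icc 0 T, ∀ x ∈ closedCube d, p 0 t x = m t x
  p_deriv : ∀ x ∈ closedCube d, IsDerivChain T 4 fun j t => p j t x
  p_bound : ∀ j ≤ 4, ∀ t ∈ Icc 0 T, ∀ x ∈ closedCube d, ‖p j t x‖ ≤ B
  w_deriv : ∀ x ∈ closedCube d, IsDerivChain T 2 fun j t => w j t x
  w_bound : ∀ j ≤ 2, ∀ t ∈ Icc 0 T, ∀ x ∈ closedCube d, ‖w j t x‖ ≤ B
  g_bound : ∀ i, ∀ t ∈ Icc 0 T, ∀ x ∈ closedCube d, ‖g i t x‖ ≤ B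
  g_time : ∀ i, ∀ t ∈ Icc 0 T, ∀ t' ∈ Icc 0 T, ∀ x ∈ closedCube d,
    ‖g i t x - g i t' x‖ ≤ B * |t - t'|
  g_space : ∀ i j, ∀ t ∈ Icc 0 T, ∀ x ∈ closedCube d, ∀ s ∈ Icc (0 : ℝ) 1, ∀ s' ∈ Icc (0 : ℝ) 1,
    ‖g j t (line x i s) - g j t (line x i s')‖ ≤ B * |s - s'|
  m_line : ∀ i, ∀ t ∈ Icc 0 T, ∀ x ∈ closedCube d, ∀ s ∈ Icc (0 : ℝ) 1,
    HasDerivWithinAt (fun s => m t (line x i s)) (g i t (line x i s)) (Icc 0 1) s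
  pde : ∀ t ∈ Icc 0 T, ∀ x ∈ closedCube d,
    p 1 t x = m t x ⨯₃ (α • p 1 t x + (α * τ) • p 2 t x - w 0 t x)
  dot_w : ∀ t ∈ Icc 0 T, ∀ x ∈ closedCube d, m t x ⬝ᵥ w 0 t x = - ∑ i, g i t x ⬝ᵥ g i t x
  lap : ∀ t ∈ Icc 0 T, ∀ N : ℕ, 0 < N → ∀ l : Idx d N,
    ‖discLaplacian (nodal N (m t)) l - w 0 t (node l)‖ ≤ B * mesh N ^ 2

/-- If `P 0` is a constant-zero curve, so are its derivatives. -/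
theorem IsDerivChain.eq_zero {E : Type*} [NormedAddCommGroup E] [NormedSpace ℝ E] {T : ℝ}
    (hT : 0 < T) {n : ℕ} {P : ℕ → ℝ → E} (h : IsDerivChain T n P)
    (h0 : ∀ t ∈ Icc 0 T, P 0 t = 0) : ∀ j ≤ n, ∀ t ∈ Icc 0 T, P j t = 0 := by
  intro j
  induction j with
  | zero => exact fun _ => h0
  | succ j ih =>
    intro hj t ht
    have h2 := (h j (by omega) t ht).congr_of_mem (f₁ := fun _ => (0 : E))
      (fun s hs => (ih (by omega) s hs).symm) ht
    exact (uniqueDiffOn_Icc hT t ht).eq_deriv _ h2 (hasDerivWithinAt_const _ _ _)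

theorem IsDerivChain.sum {E ι : Type*} [NormedAddCommGroup E] [NormedSpace ℝ E] [Fintype ι] {T : ℝ}
    {n : ℕ} {P : ι → ℕ → ℝ → E} (h : ∀ i, IsDerivChain T n (P i)) :
    IsDerivChain T n fun j t => ∑ i, P i j t :=
  fun j hj t ht => HasDerivWithinAt.fun_sum fun i _ => h i j hj t ht

theorem IsDerivChain.continuousOn {E : Type*} [NormedAddCommGroup E] [NormedSpace ℝ E] {T : ℝ}
    {n : ℕ} {P : ℕ → ℝ → E} (h : IsDerivChain T n P) {j : ℕ} (hj : j < n) :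
    ContinuousOn (P j) (Icc 0 T) := fun t ht => (h j hj t ht).continuousWithinAt

/-! ### The equation on the closed space-time cylinder -/

theorem laplacian_eq_sum_cubeDeriv {f : Space d → Vec} (hf : ContDiffOn ℝ 2 f (closedCube d))
    {x : Space d} (hx : x ∈ cube d) :
    Laplacian.laplacian f x = ∑ i, cubeDeriv 2 f x (fun _ => unitVec i) := by
  rw [InnerProductSpace.laplacian_eq_iteratedFDeriv_orthonormalBasis f
    (EuclideanSpace.basisFun (Fin d) ℝ)]
  have hnhds : closedCube d ∈ nhds x :=
    mem_interior_iff_mem_nhds.1 (cube_subset_interior hx)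
  have hfx : ContDiffAt ℝ 2 f x := hf.contDiffAt hnhds
  refine Finset.sum_congr rfl fun i _ => ?_
  rw [cubeDeriv, iteratedFDerivWithin_eq_iteratedFDeriv (uniqueDiffOn_closedCube d) hfx
    (cube_subset_closedCube hx), ← vec_two]
  simp [unitVec]

theorem pde_rearrange {α τ : ℝ} {M a b w : Vec}
    (h : a = -(M ⨯₃ w) + α • (M ⨯₃ (a + τ • b))) :
    a = M ⨯₃ (α • a + (α * τ) • b - w) := by
  nth_rw 1 [h]
  simp only [map_add, map_sub, map_smul, smul_add, mul_smul]
  abel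

/-- The equation passes to the closed cylinder by continuity, first in space at fixed interior time
and then in time at a fixed point. Separate continuity in the two variables is enough for this. -/
theorem pde_of_interior {α τ T : ℝ} (hT : 0 < T) {m₀ : Space d → Vec} {m : ℝ → Space d → Vec}
    (hm : IsSolution d α τ T m₀ m) (hm2 : ∀ t ∈ Icc 0 T, ContDiffOn ℝ 2 (m t) (closedCube d))
    {p w : ℕ → ℝ → Space d → Vec} (hp : ∀ x ∈ closedCube d, IsDerivChain T 3 fun j t => p j t x)
    (hp0 : ∀ t ∈ Icc 0 T, ∀ x ∈ closedCube d, p 0 t x = m t x)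
    (hpc : ∀ j ≤ 3, ∀ t ∈ Icc 0 T, ContinuousOn (p j t) (closedCube d))
    (hw : ∀ x ∈ closedCube d, ContinuousOn (fun t => w 0 t x) (Icc 0 T))
    (hw0 : ∀ t ∈ Icc 0 T, ∀ x ∈ closedCube d,
      w 0 t x = ∑ i, cubeDeriv 2 (m t) x (fun _ => unitVec i))
    (hwc : ∀ t ∈ Icc 0 T, ContinuousOn (w 0 t) (closedCube d)) :
    ∀ t ∈ Icc 0 T, ∀ x ∈ closedCube d,
      p 1 t x = m t x ⨯₃ (α • p 1 t x + (α * τ) • p 2 t x - w 0 t x) := by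
  have hint : ∀ t ∈ Ioo 0 T, ∀ x ∈ cube d,
      p 1 t x = p 0 t x ⨯₃ (α • p 1 t x + (α * τ) • p 2 t x - w 0 t x) := by
    intro t ht x hx
    have hxK := cube_subset_closedCube hx
    have htI := Ioo_subset_Icc_self ht
    have hd1 : ∀ s ∈ Ioo 0 T, HasDerivAt (fun s => m s x) (p 1 s x) s := by
      intro s hs
      have h := (hp x hxK 0 (by norm_num) s (Ioo_subset_Icc_self hs)).hasDerivAt
        (Icc_mem_nhds hs.1 hs.2)
      refine h.congr_of_eventuallyEq ?_
      filter_upwards [Ioo_mem_nhds hs.1 hs.2] with r hr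
      exact (hp0 r (Ioo_subset_Icc_self hr) x hxK).symm
    have hd2 : deriv (deriv fun s => m s x) t = p 2 t x := by
      have h := (hp x hxK 1 (by norm_num) t htI).hasDerivAt (Icc_mem_nhds ht.1 ht.2)
      refine (h.congr_of_eventuallyEq ?_).deriv
      filter_upwards [Ioo_mem_nhds ht.1 ht.2] with r hr
      exact (hd1 r hr).deriv
    have h := hm.eqn t ht x hx
    rw [iteratedDeriv_succ, iteratedDeriv_one, hd2, (hd1 t ht).deriv,
      laplacian_eq_sum_cubeDeriv (hm2 t htI) hx, ← hw0 t htI x hxK, ← hp0 t htI x hxK] at h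
    exact pde_rearrange h
  have hspace : ∀ t ∈ Ioo 0 T, ∀ x ∈ closedCube d,
      p 1 t x = p 0 t x ⨯₃ (α • p 1 t x + (α * τ) • p 2 t x - w 0 t x) := by
    intro t ht
    have htI := Ioo_subset_Icc_self ht
    exact (show EqOn (p 1 t) (fun x => p 0 t x ⨯₃ (α • p 1 t x + (α * τ) • p 2 t x - w 0 t x))
      (cube d) from hint t ht).of_subset_closure (hpc 1 (by norm_num) t htI)
      (continuousOn_cross (hpc 0 (by norm_num) t htI)
        ((((hpc 1 (by norm_num) t htI).const_smul α).add
          ((hpc 2 (by norm_num) t htI).const_smul (α * τ))).sub (hwc t htI)))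
      cube_subset_closedCube closedCube_subset_closure_cube
  intro t ht x hx
  rw [← hp0 t ht x hx]
  have hcl : Icc 0 T ⊆ closure (Ioo 0 T) := by rw [closure_Ioo hT.ne]
  have hc := fun j hj => (hp x hx).continuousOn (j := j) hj
  exact (show EqOn (fun t => p 1 t x)
    (fun t => p 0 t x ⨯₃ (α • p 1 t x + (α * τ) • p 2 t x - w 0 t x))
    (Ioo 0 T) from fun s hs => hspace s hs x hx).of_subset_closure (hc 1 (by norm_num))
      (continuousOn_cross (hc 0 (by norm_num))
        ((((hc 1 (by norm_num)).const_smul α).add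
          ((hc 2 (by norm_num)).const_smul (α * τ))).sub (hw x hx))) Ioo_subset_Icc_self hcl ht

/-- The second time derivative of a solution in terms of lower order derivatives. -/
theorem second_time_deriv_eq {α τ : ℝ} (hα : α ≠ 0) (hτ : τ ≠ 0) {M a b w : Vec}
    (hM : M ⬝ᵥ M = 1) (hb : M ⬝ᵥ b = - (a ⬝ᵥ a)) (h : a = M ⨯₃ (α • a + (α * τ) • b - w)) :
    b = -((a ⬝ᵥ a) • M) - (α * τ)⁻¹ • (M ⨯₃ (a + M ⨯₃ w - α • (M ⨯₃ a))) := by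
  -- The equation determines only the tangential part of `b`; the constraint gives the part along
  -- `M`, and the triple product identity puts them together.
  have h1 : M ⨯₃ b = (α * τ)⁻¹ • (a + M ⨯₃ w - α • (M ⨯₃ a)) := by
    have h0 : a + M ⨯₃ w - α • (M ⨯₃ a) =
        M ⨯₃ (α • a + (α * τ) • b - w) + M ⨯₃ w - α • (M ⨯₃ a) := by rw [← h]
    rw [h0]
    simp only [map_add, map_sub, map_smul]
    have : α • (M ⨯₃ a) + (α * τ) • (M ⨯₃ b) - M ⨯₃ w + M ⨯₃ w - α • (M ⨯₃ a) =
      (α * τ) • (M ⨯₃ b) := by abel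
    rw [this, inv_smul_smul₀ (mul_ne_zero hα hτ)]
  have h2 := cross_cross_self M b
  rw [hM, hb, one_smul, h1, map_smul] at h2
  rw [h2]; simp

theorem dot_second_deriv {T : ℝ} (hT : 0 < T) {p : ℕ → ℝ → Vec} (hp : IsDerivChain T 2 p)
    (hu : ∀ t ∈ Icc 0 T, p 0 t ⬝ᵥ p 0 t = 1) :
    ∀ t ∈ Icc 0 T, p 0 t ⬝ᵥ p 2 t = - (p 1 t ⬝ᵥ p 1 t) := by
  have hud := uniqueDiffOn_Icc hT
  have h1 : ∀ t ∈ Icc 0 T, p 0 t ⬝ᵥ p 1 t = 0 := by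
    intro t ht
    have h := hp 0 (by norm_num) t ht
    have h2 := (hasDerivWithinAt_dot h h).congr_of_mem (f₁ := fun _ => (1 : ℝ))
      (fun s hs => (hu s hs).symm) ht
    have h3 := (hud t ht).eq_deriv _ h2 (hasDerivWithinAt_const _ _ _)
    rw [dotProduct_comm (p (0 + 1) t)] at h3
    linarith
  intro t ht
  have h2 := (hasDerivWithinAt_dot (hp 0 (by norm_num) t ht) (hp 1 (by norm_num) t ht)).congr_of_mem
    (f₁ := fun _ => (0 : ℝ)) (fun s hs => (h1 s hs).symm) ht
  have h3 := (hud t ht).eq_deriv _ h2 (hasDerivWithinAt_const _ _ _)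
  linarith

/-! ### Additional regularity in time -/

/-- Triples of continuous functions on the closed cube. -/
abbrev Triple (d : ℕ) : Type := Fin 3 → C(closedCube d, ℝ)

/-- The components of a field of `j`-linear maps evaluated at given vectors. -/
def toTriple {j : ℕ} (v : Fin j → Space d) : CubeForms d j →L[ℝ] Triple d :=
  ContinuousLinearMap.pi fun c =>
    ContinuousLinearMap.compLeftContinuous ℝ (closedCube d)
      ((ContinuousLinearMap.proj c).comp
        (ContinuousMultilinearMap.apply ℝ (fun _ : Fin j => Space d) Vec v))

/-- Evaluation of a triple of functions at a point. -/
def evalTriple (y : closedCube d) : Triple d →L[ℝ] Vec :=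
  ContinuousLinearMap.pi fun c => (ContinuousMap.evalCLM ℝ y).comp (ContinuousLinearMap.proj c)

theorem evalTriple_apply (y : closedCube d) (a : Triple d) (c : Fin 3) :
    evalTriple y a c = a c y := rfl

theorem evalTriple_cross (y : closedCube d) (a b : Triple d) :
    evalTriple y (a ⨯₃ b) = evalTriple y a ⨯₃ evalTriple y b := by
  ext c
  fin_cases c <;> simp [evalTriple_apply, cross_apply]

theorem evalTriple_dot_smul (y : closedCube d) (a b : Triple d) :
    evalTriple y ((a ⬝ᵥ a) • b) = (evalTriple y a ⬝ᵥ evalTriple y a) • evalTriple y b := by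
  ext c
  simp [evalTriple_apply, dotProduct, Fin.sum_univ_three]

theorem norm_evalTriple_le (y : closedCube d) (a : Triple d) : ‖evalTriple y a‖ ≤ ‖a‖ := by
  refine (pi_norm_le_iff_of_nonneg (norm_nonneg a)).2 fun c => ?_
  rw [evalTriple_apply]
  exact ((a c).norm_coe_le_norm y).trans (norm_le_pi_norm a c)

theorem contDiffOn_dot_smul {R : Type*} [NormedCommRing R] [NormedAlgebra ℝ R] {n : WithTop ℕ∞}
    {f g : ℝ → Fin 3 → R} {S : Set ℝ} (hf : ContDiffOn ℝ n f S) (hg : ContDiffOn ℝ n g S) :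
    ContDiffOn ℝ n (fun t => (f t ⬝ᵥ f t) • g t) S := by
  have hf := contDiffOn_pi.1 hf
  have hg := contDiffOn_pi.1 hg
  refine contDiffOn_pi.2 fun i => ?_
  exact ContDiffOn.mul (ContDiffOn.sum fun j _ => (hf j).mul (hf j)) (hg i)

theorem contDiffOn_clm_comp {E E' : Type*} [NormedAddCommGroup E] [NormedSpace ℝ E]
    [NormedAddCommGroup E'] [NormedSpace ℝ E'] {n : WithTop ℕ∞} {f : ℝ → E} {S : Set ℝ}
    (hf : ContDiffOn ℝ n f S) (L : E →L[ℝ] E') : ContDiffOn ℝ n (fun t => L (f t)) S :=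
  L.contDiff.comp_contDiffOn hf

/-- By the equation, the second time derivative of a solution is itself twice differentiable in
time, so that the solution has four bounded time derivatives. -/
theorem exists_second_deriv_chain {α τ T : ℝ} (hα : 0 < α) (hτ : 0 < τ) (hT : 0 < T)
    {P : ℕ → ℝ → CubeForms d 0} {R : ℝ → CubeForms d 2}
    (hP0 : ContDiffOn ℝ 2 (P 0) (Icc 0 T)) (hP1 : ContDiffOn ℝ 2 (P 1) (Icc 0 T))
    (hR : ContDiffOn ℝ 2 R (Icc 0 T))
    (hunit : ∀ t ∈ Icc 0 T, ∀ x ∈ closedCube d, valAt (P 0 t) ![] x ⬝ᵥ valAt (P 0 t) ![] x = 1)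
    (hP : IsDerivChain T 2 P)
    (hpde : ∀ t ∈ Icc 0 T, ∀ x ∈ closedCube d,
      valAt (P 1 t) ![] x = valAt (P 0 t) ![] x ⨯₃ (α • valAt (P 1 t) ![] x +
        (α * τ) • valAt (P 2 t) ![] x - ∑ i, valAt (R t) (fun _ => unitVec i) x)) :
    ∃ A : ℕ → ℝ → Triple d, IsDerivChain T 2 A ∧
      (∀ t ∈ Icc 0 T, ∀ x : closedCube d, evalTriple x (A 0 t) = valAt (P 2 t) ![] x) ∧
      ∃ M, 0 ≤ M ∧ ∀ j ≤ 2, ∀ t ∈ Icc 0 T, ‖A j t‖ ≤ M := by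
  -- The formula of `second_time_deriv_eq` is read in `Triple d`, where the products are algebra
  -- operations. It contains `P 0`, `P 1` and the Laplacian, all `C²` in time, hence so is the
  -- second time derivative.
  set b : ℝ → Triple d := fun t => toTriple ![] (P 0 t) with hb
  set a : ℝ → Triple d := fun t => toTriple ![] (P 1 t) with ha
  set ω : ℝ → Triple d := fun t => ∑ i, toTriple (fun _ => unitVec i) (R t) with hω
  have hbc : ContDiffOn ℝ 2 b (Icc 0 T) := contDiffOn_clm_comp hP0 (toTriple ![])
  have hac : ContDiffOn ℝ 2 a (Icc 0 T) := contDiffOn_clm_comp hP1 (toTriple ![])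
  have hωc : ContDiffOn ℝ 2 ω (Icc 0 T) :=
    ContDiffOn.sum fun i _ => contDiffOn_clm_comp hR (toTriple fun _ => unitVec i)
  have hAc : ContDiffOn ℝ (2 : ℕ) (fun t => -((a t ⬝ᵥ a t) • b t) -
      (α * τ)⁻¹ • (b t ⨯₃ (a t + b t ⨯₃ ω t - α • (b t ⨯₃ a t)))) (Icc 0 T) := by
    refine ((contDiffOn_dot_smul hac hbc).neg).sub (ContDiffOn.const_smul _ ?_)
    exact contDiffOn_cross hbc
      ((hac.add (contDiffOn_cross hbc hωc)).sub ((contDiffOn_cross hbc hac).const_smul α))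
  obtain ⟨A, hA0, hA, -, hAM⟩ := exists_derivChain hT hAc
  refine ⟨A, hA, fun t ht x => ?_, hAM⟩
  have ex : ∀ (j : ℕ) (v : Fin j → Space d) (φ : CubeForms d j),
      evalTriple x (toTriple v φ) = valAt φ v x := by
    intro j v φ
    rw [valAt_of_mem _ _ x.2]; rfl
  have e := second_time_deriv_eq hα.ne' hτ.ne' (hunit t ht x x.2)
    (dot_second_deriv hT (hP.valAt ![] x) (fun s hs => hunit s hs x x.2) t ht) (hpde t ht x x.2)
  rw [e, hA0]
  simp only [map_sub, map_neg, map_smul, evalTriple_cross, evalTriple_dot_smul, map_add, hb, ha, hω,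
    map_sum, ex]

end

/-! ### From the regularity classes to uniform bounds -/

section

variable {d N : ℕ}

/-- A bound that holds for almost all times holds for all times if both sides are continuous. -/
theorem le_of_ae_of_continuousOn {T c : ℝ} (hT : 0 < T) {q : ℝ → Prop} {φ : ℝ → ℝ}
    (hq : ∀ᵐ t ∂(volume.restrict (Icc (0 : ℝ) T)), q t) (hφ : ContinuousOn φ (Icc 0 T))
    (h : ∀ t ∈ Icc 0 T, q t → φ t ≤ c) : ∀ t ∈ Icc 0 T, φ t ≤ c := by
  rw [ae_restrict_iff' measurableSet_Icc] at hq
  -- A set of full measure is dense, and a closed inequality between continuous functions extends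
  -- from a dense set.
  have hd : Dense {t : ℝ | t ∈ Icc 0 T → q t} := Measure.dense_of_ae hq
  have hcl : Icc 0 T ⊆ closure (Ioo 0 T ∩ {t : ℝ | t ∈ Icc 0 T → q t}) := by
    have h1 : closure (Ioo 0 T) ⊆ closure (Ioo 0 T ∩ {t : ℝ | t ∈ Icc 0 T → q t}) :=
      closure_minimal (hd.open_subset_closure_inter isOpen_Ioo) isClosed_closure
    rwa [closure_Ioo hT.ne] at h1
  intro t ht
  have hsub : Ioo 0 T ∩ {t : ℝ | t ∈ Icc 0 T → q t} ⊆ Icc 0 T :=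
    fun s hs => Ioo_subset_Icc_self hs.1
  exact ContinuousWithinAt.closure_le (hcl ht) ((hφ t ht).mono hsub) continuousWithinAt_const
    fun s hs => h s (hsub hs) (hs.2 (hsub hs))

theorem prod_norm_unitVec (j : ℕ) (i : Fin d) : ∏ _l : Fin j, ‖unitVec i‖ = 1 := by
  simp [norm_unitVec]

/-- The assumed regularity gives all the bounds of the consistency analysis. -/
theorem exists_solutionBounds {α τ T : ℝ} (hα : 0 < α) (hτ : 0 < τ) (hT : 0 < T)
    {m₀ : Space d → Vec} {m : ℝ → Space d → Vec} (hm : IsSolution d α τ T m₀ m)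
    (hreg₃ : CjIntoCr d T 3 0 m) (hreg₂ : CjIntoCr d T 2 2 m) (hreg₄ : LinftyIntoCr d T 4 m) :
    ∃ p w g B, SolutionBounds α τ T m p w g B := by
  have hm2 : ∀ t ∈ Icc 0 T, ContDiffOn ℝ 2 (m t) (closedCube d) := hreg₂.1
  have hm1 : ∀ t ∈ Icc 0 T, ContDiffOn ℝ 1 (m t) (closedCube d) :=
    fun t ht => (hm2 t ht).of_le (by norm_num)
  obtain ⟨U, hU, hUc⟩ := hreg₃.2 0 le_rfl
  obtain ⟨U₁, hU₁, hU₁c⟩ := hreg₂.2 1 (by norm_num)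
  obtain ⟨U₂, hU₂, hU₂c⟩ := hreg₂.2 2 le_rfl
  obtain ⟨P, hP0, hP, hPc, MP, hMP0, hMP⟩ := exists_derivChain hT hUc
  obtain ⟨Q, hQ0, hQ, -, MQ, hMQ0, hMQ⟩ := exists_derivChain hT hU₁c
  obtain ⟨R, hR0, hR, -, MR, hMR0, hMR⟩ := exists_derivChain hT hU₂c
  rw [← hP0] at hU
  rw [← hQ0] at hU₁
  rw [← hR0] at hU₂
  have hp0 : ∀ t ∈ Icc 0 T, ∀ x ∈ closedCube d, valAt (P 0 t) ![] x = m t x := by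
    intro t ht x hx
    rw [valAt_of_mem _ _ hx, hU t ht]; simp
  have hq0 : ∀ t ∈ Icc 0 T, ∀ x ∈ closedCube d, ∀ v, valAt (Q 0 t) v x = cubeDeriv 1 (m t) x v := by
    intro t ht x hx v
    rw [valAt_of_mem _ _ hx, hU₁ t ht]
  have hr0 : ∀ t ∈ Icc 0 T, ∀ x ∈ closedCube d, ∀ v, valAt (R 0 t) v x = cubeDeriv 2 (m t) x v := by
    intro t ht x hx v
    rw [valAt_of_mem _ _ hx, hU₂ t ht]
  set w : ℕ → ℝ → Space d → Vec := fun j t x => ∑ i, valAt (R j t) (fun _ => unitVec i) x with hw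
  have hwd : ∀ x, IsDerivChain T 2 fun j t => w j t x :=
    fun x => IsDerivChain.sum fun i => hR.valAt (fun _ => unitVec i) x
  have hw0 : ∀ t ∈ Icc 0 T, ∀ x ∈ closedCube d,
      w 0 t x = ∑ i, cubeDeriv 2 (m t) x (fun _ => unitVec i) :=
    fun t ht x hx => Finset.sum_congr rfl fun i _ => hr0 t ht x hx _
  have hpde : ∀ t ∈ Icc 0 T, ∀ x ∈ closedCube d, valAt (P 1 t) ![] x = m t x ⨯₃
      (α • valAt (P 1 t) ![] x + (α * τ) • valAt (P 2 t) ![] x - w 0 t x) :=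
    pde_of_interior hT hm hm2 (p := fun j t x => valAt (P j t) ![] x) (fun x _ => hP.valAt ![] x)
      hp0 (fun j _ t _ => continuousOn_valAt _ _)
      (fun x _ => (hwd x).continuousOn (by norm_num)) hw0
      (fun t _ => continuousOn_finsetSum _ fun i _ => continuousOn_valAt _ _)
  have hP' : IsDerivChain T 2 P := fun j hj => hP j (by omega)
  obtain ⟨A, hA, hA0, MA, hMA0, hMA⟩ := exists_second_deriv_chain hα hτ hT (P := P) (R := R 0)
    (by rw [hP0]; exact hUc.of_le (by norm_num)) (hPc 2 (by norm_num)) (by rw [hR0]; exact hU₂c)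
    (fun t ht x hx => by rw [hp0 t ht x hx]; exact hm.unit t ht x hx) hP'
    (fun t ht x hx => by
      have := hpde t ht x hx
      rwa [← hp0 t ht x hx] at this)
  obtain ⟨M4, hM4⟩ := hreg₄
  -- the higher time derivatives
  classical
  set a : ℕ → ℝ → Space d → Vec := fun j t x =>
    if h : x ∈ closedCube d then evalTriple ⟨x, h⟩ (A j t) else 0 with ha
  have ha_mem : ∀ j t x (h : x ∈ closedCube d), a j t x = evalTriple ⟨x, h⟩ (A j t) :=
    fun j t x h => dif_pos h
  -- The chain is spliced at order two: from there on it uses the derivatives supplied by the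
  -- equation, which reach order four.
  set p : ℕ → ℝ → Space d → Vec := fun j t x =>
    if j < 2 then valAt (P j t) ![] x else a (j - 2) t x with hp
  have hp01 : ∀ j < 2, ∀ t x, p j t x = valAt (P j t) ![] x := 
    fun j hj t x => if_pos hj
  have hp2 : ∀ t ∈ Icc 0 T, ∀ x ∈ closedCube d, p 2 t x = valAt (P 2 t) ![] x := by
    intro t ht x hx
    have : p 2 t x = a 0 t x := if_neg (lt_irrefl 2)
    rw [this, ha_mem _ _ _ hx, hA0 t ht ⟨x, hx⟩]
  have hpge : ∀ j, 2 ≤ j → ∀ t x, p j t x = a (j - 2) t x := fun j hj t x =>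
    if_neg (not_lt.2 hj)
  have hpd : ∀ x ∈ closedCube d, IsDerivChain T 4 fun j t => p j t x := by
    intro x hx j hj t ht
    by_cases h2 : j < 2
    · have h := hP'.valAt ![] x j h2 t ht
      have e : ∀ i ≤ 2, ∀ s ∈ Icc 0 T, p i s x = valAt (P i s) ![] x := by
        intro i hi s hs
        rcases hi.lt_or_eq with h | rfl
        · exact hp01 i h s x
        · exact hp2 s hs x hx
      dsimp only
      rw [e (j + 1) (by omega) t ht]
      exact h.congr_of_mem (fun s hs => e j h2.le s hs) ht
    · have h := hA.clm (evalTriple ⟨x, hx⟩) (j - 2) (by omega) t ht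
      dsimp only at h ⊢
      rw [show j - 2 + 1 = j + 1 - 2 by omega, ← ha_mem, ← hpge (j + 1) (by omega)] at h
      refine h.congr_of_mem (fun s _ => ?_) ht
      rw [← ha_mem _ _ _ hx, ← hpge j (by omega)]
  have hlap : ∀ t ∈ Icc 0 T, ∀ N : ℕ, 0 < N → ∀ l : Idx d N,
      ‖discLaplacian (nodal N (m t)) l - w 0 t (node l)‖ ≤ 2 * d * M4 * mesh N ^ 2 := by
    intro t ht N hN l
    have hmc : ∀ x ∈ closedCube d, ContinuousOn (fun t => m t x) (Icc 0 T) := fun x hx =>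
      ((hP.valAt ![] x).continuousOn (j := 0) (by norm_num)).congr fun s hs =>
        (hp0 s hs x hx).symm
    -- Four space derivatives are available only for almost every time, but at a fixed node the
    -- consistency error is continuous in time.
    refine le_of_ae_of_continuousOn hT (φ := fun t =>
      ‖discLaplacian (nodal N (m t)) l - w 0 t (node l)‖) hM4 ?_ ?_ t ht
    · refine (ContinuousOn.sub ?_ ((hwd (node l)).continuousOn (by norm_num))).norm
      refine continuousOn_finsetSum _ fun i _ => ?_
      exact (((hmc _ (node_mem hN (next i l))).sub
        ((hmc _ (node_mem hN l)).const_smul (2 : ℝ))).add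
        (hmc _ (node_mem hN (prev i l)))).const_smul (1 / mesh N ^ 2)
    · rintro s hs ⟨hs4, hsM⟩
      have hn : ∀ x ∈ closedCube d, ∀ i, (x i = 0 ∨ x i = 1) →
          cubeDeriv 1 (m s) x (fun _ => unitVec i) = 0 := by
        intro x hx i hi
        have := hm.neumann s hs x hx i hi
        rw [cubeDeriv, iteratedFDerivWithin_one_apply (uniqueDiffOn_closedCube d x hx)]
        exact this
      rw [hw0 s hs _ (node_mem hN l)]
      refine norm_discLaplacian_sub_le hs4 (fun x hx => hsM 4 le_rfl x hx) hn ?_ hN l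
      intro x hx i hi
      -- The Neumann condition holds at all times, so it is inherited by the time derivatives of the
      -- gradient. Through `hasDerivWithinAt_valAt_line` this gives the hypotheses on `a` and `b` in
      -- `cubeDeriv_three_normal`.
      have hface : ∀ j ≤ 2, ∀ t ∈ Icc 0 T, valAt (Q j t) (fun _ => unitVec i) x = 0 := by
        refine (hQ.valAt (fun _ => unitVec i) x).eq_zero hT fun r hr => ?_
        rw [hq0 r hr x hx, cubeDeriv, iteratedFDerivWithin_one_apply
          (uniqueDiffOn_closedCube d x hx)]
        exact hm.neumann r hr x hx i hi
      have hline : ∀ j ≤ 2, HasDerivWithinAt (fun r => valAt (P j s) ![] (line x i r)) 0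
          (Icc 0 1) (x i) := by
        intro j hj
        have h := hasDerivWithinAt_valAt_line hT hm1 hU hU₁ hP' hQ hx i hj hs (hx i)
        rwa [line_self, hface j hj s hs] at h
      have hb := ((hline 1 (by norm_num)).fun_const_smul α).fun_add
        ((hline 2 le_rfl).fun_const_smul (α * τ))
      rw [smul_zero, smul_zero, add_zero] at hb
      exact cubeDeriv_three_normal (hs4.of_le (by norm_num)) (hm.unit s hs) hn
        (a := valAt (P 1 s) ![])
        (b := fun y => α • valAt (P 1 s) ![] y + (α * τ) • valAt (P 2 s) ![] y)
        (fun y hy => by rw [← hw0 s hs y hy]; exact hpde s hs y hy) hx hi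
        (hline 1 (by norm_num)) hb
  set g : Fin d → ℝ → Space d → Vec := fun i t x => valAt (Q 0 t) (fun _ => unitVec i) x with hg
  set B : ℝ := MP + MQ + d * MR + MR + MA + 2 * d * |M4| with hB
  have hd : (0 : ℝ) ≤ d := Nat.cast_nonneg d
  have hdR : 0 ≤ d * MR := by positivity
  have hd4 : 0 ≤ 2 * d * |M4| := by positivity
  refine ⟨p, w, g, B, ?_⟩
  constructor
  · positivity
  · exact hm.unit
  · intro t ht x hx
    rw [hp01 0 (by norm_num), hp0 t ht x hx]
  · exact hpd
  · intro j hj t ht x hx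
    by_cases h2 : j < 2
    · rw [hp01 j h2]
      have h := norm_valAt_le (P j t) ![] x
      rw [Finset.univ_eq_empty, Finset.prod_empty, mul_one] at h
      have := hMP j (by omega) t ht
      linarith
    · rw [hpge j (by omega), ha_mem _ _ _ hx]
      have h := norm_evalTriple_le ⟨x, hx⟩ (A (j - 2) t)
      have := hMA (j - 2) (by omega) t ht
      linarith
  · exact fun x _ => hwd x
  · intro j hj t ht x hx
    have h : ‖w j t x‖ ≤ ∑ _i : Fin d, MR := by
      refine norm_sum_le_of_le _ fun i _ => (norm_valAt_le _ _ _).trans ?_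
      rw [prod_norm_unitVec, mul_one]
      exact hMR j hj t ht
    simp only [Finset.sum_const, Finset.card_univ, Fintype.card_fin, nsmul_eq_mul] at h
    linarith
  · intro i t ht x hx
    have h := norm_valAt_le (Q 0 t) (fun _ => unitVec i) x
    rw [prod_norm_unitVec, mul_one] at h
    have := hMQ 0 (by norm_num) t ht
    linarith
  · intro i t ht t' ht' x hx
    have h := (convex_Icc 0 T).norm_image_sub_le_of_norm_hasDerivWithin_le
      (f := fun t => g i t x) (f' := fun t => valAt (Q 1 t) (fun _ => unitVec i) x) (C := MQ)
      (hQ.valAt (fun _ => unitVec i) x 0 (by norm_num)) (fun s hs => by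
        refine (norm_valAt_le _ _ _).trans ?_
        rw [prod_norm_unitVec, mul_one]
        exact hMQ 1 (by norm_num) s hs) ht' ht
    rw [Real.norm_eq_abs] at h
    exact h.trans (mul_le_mul_of_nonneg_right (by linarith) (abs_nonneg _))
  · intro i j t ht x hx s hs s' hs'
    have h := (convex_Icc (0 : ℝ) 1).norm_image_sub_le_of_norm_hasDerivWithin_le
      (f := fun s => cubeDeriv 1 (m t) (line x i s) fun _ => unitVec j)
      (C := MR) (fun s hs => hasDerivWithinAt_cubeDeriv_line (n := 2) (j := 1) (hm2 t ht)
        (by norm_num) hx i (fun _ => unitVec j) hs) (fun s hs => by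
        rw [← hr0 t ht _ (line_mem hx i hs)]
        refine (norm_valAt_le _ _ _).trans ?_
        rw [cons_const_one, Fin.prod_univ_two]
        simp only [Matrix.cons_val_zero, Matrix.cons_val_one, norm_unitVec, mul_one]
        exact hMR 0 (by norm_num) t ht) hs' hs
    rw [Real.norm_eq_abs] at h
    simp only [hg]
    rw [hq0 t ht _ (line_mem hx i hs), hq0 t ht _ (line_mem hx i hs')]
    exact h.trans (mul_le_mul_of_nonneg_right (by linarith) (abs_nonneg _))
  · intro i t ht x hx s hs
    simp only [hg]
    rw [hq0 t ht _ (line_mem hx i hs)]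
    exact hasDerivWithinAt_line (hm1 t ht) hx i hs
  · intro t ht x hx
    rw [hp01 1 (by norm_num), hp2 t ht x hx]
    exact hpde t ht x hx
  · intro t ht x hx
    rw [hw0 t ht x hx, dotProduct_sum, ← Finset.sum_neg_distrib]
    refine Finset.sum_congr rfl fun i _ => ?_
    simp only [hg]
    rw [hq0 t ht x hx]
    exact dot_cubeDeriv_two (hm2 t ht) (hm.unit t ht) hx i
  · intro t ht N hN l
    refine (hlap t ht N hN l).trans (mul_le_mul_of_nonneg_right ?_ (sq_nonneg _))
    have : 2 * d * M4 ≤ 2 * d * |M4| :=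
      mul_le_mul_of_nonneg_left (le_abs_self _) (by positivity)
    linarith

end

section

variable {d N : ℕ}

/-! ### The effective field of the exact solution -/

/-- The field `V` with `D = u × V` and `u`-component determined by the gradient `G` and by `D`. -/
def effField (c : ℝ) (u D : Vec) (G : Fin d → Vec) : Vec :=
  -((u ⬝ᵥ u)⁻¹ • (u ⨯₃ D)) + (∑ i, G i ⬝ᵥ G i - c * (D ⬝ᵥ D)) • u

theorem cross_effField {c : ℝ} {u D : Vec} {G : Fin d → Vec} (hu : u ⬝ᵥ u ≠ 0) (hD : u ⬝ᵥ D = 0) :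
    u ⨯₃ effField c u D G = D := by
  have h := cross_cross_self u D
  rw [hD, zero_smul, zero_sub] at h
  simp only [effField, map_add, map_neg, map_smul, h, cross_self, smul_zero, add_zero, smul_neg,
    neg_neg]
  rw [inv_smul_smul₀ hu]

theorem norm_smul_sub_smul_le {s s' L η η' C : ℝ} {a a' : Vec} (hs : |s| ≤ L) (ha : ‖a'‖ ≤ C)
    (hd : |s - s'| ≤ η) (hd' : ‖a - a'‖ ≤ η') : ‖s • a - s' • a'‖ ≤ L * η' + η * C := by
  have e : s • a - s' • a' = s • (a - a') + (s - s') • a' := by module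
  rw [e]
  refine (norm_add_le _ _).trans (add_le_add ?_ ?_)
  · rw [norm_smul, Real.norm_eq_abs]
    exact mul_le_mul hs hd' (norm_nonneg _) ((abs_nonneg _).trans hs)
  · rw [norm_smul, Real.norm_eq_abs]
    exact mul_le_mul hd ha (norm_nonneg _) ((abs_nonneg _).trans hd)

theorem abs_dot_sub_dot_le {a a' b b' : Vec} {B η : ℝ} (ha : ‖a‖ ≤ B) (hb' : ‖b'‖ ≤ B)
    (hda : ‖a - a'‖ ≤ η) (hdb : ‖b - b'‖ ≤ η) : |a ⬝ᵥ b - a' ⬝ᵥ b'| ≤ 6 * B * η := by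
  have e : a ⬝ᵥ b - a' ⬝ᵥ b' = a ⬝ᵥ (b - b') + (a - a') ⬝ᵥ b' := by
    simp only [dotProduct_sub, sub_dotProduct]; ring
  have hB := (norm_nonneg _).trans ha
  have hη := (norm_nonneg _).trans hda
  have h1 := mul_le_mul ha hdb (norm_nonneg _) hB
  have h2 := mul_le_mul hda hb' (norm_nonneg _) hη
  rw [e]
  refine (abs_add_le _ _).trans ?_
  linarith [abs_dot_le a (b - b'), abs_dot_le (a - a') b']

theorem norm_cross_sub_cross_le {a a' b b' : Vec} {B η : ℝ} (ha : ‖a‖ ≤ B) (hb' : ‖b'‖ ≤ B)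
    (hda : ‖a - a'‖ ≤ η) (hdb : ‖b - b'‖ ≤ η) : ‖a ⨯₃ b - a' ⨯₃ b'‖ ≤ 4 * B * η := by
  have e : a ⨯₃ b - a' ⨯₃ b' = a ⨯₃ (b - b') + (a - a') ⨯₃ b' := by
    simp only [map_sub, LinearMap.sub_apply]; abel
  have hB := (norm_nonneg _).trans ha
  have hη := (norm_nonneg _).trans hda
  have h1 := mul_le_mul ha hdb (norm_nonneg _) hB
  have h2 := mul_le_mul hda hb' (norm_nonneg _) hη
  rw [e]
  refine (norm_add_le _ _).trans ?_
  linarith [norm_cross_le a (b - b'), norm_cross_le (a - a') b']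

theorem norm_cross_le_of_le {a b : Vec} {B : ℝ} (ha : ‖a‖ ≤ B) (hb : ‖b‖ ≤ B) :
    ‖a ⨯₃ b‖ ≤ 2 * B ^ 2 := by
  have h := mul_le_mul ha hb (norm_nonneg _) ((norm_nonneg _).trans ha)
  linarith [norm_cross_le a b]

theorem abs_dot_self_le {a : Vec} {B : ℝ} (ha : ‖a‖ ≤ B) : |a ⬝ᵥ a| ≤ 3 * B ^ 2 := by
  have h := mul_le_mul ha ha (norm_nonneg _) ((norm_nonneg _).trans ha)
  linarith [abs_dot_le a a]

theorem abs_inv_le_two {s : ℝ} (hs : 1 / 2 ≤ s) : |s⁻¹| ≤ 2 := by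
  rw [abs_of_pos (by positivity)]
  exact inv_le_of_inv_le₀ (by norm_num) (by linarith)

theorem abs_inv_sub_inv_le {s s' η : ℝ} (hs : 1 / 2 ≤ s) (hs' : 1 / 2 ≤ s') (h : |s - s'| ≤ η) :
    |s⁻¹ - s'⁻¹| ≤ 4 * η := by
  have h0 : s ≠ 0 := by positivity
  have h0' : s' ≠ 0 := by positivity
  have e : s⁻¹ - s'⁻¹ = s⁻¹ * s'⁻¹ * (s' - s) := by field_simp
  rw [e, abs_mul, abs_mul, abs_sub_comm]
  have h1 := mul_le_mul (abs_inv_le_two hs) (abs_inv_le_two hs') (abs_nonneg _) (by norm_num)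
  have h2 := mul_le_mul h1 h (abs_nonneg _) (by norm_num)
  linarith

theorem abs_effField_coeff_le {c B : ℝ} (hc : 0 ≤ c) {D : Vec} {G : Fin d → Vec}
    (hD : ‖D‖ ≤ B) (hG : ∀ i, ‖G i‖ ≤ B) :
    |∑ i, G i ⬝ᵥ G i - c * (D ⬝ᵥ D)| ≤ 3 * (d + c) * B ^ 2 := by
  have h1 : |∑ i, G i ⬝ᵥ G i| ≤ ∑ _i : Fin d, 3 * B ^ 2 :=
    (Finset.abs_sum_le_sum_abs _ _).trans (Finset.sum_le_sum fun i _ => abs_dot_self_le (hG i))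
  simp only [Finset.sum_const, Finset.card_univ, Fintype.card_fin, nsmul_eq_mul] at h1
  have h2 : |c * (D ⬝ᵥ D)| ≤ c * (3 * B ^ 2) := by
    rw [abs_mul, abs_of_nonneg hc]
    exact mul_le_mul_of_nonneg_left (abs_dot_self_le hD) hc
  refine (abs_sub _ _).trans ?_
  linarith

/-- Lipschitz continuity of the effective field. -/
theorem norm_effField_sub_le {c B η : ℝ} (hc : 0 ≤ c) {u u' D D' : Vec} {G G' : Fin d → Vec}
    (hu : ‖u‖ ≤ B) (hu' : ‖u'‖ ≤ B) (hD : ‖D‖ ≤ B) (hD' : ‖D'‖ ≤ B)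
    (hG : ∀ i, ‖G i‖ ≤ B) (hG' : ∀ i, ‖G' i‖ ≤ B)
    (h1 : 1 / 2 ≤ u ⬝ᵥ u) (h1' : 1 / 2 ≤ u' ⬝ᵥ u')
    (du : ‖u - u'‖ ≤ η) (dD : ‖D - D'‖ ≤ η) (dG : ∀ i, ‖G i - G' i‖ ≤ η) :
    ‖effField c u D G - effField c u' D' G'‖ ≤
      (8 * B + 48 * B ^ 3 + 9 * (d + c) * B ^ 2) * η := by
  have hB := (norm_nonneg _).trans hu
  have t1 : ‖(u ⬝ᵥ u)⁻¹ • (u ⨯₃ D) - (u' ⬝ᵥ u')⁻¹ • (u' ⨯₃ D')‖ ≤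
      2 * (4 * B * η) + 4 * (6 * B * η) * (2 * B ^ 2) :=
    norm_smul_sub_smul_le (abs_inv_le_two h1) (norm_cross_le_of_le hu' hD')
      (abs_inv_sub_inv_le h1 h1' (abs_dot_sub_dot_le hu hu' du du))
      (norm_cross_sub_cross_le hu hD' du dD)
  have t2 : |(∑ i, G i ⬝ᵥ G i - c * (D ⬝ᵥ D)) - (∑ i, G' i ⬝ᵥ G' i - c * (D' ⬝ᵥ D'))| ≤
      6 * (d + c) * B * η := by
    have e : (∑ i, G i ⬝ᵥ G i - c * (D ⬝ᵥ D)) - (∑ i, G' i ⬝ᵥ G' i - c * (D' ⬝ᵥ D')) =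
        ∑ i, (G i ⬝ᵥ G i - G' i ⬝ᵥ G' i) - c * (D ⬝ᵥ D - D' ⬝ᵥ D') := by
      rw [Finset.sum_sub_distrib]; ring
    have a1 : |∑ i, (G i ⬝ᵥ G i - G' i ⬝ᵥ G' i)| ≤ ∑ _i : Fin d, 6 * B * η :=
      (Finset.abs_sum_le_sum_abs _ _).trans (Finset.sum_le_sum fun i _ =>
        abs_dot_sub_dot_le (hG i) (hG' i) (dG i) (dG i))
    simp only [Finset.sum_const, Finset.card_univ, Fintype.card_fin, nsmul_eq_mul] at a1
    have a2 : |c * (D ⬝ᵥ D - D' ⬝ᵥ D')| ≤ c * (6 * B * η) := by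
      rw [abs_mul, abs_of_nonneg hc]
      exact mul_le_mul_of_nonneg_left (abs_dot_sub_dot_le hD hD' dD dD) hc
    rw [e]
    refine (abs_sub _ _).trans ?_
    linarith
  have t3 := norm_smul_sub_smul_le (abs_effField_coeff_le hc hD hG) hu' t2 du
  have e : effField c u D G - effField c u' D' G' =
      -((u ⬝ᵥ u)⁻¹ • (u ⨯₃ D) - (u' ⬝ᵥ u')⁻¹ • (u' ⨯₃ D')) +
      ((∑ i, G i ⬝ᵥ G i - c * (D ⬝ᵥ D)) • u - (∑ i, G' i ⬝ᵥ G' i - c * (D' ⬝ᵥ D')) • u') := by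
    unfold effField; abel
  rw [e]
  refine (norm_add_le _ _).trans ?_
  rw [norm_neg]
  linarith

theorem norm_effField_le {c B : ℝ} (hc : 0 ≤ c) {u D : Vec} {G : Fin d → Vec}
    (hu : ‖u‖ ≤ B) (hD : ‖D‖ ≤ B) (hG : ∀ i, ‖G i‖ ≤ B) (h1 : 1 / 2 ≤ u ⬝ᵥ u) :
    ‖effField c u D G‖ ≤ 4 * B ^ 2 + 3 * (d + c) * B ^ 3 := by
  have hB := (norm_nonneg _).trans hu
  unfold effField
  refine (norm_add_le _ _).trans ?_
  rw [norm_neg, norm_smul, norm_smul, Real.norm_eq_abs, Real.norm_eq_abs]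
  have a1 := mul_le_mul (abs_inv_le_two h1) (norm_cross_le_of_le hu hD) (norm_nonneg _)
    (by norm_num)
  have hd : (0 : ℝ) ≤ d := Nat.cast_nonneg d
  have a2 := mul_le_mul (abs_effField_coeff_le hc hD hG) hu (norm_nonneg _) (by positivity)
  linarith

/-- On the unit sphere the effective field of a solution is the variational derivative. -/
theorem effField_eq {α τ : ℝ} {M a b w : Vec} {G : Fin d → Vec} (hM : M ⬝ᵥ M = 1)
    (ha : M ⬝ᵥ a = 0) (hb : M ⬝ᵥ b = -(a ⬝ᵥ a)) (hw : M ⬝ᵥ w = - ∑ i, G i ⬝ᵥ G i)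
    (h : a = M ⨯₃ (α • a + (α * τ) • b - w)) :
    effField (α * τ) M a G = α • a + (α * τ) • b - w := by
  have h1 := cross_cross_self M (α • a + (α * τ) • b - w)
  rw [← h, hM, one_smul] at h1
  have h2 : M ⬝ᵥ (α • a + (α * τ) • b - w) = ∑ i, G i ⬝ᵥ G i - α * τ * (a ⬝ᵥ a) := by
    simp only [dotProduct_sub, dotProduct_add, dotProduct_smul, smul_eq_mul, ha, hb, hw]; ring
  rw [h2] at h1
  unfold effField
  rw [hM, inv_one, one_smul, h1]
  abel

/-! ### Consistency -/

namespace SolutionBounds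

variable {α τ T : ℝ} {m : ℝ → Space d → Vec} {p w : ℕ → ℝ → Space d → Vec}
  {g : Fin d → ℝ → Space d → Vec} {B : ℝ}

/-- Lipschitz continuity in time of the lower order time derivatives. -/
theorem p_lipschitz (sb : SolutionBounds α τ T m p w g B) {j : ℕ} (hj : j < 4) {t t' : ℝ}
    (ht : t ∈ Icc 0 T) (ht' : t' ∈ Icc 0 T) {x : Space d} (hx : x ∈ closedCube d) :
    ‖p j t x - p j t' x‖ ≤ B * |t - t'| := by
  have h := (convex_Icc 0 T).norm_image_sub_le_of_norm_hasDerivWithin_le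
    (f := fun t => p j t x) (C := B) (sb.p_deriv x hx j hj)
    (fun s hs => sb.p_bound (j + 1) hj s hs x hx) ht' ht
  rwa [Real.norm_eq_abs] at h

variable {k t : ℝ} {x : Space d}

/-- Time mean and time difference quotient of the exact solution. -/
theorem mean_diff_bounds (sb : SolutionBounds α τ T m p w g B) (hk : 0 < k) (ht : t ∈ Icc 0 T)
    (hp : t + k ∈ Icc 0 T) (hm : t - k ∈ Icc 0 T) (hx : x ∈ closedCube d) :
    ‖(1 / 2 : ℝ) • (m (t + k) x + m (t - k) x) - m t x‖ ≤ B * k ^ 2 ∧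
    ‖(1 / (2 * k)) • (m (t + k) x - m (t - k) x) - p 1 t x‖ ≤ B * k ^ 2 ∧
    ‖(1 / k ^ 2) • (m (t + k) x - (2 : ℝ) • m t x + m (t - k) x) - p 2 t x‖ ≤ 2 * B * k ^ 2 ∧
    ‖(1 / 2 : ℝ) • (m (t + k) x + m (t - k) x)‖ ≤ B ∧
    ‖(1 / (2 * k)) • (m (t + k) x - m (t - k) x)‖ ≤ B := by
  have hd := sb.p_deriv x hx
  simp only [← sb.p_zero t ht x hx, ← sb.p_zero _ hp x hx, ← sb.p_zero _ hm x hx]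
  refine ⟨?_, ?_, ?_, ?_, ?_⟩
  · exact norm_mean_sub_le (F := fun j t => p j t x) (convex_Icc 0 T) hk ht hp hm
      (fun j hj => hd j (by omega)) (fun s hs => sb.p_bound 2 (by norm_num) s hs x hx)
  · exact norm_centralDiff_sub_le (F := fun j t => p j t x) (convex_Icc 0 T) hk ht hp hm
      (fun j hj => hd j (by omega)) (fun s hs => sb.p_bound 3 (by norm_num) s hs x hx)
  · exact norm_secondDiff_sub_le (F := fun j t => p j t x) (convex_Icc 0 T) hk ht hp hm
      (fun j hj => hd j (by omega)) (fun s hs => sb.p_bound 4 (by norm_num) s hs x hx)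
  · refine norm_smul_le_of_le two_pos ((norm_add_le _ _).trans ?_)
    linarith [sb.p_bound 0 (by norm_num) _ hp x hx, sb.p_bound 0 (by norm_num) _ hm x hx]
  · refine norm_smul_le_of_le (by positivity) ((sb.p_lipschitz (by norm_num) hp hm hx).trans ?_)
    rw [show t + k - (t - k) = 2 * k by ring, abs_of_pos (by positivity), mul_comm]

/-- Orthogonality of mean and difference, and the length of the mean. -/
theorem mean_dot (sb : SolutionBounds α τ T m p w g B) (hk : 0 < k) (hkB : k * (3 * B + 1) ≤ 1)
    (ht : t ∈ Icc 0 T) (hp : t + k ∈ Icc 0 T) (hm : t - k ∈ Icc 0 T) (hx : x ∈ closedCube d) :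
    ((1 / 2 : ℝ) • (m (t + k) x + m (t - k) x)) ⬝ᵥ
      ((1 / (2 * k)) • (m (t + k) x - m (t - k) x)) = 0 ∧
    1 / 2 ≤ ((1 / 2 : ℝ) • (m (t + k) x + m (t - k) x)) ⬝ᵥ
      ((1 / 2 : ℝ) • (m (t + k) x + m (t - k) x)) := by
  have h1 := sb.unit _ hp x hx
  have h2 := sb.unit _ hm x hx
  have hD := (sb.mean_diff_bounds hk ht hp hm hx).2.2.2.2
  set D := (1 / (2 * k)) • (m (t + k) x - m (t - k) x) with hDdef
  have hDD : D ⬝ᵥ D ≤ 3 * B ^ 2 := (le_abs_self _).trans (abs_dot_self_le hD)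
  have hcomm := dotProduct_comm (m (t - k) x) (m (t + k) x)
  constructor
  · simp only [hDdef, dotProduct_smul, smul_dotProduct, dotProduct_sub, add_dotProduct, smul_eq_mul,
      h1, h2, hcomm]
    ring
  -- Parallelogram identity for two unit vectors with half sum `u` and half difference `k D`. The
  -- assumption `hkB` makes `k² |D|²` at most `1/3`.
  · have e : ((1 / 2 : ℝ) • (m (t + k) x + m (t - k) x)) ⬝ᵥ
        ((1 / 2 : ℝ) • (m (t + k) x + m (t - k) x)) = 1 - k ^ 2 * (D ⬝ᵥ D) := by
      simp only [hDdef, dotProduct_smul, smul_dotProduct, dotProduct_sub, sub_dotProduct,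
        add_dotProduct, dotProduct_add, smul_eq_mul, h1, h2, hcomm]
      field_simp; ring
    rw [e]
    have h3 := mul_le_mul_of_nonneg_left hDD (sq_nonneg k)
    have h4 : (k * (3 * B)) ^ 2 ≤ 1 ^ 2 := by
      have := sb.nonneg
      exact pow_le_pow_left₀ (by positivity) (by linarith) 2
    nlinarith

/-- The effective field of the exact solution at time `t` for the time step `k`. -/
def field (_ : SolutionBounds α τ T m p w g B) (k t : ℝ) (x : Space d) : Vec :=
  effField (α * τ) ((1 / 2 : ℝ) • (m (t + k) x + m (t - k) x))
    ((1 / (2 * k)) • (m (t + k) x - m (t - k) x)) (fun i => g i t x)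

theorem cross_field (sb : SolutionBounds α τ T m p w g B) (hk : 0 < k) (hkB : k * (3 * B + 1) ≤ 1)
    (ht : t ∈ Icc 0 T) (hp : t + k ∈ Icc 0 T) (hm : t - k ∈ Icc 0 T) (hx : x ∈ closedCube d) :
    (1 / (2 * k)) • (m (t + k) x - m (t - k) x) =
      ((1 / 2 : ℝ) • (m (t + k) x + m (t - k) x)) ⨯₃ sb.field k t x := by
  obtain ⟨h1, h2⟩ := sb.mean_dot hk hkB ht hp hm hx
  exact (cross_effField (by linarith) h1).symm

theorem norm_field_le (sb : SolutionBounds α τ T m p w g B) (hc : 0 ≤ α * τ) (hk : 0 < k)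
    (hkB : k * (3 * B + 1) ≤ 1) (ht : t ∈ Icc 0 T) (hp : t + k ∈ Icc 0 T) (hm : t - k ∈ Icc 0 T)
    (hx : x ∈ closedCube d) :
    ‖sb.field k t x‖ ≤ 4 * B ^ 2 + 3 * (d + α * τ) * B ^ 3 := by
  obtain ⟨-, -, -, h4, h5⟩ := sb.mean_diff_bounds hk ht hp hm hx
  exact norm_effField_le hc h4 h5 (fun i => sb.g_bound i t ht x hx)
    (sb.mean_dot hk hkB ht hp hm hx).2

/-- The Lipschitz constant of the effective field. -/
def lipConst (d : ℕ) (c B : ℝ) : ℝ := 8 * B + 48 * B ^ 3 + 9 * (d + c) * B ^ 2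

theorem lipConst_nonneg {c : ℝ} (hc : 0 ≤ c) (hB : 0 ≤ B) : 0 ≤ lipConst d c B := by
  unfold lipConst; positivity

/-- This bounds the increment of `V` that summation by parts in time leaves behind. No second
difference quotient enters the field, so Lipschitz bounds for the mean, the first quotient and the
gradient are enough. -/
theorem norm_field_time_sub_le (sb : SolutionBounds α τ T m p w g B) (hc : 0 ≤ α * τ) (hk : 0 < k)
    (hk1 : k ≤ 1) (hkB : k * (3 * B + 1) ≤ 1) (ht : t ∈ Icc 0 T) (hp : t + k ∈ Icc 0 T)
    (hpp : t + k + k ∈ Icc 0 T) (hm : t - k ∈ Icc 0 T) (hx : x ∈ closedCube d) :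
    ‖sb.field k (t + k) x - sb.field k t x‖ ≤ lipConst d (α * τ) B * (3 * B * k) := by
  have hB := sb.nonneg
  have hm' : t + k - k ∈ Icc 0 T := by rwa [add_sub_cancel_right]
  obtain ⟨-, a2, -, a4, a5⟩ := sb.mean_diff_bounds hk ht hp hm hx
  obtain ⟨-, b2, -, b4, b5⟩ := sb.mean_diff_bounds hk hp hpp hm' hx
  have hlip : ∀ j < 4, ∀ s ∈ Icc 0 T, s + k ∈ Icc 0 T → ‖p j (s + k) x - p j s x‖ ≤ B * k := by
    intro j hj s hs hsk
    have := sb.p_lipschitz hj hsk hs hx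
    rwa [add_sub_cancel_left, abs_of_pos hk] at this
  have hBk : 0 ≤ B * k := by positivity
  have hk2 : B * k ^ 2 ≤ B * k := mul_le_mul_of_nonneg_left (by nlinarith) hB
  refine norm_effField_sub_le hc b4 a4 b5 a5 (fun i => sb.g_bound i _ hp x hx)
    (fun i => sb.g_bound i _ ht x hx) (sb.mean_dot hk hkB hp hpp hm' hx).2
    (sb.mean_dot hk hkB ht hp hm hx).2 ?_ ?_ fun i => ?_
  · rw [← smul_sub]
    refine norm_smul_le_of_le two_pos ?_
    have e : m (t + k + k) x + m (t + k - k) x - (m (t + k) x + m (t - k) x) =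
        (p 0 (t + k + k) x - p 0 (t + k) x) + (p 0 (t - k + k) x - p 0 (t - k) x) := by
      rw [add_sub_cancel_right, sub_add_cancel]
      rw [sb.p_zero _ hpp x hx, sb.p_zero _ hp x hx, sb.p_zero _ ht x hx, sb.p_zero _ hm x hx]
      abel
    rw [e]
    refine (norm_add_le _ _).trans ?_
    have h1 := hlip 0 (by norm_num) _ hp hpp
    have h2 := hlip 0 (by norm_num) _ hm (by rwa [sub_add_cancel])
    linarith
  -- Both difference quotients are compared with `p 1`. This costs `2 B k²`, at most `2 B k` as `k ≤
  -- 1`, and explains the factor `3`.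
  · have h1 := hlip 1 (by norm_num) _ ht hp
    have e : ∀ a b c e : Vec, a - b = (a - c) - (b - e) + (c - e) := fun a b c e => by abel
    rw [e _ _ (p 1 (t + k) x) (p 1 t x)]
    refine (norm_add_le _ _).trans ((add_le_add (norm_sub_le _ _) le_rfl).trans ?_)
    linarith
  · have h := sb.g_time i _ hp _ ht x hx
    rw [add_sub_cancel_left, abs_of_pos hk] at h
    linarith

theorem norm_field_space_sub_le (sb : SolutionBounds α τ T m p w g B) (hc : 0 ≤ α * τ) (hk : 0 < k)
    (hkB : k * (3 * B + 1) ≤ 1) (ht : t ∈ Icc 0 T) (hp : t + k ∈ Icc 0 T)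
    (hm : t - k ∈ Icc 0 T) (hx : x ∈ closedCube d) (i : Fin d) {s s' : ℝ} (hs : s ∈ Icc (0 : ℝ) 1)
    (hs' : s' ∈ Icc (0 : ℝ) 1) :
    ‖sb.field k t (line x i s) - sb.field k t (line x i s')‖ ≤
      lipConst d (α * τ) B * (B * |s - s'|) := by
  have hB := sb.nonneg
  have hy := line_mem hx i hs
  have hy' := line_mem hx i hs'
  obtain ⟨-, -, -, a4, a5⟩ := sb.mean_diff_bounds hk ht hp hm hy
  obtain ⟨-, -, -, b4, b5⟩ := sb.mean_diff_bounds hk ht hp hm hy'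
  refine norm_effField_sub_le hc a4 b4 a5 b5 (fun i => sb.g_bound i _ ht _ hy)
    (fun i => sb.g_bound i _ ht _ hy') (sb.mean_dot hk hkB ht hp hm hy).2
    (sb.mean_dot hk hkB ht hp hm hy').2 ?_ ?_ fun j => ?_
  · have h := (convex_Icc (0 : ℝ) 1).norm_image_sub_le_of_norm_hasDerivWithin_le
      (f := fun s => m (t + k) (line x i s) + m (t - k) (line x i s)) (C := 2 * B)
      (fun r hr => (sb.m_line i _ hp x hx r hr).fun_add (sb.m_line i _ hm x hx r hr))
      (fun r hr => (norm_add_le _ _).trans (by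
        linarith [sb.g_bound i _ hp _ (line_mem hx i hr), sb.g_bound i _ hm _ (line_mem hx i hr)]))
      hs' hs
    rw [Real.norm_eq_abs] at h
    rw [← smul_sub]
    exact norm_smul_le_of_le two_pos (by linarith)
  -- The space derivative of the difference quotient is a difference quotient of the gradient,
  -- bounded uniformly in `k` by the Lipschitz continuity of the gradient in time.
  · have h := (convex_Icc (0 : ℝ) 1).norm_image_sub_le_of_norm_hasDerivWithin_le
      (f := fun s => m (t + k) (line x i s) - m (t - k) (line x i s)) (C := 2 * k * B)
      (fun r hr => (sb.m_line i _ hp x hx r hr).fun_sub (sb.m_line i _ hm x hx r hr))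
      (fun r hr => by
        have := sb.g_time i _ hp _ hm _ (line_mem hx i hr)
        rw [show t + k - (t - k) = 2 * k by ring, abs_of_pos (by positivity)] at this
        linarith)
      hs' hs
    rw [Real.norm_eq_abs] at h
    rw [← smul_sub]
    exact norm_smul_le_of_le (by positivity) (by linarith)
  · exact sb.g_space i j t ht x hx s hs s' hs'

/-- The discrete equation is satisfied up to second order. -/
theorem norm_field_sub_le (sb : SolutionBounds α τ T m p w g B) (hα : 0 < α) (hτ : 0 < τ)
    (hT : 0 < T) (hk : 0 < k) (hkB : k * (3 * B + 1) ≤ 1) (ht : t ∈ Icc 0 T) (hp : t + k ∈ Icc 0 T)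
    (hm : t - k ∈ Icc 0 T) (hN : 0 < N) (l : Idx d N) :
    ‖sb.field k t (node l) - (α • (1 / (2 * k)) • (m (t + k) (node l) - m (t - k) (node l)) +
      (α * τ) • (1 / k ^ 2) • (m (t + k) (node l) - (2 : ℝ) • m t (node l) + m (t - k) (node l)) -
      (1 / 2 : ℝ) • (discLaplacian (nodal N (m (t + k))) l +
        discLaplacian (nodal N (m (t - k))) l))‖ ≤
      (lipConst d (α * τ) B * B + α * B + 2 * (α * τ) * B + B) * (k ^ 2 + mesh N ^ 2) := by
  have hB := sb.nonneg
  have hat : 0 < α * τ := mul_pos hα hτ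
  have hx := node_mem hN l
  set x := node l with hxdef
  obtain ⟨a1, a2, a3, a4, a5⟩ := sb.mean_diff_bounds hk ht hp hm hx
  have hunit := sb.unit t ht x hx
  have hpu : ∀ s ∈ Icc 0 T, p 0 s x ⬝ᵥ p 0 s x = 1 := fun s hs => by
    rw [sb.p_zero s hs x hx]; exact sb.unit s hs x hx
  have hpde := sb.pde t ht x hx
  have hMa : m t x ⬝ᵥ p 1 t x = 0 := by rw [hpde]; exact dot_self_cross _ _
  have hMb := dot_second_deriv hT (p := fun j t => p j t x)
    (fun j hj => sb.p_deriv x hx j (by omega)) hpu t ht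
  rw [sb.p_zero t ht x hx] at hMb
  have heff : effField (α * τ) (m t x) (p 1 t x) (fun i => g i t x) =
      α • p 1 t x + (α * τ) • p 2 t x - w 0 t x :=
    effField_eq hunit hMa hMb (sb.dot_w t ht x hx) hpde
  have hmB : ‖m t x‖ ≤ B := by
    rw [← sb.p_zero t ht x hx]; exact sb.p_bound 0 (by norm_num) t ht x hx
  -- The mean and the difference quotient are within `B k²` of `m` and `p 1`, so Lipschitz
  -- continuity of `effField` compares the field with its value on the sphere, which `heff`
  -- identifies.
  have t1 : ‖sb.field k t x - effField (α * τ) (m t x) (p 1 t x) (fun i => g i t x)‖ ≤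
      lipConst d (α * τ) B * (B * k ^ 2) :=
    norm_effField_sub_le hat.le a4 hmB a5 (sb.p_bound 1 (by norm_num) t ht x hx)
      (fun i => sb.g_bound i t ht x hx) (fun i => sb.g_bound i t ht x hx)
      (sb.mean_dot hk hkB ht hp hm hx).2 (by rw [hunit]; norm_num) a1 a2
      (fun i => by rw [sub_self, norm_zero]; positivity)
  have t2 : ‖(1 / 2 : ℝ) • (w 0 (t + k) x + w 0 (t - k) x) - w 0 t x‖ ≤ B * k ^ 2 :=
    norm_mean_sub_le (F := fun j t => w j t x) (convex_Icc 0 T) hk ht hp hm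
      (fun j hj => sb.w_deriv x hx j (by omega)) (fun s hs => sb.w_bound 2 le_rfl s hs x hx)
  have l1 := sb.lap _ hp N hN l
  have l2 := sb.lap _ hm N hN l
  have t3 : ‖(1 / 2 : ℝ) • ((discLaplacian (nodal N (m (t + k))) l - w 0 (t + k) x) +
      (discLaplacian (nodal N (m (t - k))) l - w 0 (t - k) x))‖ ≤ B * mesh N ^ 2 :=
    norm_smul_le_of_le two_pos ((norm_add_le _ _).trans (by linarith))
  set D := (1 / (2 * k)) • (m (t + k) x - m (t - k) x)
  set D2 := (1 / k ^ 2) • (m (t + k) x - (2 : ℝ) • m t x + m (t - k) x)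
  have e : sb.field k t x - (α • D + (α * τ) • D2 -
      (1 / 2 : ℝ) • (discLaplacian (nodal N (m (t + k))) l +
        discLaplacian (nodal N (m (t - k))) l)) =
      (sb.field k t x - effField (α * τ) (m t x) (p 1 t x) (fun i => g i t x)) -
      α • (D - p 1 t x) - (α * τ) • (D2 - p 2 t x) +
      ((1 / 2 : ℝ) • (w 0 (t + k) x + w 0 (t - k) x) - w 0 t x) +
      (1 / 2 : ℝ) • ((discLaplacian (nodal N (m (t + k))) l - w 0 (t + k) x) +
      (discLaplacian (nodal N (m (t - k))) l - w 0 (t - k) x)) := by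
    rw [heff]; module
  rw [e]
  have s1 : ‖α • (D - p 1 t x)‖ ≤ α * (B * k ^ 2) := by
    rw [norm_smul, Real.norm_eq_abs, abs_of_pos hα]
    exact mul_le_mul_of_nonneg_left a2 hα.le
  have s2 : ‖(α * τ) • (D2 - p 2 t x)‖ ≤ α * τ * (2 * B * k ^ 2) := by
    rw [norm_smul, Real.norm_eq_abs, abs_of_pos hat]
    exact mul_le_mul_of_nonneg_left a3 hat.le
  refine (norm_add_le _ _).trans ((add_le_add (norm_add_le _ _) le_rfl).trans ?_)
  refine (add_le_add (add_le_add (norm_sub_le _ _) le_rfl) le_rfl).trans ?_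
  refine (add_le_add (add_le_add (add_le_add (norm_sub_le _ _) le_rfl) le_rfl) le_rfl).trans ?_
  have hL : 0 ≤ lipConst d (α * τ) B * B := mul_nonneg (lipConst_nonneg hat.le hB) hB
  have h2 : 0 ≤ (lipConst d (α * τ) B * B + α * B + 2 * (α * τ) * B) * mesh N ^ 2 := by positivity
  linarith

end SolutionBounds

end

section

variable {d N : ℕ}

/-! ### The error equation and convergence -/

/-- Passage from the sup norm to the Euclidean one; `√3` is rounded up to `2`. -/
theorem dot_self_le_of_norm_le {a : Vec} {C : ℝ} (h : ‖a‖ ≤ C) : a ⬝ᵥ a ≤ (2 * C) ^ 2 := by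
  have := (le_abs_self _).trans (abs_dot_self_le h)
  nlinarith [sq_nonneg C]

/-- The error equation: `u, u'` are exact and numerical means, and so on. -/
theorem error_equation {α τ : ℝ} {u D D2 L V u' D' D2' L' : Vec} (hV : D = u ⨯₃ V)
    (h : D' - α • (u' ⨯₃ (D' + τ • D2')) = -(u' ⨯₃ L')) :
    D - D' = (u - u') ⨯₃ V + u' ⨯₃ (α • (D - D') + (α * τ) • (D2 - D2') - (L - L') +
      (V - (α • D + (α * τ) • D2 - L))) := by
  -- The scheme in the same form as the exact relation `D = u × V`. In the difference `V` goes with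
  -- the error of the mean, and `u'` with everything that testing will remove.
  have h' : D' = u' ⨯₃ (α • D' + (α * τ) • D2' - L') :=
    pde_rearrange (by rw [← h]; abel)
  have e : α • (D - D') + (α * τ) • (D2 - D2') - (L - L') + (V - (α • D + (α * τ) • D2 - L)) =
      V - (α • D' + (α * τ) • D2' - L') := by module
  have h1 : u' ⨯₃ (V - (α • D' + (α * τ) • D2' - L')) = u' ⨯₃ V - D' := by
    rw [map_sub (crossProduct u'), ← h']
  rw [e, h1, map_sub, LinearMap.sub_apply, ← hV]
  abel

theorem timeDiff_error (k : ℝ) (m : ℝ → Space d → Vec) (mh : ℕ → Grid d N) (n : ℕ) :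
    timeDiff k (error k m mh) n =
      timeDiff k (fun n => nodal N (m (n * k))) n - timeDiff k mh n := by
  simp only [timeDiff, error]; module

theorem timeDiffTwo_error (k : ℝ) (m : ℝ → Space d → Vec) (mh : ℕ → Grid d N) (n : ℕ) :
    timeDiffTwo k (error k m mh) n =
      timeDiffTwo k (fun n => nodal N (m (n * k))) n - timeDiffTwo k mh n := by
  simp only [timeDiffTwo, error]; module

theorem timeMean_error (k : ℝ) (m : ℝ → Space d → Vec) (mh : ℕ → Grid d N) (n : ℕ) :
    timeMean (error k m mh) n = timeMean (fun n => nodal N (m (n * k))) n - timeMean mh n := by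
  simp only [timeMean, error]; module

theorem sq_le_of_add_le {a b c : ℝ} (ha : 0 ≤ a) (hb : 0 ≤ b) (h : a + b ≤ c) :
    a ^ 2 ≤ c ^ 2 ∧ b ^ 2 ≤ c ^ 2 :=
  ⟨pow_le_pow_left₀ ha (by linarith) 2, pow_le_pow_left₀ hb (by linarith) 2⟩

theorem time_mem_Icc {T k : ℝ} (hT : 0 < T) (hk : 0 < k) {n : ℕ} (hn : n ≤ ⌊T / k⌋₊) :
    (n : ℝ) * k ∈ Icc 0 T := by
  refine ⟨by positivity, ?_⟩
  rw [← le_div_iff₀ hk]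
  exact (Nat.cast_le.2 hn).trans (Nat.floor_le (by positivity))

namespace SolutionBounds

variable {α τ T : ℝ} {m : ℝ → Space d → Vec} {p w : ℕ → ℝ → Space d → Vec}
  {g : Fin d → ℝ → Space d → Vec} {B k : ℝ}

theorem nodes_mem (hT : 0 < T) (hk : 0 < k) {n : ℕ} (hn : 1 ≤ n) (hn1 : n + 1 ≤ ⌊T / k⌋₊) :
    (n : ℝ) * k ∈ Icc 0 T ∧ (n : ℝ) * k + k ∈ Icc 0 T ∧ (n : ℝ) * k - k ∈ Icc 0 T := by
  have h1 := time_mem_Icc hT hk (n := n) (by omega)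
  have h2 := time_mem_Icc hT hk hn1
  have h3 := time_mem_Icc hT hk (n := n - 1) (by omega)
  rw [Nat.cast_sub hn] at h3
  push_cast at h2 h3
  exact ⟨h1, by convert h2 using 1; ring, by convert h3 using 1; ring⟩

theorem norm_discGrad_field_le (sb : SolutionBounds α τ T m p w g B) (hc : 0 ≤ α * τ) (hk : 0 < k)
    (hkB : k * (3 * B + 1) ≤ 1) {t : ℝ} (ht : t ∈ Icc 0 T) (hp : t + k ∈ Icc 0 T)
    (hm : t - k ∈ Icc 0 T) (hN : 0 < N) (i : Fin d) (l : Idx d N) :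
    ‖discGrad i (nodal N (sb.field k t)) l‖ ≤ lipConst d (α * τ) B * B := by
  have hh := mesh_pos hN
  have hL : 0 ≤ lipConst d (α * τ) B * B := mul_nonneg (lipConst_nonneg hc sb.nonneg) sb.nonneg
  unfold discGrad
  refine norm_smul_le_of_le hh ?_
  by_cases hl : (l i : ℕ) + 1 < N
  · have hx := node_mem hN l
    have hs := node_mem hN (next i l) i
    rw [node_next hl, line_apply, if_pos rfl] at hs
    have h := sb.norm_field_space_sub_le hc hk hkB ht hp hm hx i hs (hx i)
    rw [line_self, ← node_next hl, add_sub_cancel_left, abs_of_pos hh] at h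
    exact h.trans (le_of_eq (by ring))
  · rw [next_eq_self hl, sub_self, norm_zero]; positivity

end SolutionBounds

theorem errSq_one_le {k C₀ ε : ℝ} {e : ℕ → Grid d N}
    (h : ∀ p ≤ 2, normTwo (e p) + normGrad (e p) ≤ C₀ * ε)
    (h' : ∀ q ≤ 1, normTwo ((1 / k) • (e (q + 1) - e q)) ≤ C₀ * ε) :
    errSq k e 1 ≤ 5 * C₀ ^ 2 * ε ^ 2 := by
  have n0 : ∀ f : Grid d N, 0 ≤ normTwo f := fun f => Real.sqrt_nonneg _
  have n1 : ∀ f : Grid d N, 0 ≤ normGrad f := fun f => Real.sqrt_nonneg _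
  obtain ⟨a1, a2⟩ := sq_le_of_add_le (n0 _) (n1 _) (h 1 (by norm_num))
  obtain ⟨b1, b2⟩ := sq_le_of_add_le (n0 _) (n1 _) (h 2 le_rfl)
  have c1 := pow_le_pow_left₀ (n0 _) (h' 1 le_rfl) 2
  rw [normTwo_sq, mul_pow] at a1 b1 c1
  rw [normGrad_sq, mul_pow] at a2 b2
  unfold errSq
  norm_num at a1 a2 b1 b2 c1 ⊢
  linarith

theorem norm_add_le_of_errSq_le {k C ε : ℝ} (hC : 0 ≤ C) (hε : 0 ≤ ε) {e : ℕ → Grid d N} {n : ℕ}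
    (h : errSq k e n ≤ C * ε ^ 2) :
    normTwo (e (n + 1)) + normGrad (e (n + 1)) ≤ 2 * √C * ε := by
  have q1 := ip_self_nonneg ((1 / k) • (e (n + 1) - e n))
  have q2 := ip_self_nonneg (e (n + 1))
  have q3 := ip_self_nonneg (e n)
  have q4 := gradSq_nonneg (e (n + 1))
  have q5 := gradSq_nonneg (e n)
  unfold errSq at h
  have hs : (√C * ε) ^ 2 = C * ε ^ 2 := by rw [mul_pow, Real.sq_sqrt hC]
  have h1 : normTwo (e (n + 1)) ≤ √C * ε := by
    refine le_of_sq_le_sq ?_ (by positivity)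
    rw [normTwo_sq, hs]; linarith
  have h2 : normGrad (e (n + 1)) ≤ √C * ε := by
    refine le_of_sq_le_sq ?_ (by positivity)
    rw [normGrad_sq, hs]; linarith
  linarith

end

end ILLG

end

/-! ### The convergence theorem -/

theorem theorem3p1 (d : ℕ) (hd : 1 ≤ d ∧ d ≤ 3) (α τ T : ℝ) (hα : 0 < α) (hτ : 0 < τ) (hT : 0 < T)
    (m₀ : ILLG.Space d → ILLG.Vec) (m : ℝ → ILLG.Space d → ILLG.Vec)
    (hm : ILLG.IsSolution d α τ T m₀ m)
    (hreg₃ : ILLG.CjIntoCr d T 3 0 m) (hreg₂ : ILLG.CjIntoCr d T 2 2 m)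
    (hreg₄ : ILLG.LinftyIntoCr d T 4 m)
    (C₀ : ℝ) :
    ∃ C > 0, ∃ δ > 0, ∀ (N : ℕ) (k : ℝ), 0 < N → ILLG.mesh N < δ → 0 < k → k < δ →
      ∀ mh : ℕ → ILLG.Grid d N, ILLG.IsNumerical α τ T k mh →
        (∀ p ≤ 2, ILLG.normTwo (ILLG.error k m mh p) + ILLG.normGrad (ILLG.error k m mh p) ≤
          C₀ * (k ^ 2 + ILLG.mesh N ^ 2)) →
        (∀ q ≤ 1, ILLG.normTwo
            ((1 / k) • (ILLG.error k m mh (q + 1) - ILLG.error k m mh q)) ≤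
          C₀ * (k ^ 2 + ILLG.mesh N ^ 2)) →
        ∀ n : ℕ, 2 ≤ n → n ≤ ⌊T / k⌋₊ →
          ILLG.normTwo (ILLG.error k m mh n) + ILLG.normGrad (ILLG.error k m mh n) ≤
            C * (k ^ 2 + ILLG.mesh N ^ 2) := by
  open ILLG in
  obtain ⟨p, w, g, B, sb⟩ := exists_solutionBounds hα hτ hT hm hreg₃ hreg₂ hreg₄
  have hB := sb.nonneg
  have hat : 0 < α * τ := mul_pos hα hτ
  set c₁ : ℝ := 4 * B ^ 2 + 3 * (d + α * τ) * B ^ 3 with hc₁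
  set c₂ : ℝ := SolutionBounds.lipConst d (α * τ) B with hc₂
  set c₃ : ℝ := c₂ * B + α * B + 2 * (α * τ) * B + B with hc₃
  have hc₁0 : 0 ≤ c₁ := by positivity
  have hc₂0 : 0 ≤ c₂ := SolutionBounds.lipConst_nonneg hat.le hB
  have hc₂B : 0 ≤ c₂ * B := mul_nonneg hc₂0 hB
  have hc₃0 : 0 ≤ c₃ := by positivity
  -- One constant for all hypotheses of the stability theorem: `c₁` bounds the field, `c₂ * B` its
  -- space differences, `3 * (c₂ * B)` its time differences per step `k`, and `c₃` the consistency
  -- error. The factor `2` is that of `dot_self_le_of_norm_le`.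
  set K : ℝ := 2 * (c₁ + 3 * (c₂ * B) + c₃) with hK
  have hK0 : 0 ≤ K := by positivity
  have hmono : ∀ {a : Vec} {c : ℝ}, ‖a‖ ≤ c → 2 * c ≤ K → a ⬝ᵥ a ≤ K ^ 2 := by
    intro a c ha hc
    exact (dot_self_le_of_norm_le ha).trans
      (pow_le_pow_left₀ (by linarith [norm_nonneg a]) hc 2)
  obtain ⟨C, hC, δ, hδ, hstab⟩ := exists_errSq_le d hα hτ hT hK0 (5 * C₀ ^ 2) (by positivity)
  refine ⟨2 * √C, by positivity, min δ (min 1 (1 / (3 * B + 1))), by positivity, ?_⟩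
  intro N k hN _ hk hkδ mh hmh hinit hinit' n hn hnT
  have hk1 : k ≤ 1 := (hkδ.trans_le ((min_le_right _ _).trans (min_le_left _ _))).le
  have hkB : k * (3 * B + 1) ≤ 1 := by
    have h := hkδ.trans_le ((min_le_right _ _).trans (min_le_right _ _))
    rw [lt_div_iff₀ (by positivity)] at h
    exact h.le
  have hkδ' : k < δ := hkδ.trans_le (min_le_left _ _)
  set ε : ℝ := k ^ 2 + mesh N ^ 2 with hε
  have hε0 : 0 ≤ ε := by positivity
  set ex : ℕ → Grid d N := fun n => nodal N (m (n * k)) with hex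
  set V : ℕ → Grid d N := fun n => nodal N (sb.field k (n * k)) with hV
  set ρ : ℕ → Grid d N := fun n => V n - (α • timeDiff k ex n + (α * τ) • timeDiffTwo k ex n -
    discLaplacian (timeMean ex n)) with hρ
  have hplus : ∀ n : ℕ, ((n + 1 : ℕ) : ℝ) * k = n * k + k := fun n => by push_cast; ring
  have hminus : ∀ n : ℕ, 1 ≤ n → ((n - 1 : ℕ) : ℝ) * k = n * k - k := fun n hn => by
    rw [Nat.cast_sub hn]; push_cast; ring
  -- The index is `n - 1` because `errSq` at `n - 1` contains the error at level `n`.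
  have hmain := hstab N k hN hk hkδ' ε (error k m mh) V ρ (timeMean mh) ?_ ?_
    (errSq_one_le hinit hinit') (n - 1) (by omega) (by omega)
  · have h := norm_add_le_of_errSq_le hC.le hε0 hmain
    rwa [Nat.sub_add_cancel (by omega : 1 ≤ n)] at h
  · intro n hn hnT
    obtain ⟨ht, htp, htm⟩ := SolutionBounds.nodes_mem hT hk hn hnT
    have hD : ∀ l, timeDiff k ex n l = (1 / (2 * k)) •
        (m (n * k + k) (node l) - m (n * k - k) (node l)) := fun l => by
      rw [← hplus, ← hminus n hn]; rfl
    have hD2 : ∀ l, timeDiffTwo k ex n l = (1 / k ^ 2) •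
        (m (n * k + k) (node l) - (2 : ℝ) • m (n * k) (node l) + m (n * k - k) (node l)) :=
      fun l => by rw [← hplus, ← hminus n hn]; rfl
    have hM : ∀ l, timeMean ex n l = (1 / 2 : ℝ) •
        (m (n * k + k) (node l) + m (n * k - k) (node l)) := fun l => by
      rw [← hplus, ← hminus n hn]; rfl
    have hL : ∀ l, discLaplacian (timeMean ex n) l = (1 / 2 : ℝ) •
        (discLaplacian (nodal N (m (n * k + k))) l +
          discLaplacian (nodal N (m (n * k - k))) l) := fun l => by
      rw [← hplus, ← hminus n hn, timeMean, discLaplacian_smul, discLaplacian_add]; rfl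
    refine ⟨fun l => ?_, fun l => ?_, fun l => ?_, fun i l => ?_⟩
    · have hx := node_mem hN l
      have hcross : timeDiff k ex n l = timeMean ex n l ⨯₃ V n l := by
        rw [hD, hM]; exact sb.cross_field hk hkB ht htp htm hx
      rw [timeDiff_error, timeDiffTwo_error, timeMean_error, discLaplacian_sub]
      exact error_equation hcross (hmh.scheme n hn hnT l)
    · exact hmono (sb.norm_field_le hat.le hk hkB ht htp htm (node_mem hN l)) (by linarith)
    · have h := sb.norm_field_sub_le hα hτ hT hk hkB ht htp htm hN l
      rw [← hD, ← hD2, ← hL] at h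
      refine (dot_self_le_of_norm_le (a := ρ n l) h).trans ?_
      rw [← mul_assoc]
      exact pow_le_pow_left₀ (by positivity)
        (mul_le_mul_of_nonneg_right (by linarith) hε0) 2
    · exact hmono (sb.norm_discGrad_field_le hat.le hk hkB ht htp htm hN i l) (by linarith)
  · intro n hn hnT l
    obtain ⟨ht, htp, htm⟩ := SolutionBounds.nodes_mem hT hk hn (by omega)
    obtain ⟨-, htpp, -⟩ := SolutionBounds.nodes_mem hT hk (n := n + 1) (by omega) hnT
    rw [hplus] at htpp
    have h := sb.norm_field_time_sub_le hat.le hk hk1 hkB ht htp htpp htm (node_mem hN l)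
    rw [← hplus] at h
    refine (dot_self_le_of_norm_le (a := V (n + 1) l - V n l) h).trans ?_
    refine pow_le_pow_left₀ (by positivity) ?_ 2
    have h3 : 2 * (3 * (c₂ * B)) * k ≤ K * k := mul_le_mul_of_nonneg_right (by linarith) hk.le
    linarith
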